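/- Consider virtual string link diagrams with $n$ strands, i.e. generic immersions of $n$ intervals in the square $[0,1]^2$ (with fixed endpoints, the $i$-th strand joining the $i$-th point of the bottom side to the $i$-th point of the top side) whose double points are labelled as classical (over/under) or virtual crossings, and likewise virtual link diagrams (circles instead of intervals). Diagrams are taken up to planar isotopy, and are called classical if they have no virtual crossing. The *welded Reidemeister moves* are the classical Reidemeister moves R1, R2, R3; the purely virtual versions vR1, vR2, vR3; the mixed move (a strand crossing only virtually passes across a classical crossing); and the over-commute move OC (a strand passing over two others passes across their virtual crossing). A local move replaces the contents of a disk, consisting of unoriented pieces of strands. Consider the following local moves (each can be applied in both directions). - $\mathrm{CC}$ (crossing change): exchange the over and the under branch at a classical crossing. $\mathrm{SC}$: the same, at a crossing between two pieces of one and the same component. - $\Delta$: three pieces of strands $1,2,3$ cross pairwise, with $1$ over $2$, $2$ over $3$ and $3$ over $1$; each piece is pushed across the crossing of the two others, the crossings being kept. - $\mathrm{BP}$ (unoriented band-pass): two parallel pieces pass over two other parallel pieces; all four crossings are changed. - $\mathrm V$ (virtualization): replace a classical crossing by a virtual one. $\mathrm{SV}$: the same, at a crossing between two pieces of one and the same component.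 - $\mathrm{wBP}$ (welded band-pass): as $\mathrm{BP}$, except that one (fixed in advance) of the four crossings is not changed but put between two virtual crossings of the same two pieces of strands, so that the roles of over and under strand are exchanged and the sign is kept. - $\mathrm F$ (fused move): three pieces of strands cross pairwise, $2$ passes under $1$ and over $3$, and $1$ and $3$ cross virtually; strand $2$ is pushed across the virtual crossing of $1$ and $3$. For local moves $M_1,M_2$, write $M_2\stackrel{w}{\Rightarrow}M_1$ if any two virtual string link diagrams (with any number $n$ of strands), and any two virtual link diagrams, which differ by $M_1$ are related by a finite sequence of moves $M_2$ and welded Reidemeister moves. If $M_1,M_2$ involve no virtual crossing, write $M_2\stackrel{c}{\Rightarrow}M_1$ if any two classical string link diagrams, and any two classical link diagrams, which differ by $M_1$ are related by a finite sequence, through classical diagrams, of moves $M_2$ and classical Reidemeister moves. Then $$\mathrm{CC}\stackrel{c}{\Rightarrow}\mathrm{BP}\stackrel{c}{\Rightarrow}\Delta\stackrel{c}{\Rightarrow}\mathrm{SC},\qquad \mathrm{V}\stackrel{w}{\Rightarrow}\mathrm{wBP}\stackrel{w}{\Rightarrow}\mathrm{F}\stackrel{w}{\Rightarrow}\mathrm{SV},$$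 $$\mathrm V\stackrel{w}{\Rightarrow}\mathrm{CC},\qquad \mathrm{wBP}\stackrel{w}{\Rightarrow}\mathrm{BP},\qquad \mathrm F\stackrel{w}{\Rightarrow}\Delta,\qquad \mathrm{SV}\stackrel{w}{\Rightarrow}\mathrm{SC}.$$ -/

import Mathlib

/-!
Virtual string link diagrams and virtual link diagrams in the square, in Morse position.

A diagram is read from bottom to top as a list of elementary layers; a layer carries one minimum
(`cup`), one maximum (`cap`) or one double point, with vertical strands on both sides.  Every
generic immersed diagram is isotopic to such a list, and two lists describe isotopic diagrams if
and only if they are related by the elementary planar isotopies `IsotopyRel` below.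
-/

namespace LocalMoves

/-- The three kinds of (unoriented) double points.  Of the two branches, one joins bottom left to
top right and the other joins bottom right to top left.
`over`: classical, the branch from bottom left to top right is the upper one;
`under`: classical, the branch from bottom left to top right is the lower one;
`virt`: virtual.  The sign of a classical crossing is determined by this and by the orientation of
the strands. -/
inductive Crossing
  | over
  | under
  | virt

/-- The crossing seen after turning the plane by a quarter turn. -/
def Crossing.rot : Crossing → Crossing
  | .over => .under
  | .under => .over
  | .virt => .virt

/-- A crossing is classical if it is not virtual. -/
def Crossing.IsClassical (x : Crossing) : Prop := x ≠ .virt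

/-- The elementary pieces of a diagram. -/
inductive Gen
  | cup
  | cap
  | cross (x : Crossing)

/-- Number of endpoints at the bottom of an elementary piece. -/
def Gen.ins : Gen → ℕ
  | .cup => 0
  | .cap => 2
  | .cross _ => 2

/-- Number of endpoints at the top of an elementary piece. -/
def Gen.outs : Gen → ℕ
  | .cup => 2
  | .cap => 0
  | .cross _ => 2

/-- A word of layers, read from bottom to top.  The layer `(k, g)` is the piece `g` with `k`
vertical strands to its left; the vertical strands to its right are not recorded. -/
abbrev Word := List (ℕ × Gen)

/-- `IsTangle m w n`: the word `w` is a diagram with `m` endpoints at the bottom and `n` endpoints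
at the top. -/
inductive IsTangle : ℕ → Word → ℕ → Prop
  | nil (m : ℕ) : IsTangle m [] m
  | cons (k r : ℕ) (g : Gen) (w : Word) (n : ℕ) (h : IsTangle (k + g.outs + r) w n) :
      IsTangle (k + g.ins + r) ((k, g) :: w) n

/-- The same word with `k` further vertical strands on its left. -/
def shift (k : ℕ) (w : Word) : Word := w.map fun p => (k + p.1, p.2)

/-! ### Strands

The point `(l, i)` is the `i`-th point, counted from the left from `0`, of the horizontal line
below the `l`-th layer (the top line if `l` is the number of layers). -/

/-- Two points are adjacent if they are joined by an arc inside one layer. -/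
inductive Adj (w : Word) : ℕ × ℕ → ℕ × ℕ → Prop
  | left (l k i : ℕ) (g : Gen) (h : w[l]? = some (k, g)) (hi : i < k) : Adj w (l, i) (l + 1, i)
  | right (l k i : ℕ) (g : Gen) (h : w[l]? = some (k, g)) :
      Adj w (l, k + g.ins + i) (l + 1, k + g.outs + i)
  | crossRight (l k : ℕ) (x : Crossing) (h : w[l]? = some (k, .cross x)) :
      Adj w (l, k) (l + 1, k + 1)
  | crossLeft (l k : ℕ) (x : Crossing) (h : w[l]? = some (k, .cross x)) :
      Adj w (l, k + 1) (l + 1, k)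
  | cap (l k : ℕ) (h : w[l]? = some (k, .cap)) : Adj w (l, k) (l, k + 1)
  | cup (l k : ℕ) (h : w[l]? = some (k, .cup)) : Adj w (l + 1, k) (l + 1, k + 1)

/-- Two points of a diagram lie on the same strand (component). -/
def SameStrand (w : Word) : ℕ × ℕ → ℕ × ℕ → Prop := Relation.EqvGen (Adj w)

/-- Virtual string link diagrams on `n` strands: the `i`-th bottom endpoint is joined with the
`i`-th top endpoint, and there is no closed component. -/
def IsStringLink (n : ℕ) (w : Word) : Prop :=
  IsTangle n w n ∧
  (∀ i < n, SameStrand w (0, i) (w.length, i)) ∧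
  ∀ l ≤ w.length, ∀ p, IsTangle n (w.take l) p → ∀ i < p, ∃ j < n, SameStrand w (l, i) (0, j)

/-- Virtual link diagrams. -/
def IsLink (w : Word) : Prop := IsTangle 0 w 0

/-- A diagram is classical if it has no virtual crossing. -/
def IsClassical (w : Word) : Prop := ∀ p ∈ w, p.2 ≠ .cross .virt

/-! ### Local moves -/

/-- A move is a relation between diagrams. -/
abbrev Move := Word → Word → Prop

/-- The move which replaces somewhere in a diagram a subdiagram `u` by `u'`, where `P u u'`. -/
def Locally (P : Word → Word → Prop) : Move := fun D D' =>
  ∃ (A B : Word) (k : ℕ) (u u' : Word),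
    P u u' ∧ D = A ++ shift k u ++ B ∧ D' = A ++ shift k u' ++ B

/-- The move which replaces somewhere in a diagram a crossing `x` between two pieces of the same
strand by a crossing `x'`, where `P x x'`. -/
def SelfLocally (P : Crossing → Crossing → Prop) : Move := fun D D' =>
  ∃ (A B : Word) (k : ℕ) (x x' : Crossing),
    P x x' ∧ D = A ++ (k, .cross x) :: B ∧ D' = A ++ (k, .cross x') :: B ∧
    SameStrand D (A.length, k) (A.length, k + 1)

/-- The layer with a crossing and `k` vertical strands on its left. -/
def cr (k : ℕ) (x : Crossing) : ℕ × Gen := (k, .cross x)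

/-- Three strands, numbered from the left at the bottom, which cross pairwise: first the strands
`1, 2` (in `x`), then `1, 3` (in `y`), then `2, 3` (in `z`). -/
def tri (x y z : Crossing) : Word := [cr 0 x, cr 1 y, cr 0 z]

/-- The same three crossings on the other side of the triangle: first the strands
`2, 3` (in `z`), then `1, 3` (in `y`), then `1, 2` (in `x`). -/
def tri' (x y z : Crossing) : Word := [cr 1 z, cr 0 y, cr 1 x]

/-- Elementary planar isotopies. -/
inductive IsotopyRel : Word → Word → Prop
  /-- Exchange of heights of two distant pieces. -/
  | far (g g' : Gen) (j : ℕ) : IsotopyRel [(0, g), (g.outs + j, g')] [(g.ins + j, g'), (0, g)]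
  /-- Birth or death of a minimum and a maximum. -/
  | zigzag : IsotopyRel [(1, .cup), (0, .cap)] []
  | zigzag' : IsotopyRel [(0, .cup), (1, .cap)] []
  /-- A crossing passes a maximum or a minimum of one of its branches. -/
  | capSlide (x : Crossing) : IsotopyRel [cr 1 x, (0, .cap)] [cr 0 x.rot, (1, .cap)]
  | cupSlide (x : Crossing) : IsotopyRel [(0, .cup), cr 1 x] [(1, .cup), cr 0 x.rot]

/-- The classical Reidemeister moves. -/
inductive ReidRel : Word → Word → Prop
  | r1 (x : Crossing) (hx : x.IsClassical) : ReidRel [(1, .cup), cr 0 x, (1, .cap)] []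
  | r2 (x : Crossing) (hx : x.IsClassical) : ReidRel [cr 0 x, cr 0 x.rot] []
  /-- The three crossings are classical and one of the strands lies above the two others, one
  below the two others. -/
  | r3 (x y z : Crossing) (hx : x.IsClassical) (hy : y.IsClassical) (hz : z.IsClassical)
      (h : y = x ∨ y = z) : ReidRel (tri x y z) (tri' x y z)

/-- The welded Reidemeister moves: the classical and the virtual Reidemeister moves, the mixed move
and the over-commute move. -/
inductive WReidRel : Word → Word → Prop
  | classical (u u' : Word) (h : ReidRel u u') : WReidRel u u'
  | vr1 : WReidRel [(1, .cup), cr 0 .virt, (1, .cap)] []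
  | vr2 : WReidRel [cr 0 .virt, cr 0 .virt] []
  | vr3 : WReidRel (tri .virt .virt .virt) (tri' .virt .virt .virt)
  | mixed (y : Crossing) (hy : y.IsClassical) : WReidRel (tri .virt y .virt) (tri' .virt y .virt)
  /-- Strand 2 passes over the strands 1 and 3, which cross virtually. -/
  | oc : WReidRel (tri .under .virt .over) (tri' .under .virt .over)

/-- Crossing change. -/
inductive CCRel : Word → Word → Prop
  | mk : CCRel [cr 0 .over] [cr 0 .under]

/-- Delta move: three strands, 1 over 2, 2 over 3 and 3 over 1. -/
inductive DeltaRel : Word → Word → Prop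
  | mk : DeltaRel (tri .over .under .over) (tri' .over .under .over)

/-- (Unoriented) band-pass move: a band formed by two strands passes from above to below another
band of two strands. -/
inductive BPRel : Word → Word → Prop
  | mk : BPRel [cr 1 .over, cr 0 .over, cr 2 .over, cr 1 .over]
      [cr 1 .under, cr 0 .under, cr 2 .under, cr 1 .under]

/-- Virtualization: a classical crossing becomes virtual. -/
inductive VRel : Word → Word → Prop
  | mk (x : Crossing) (hx : x.IsClassical) : VRel [cr 0 x] [cr 0 .virt]

/-- Welded band-pass move: as the band-pass move, but one of the four crossings is virtually
conjugated (placed between two virtual crossings) instead of being changed. -/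
inductive WBPRel : Word → Word → Prop
  | mk : WBPRel [cr 1 .over, cr 0 .over, cr 2 .over, cr 1 .over]
      [cr 1 .under, cr 0 .under, cr 2 .under, cr 1 .virt, cr 1 .over, cr 1 .virt]

/-- Fused move: strand 2 passes under strand 1 and over strand 3, which cross virtually. -/
inductive FRel : Word → Word → Prop
  | mk : FRel (tri .over .virt .over) (tri' .over .virt .over)

/-! The moves as relations between diagrams. -/

/-- Crossing change. -/
def CC : Move := Locally CCRel

/-- Band-pass move. -/
def BP : Move := Locally BPRel

/-- Delta move. -/
def Delta : Move := Locally DeltaRel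

/-- Virtualization. -/
def V : Move := Locally VRel

/-- Welded band-pass move. -/
def WBP : Move := Locally WBPRel

/-- Fused move. -/
def F : Move := Locally FRel

/-- Self-crossing change. -/
def SC : Move := SelfLocally fun x x' => x = .over ∧ x' = .under

/-- Self-virtualization. -/
def SV : Move := SelfLocally fun x x' => x.IsClassical ∧ x' = .virt

/-! ### Generation -/

/-- Within the set `K` of diagrams, each application of the move `M₁` can be realized by a finite
sequence of planar isotopies, moves of type `R`, and moves `M₂`, in either direction. -/
def Realizes (K : Set Word) (R : Word → Word → Prop) (M₂ M₁ : Move) : Prop :=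
  ∀ D ∈ K, ∀ D' ∈ K, M₁ D D' →
    Relation.EqvGen
      (fun X Y => X ∈ K ∧ Y ∈ K ∧ (Locally IsotopyRel X Y ∨ Locally R X Y ∨ M₂ X Y)) D D'

/-- `M₂` c-generates `M₁`: on classical string link diagrams with any number of strands, and on
classical link diagrams, `M₁` can be realized using `M₂` and classical Reidemeister moves. -/
def CGenerates (M₂ M₁ : Move) : Prop :=
  (∀ n, Realizes {w | IsStringLink n w ∧ IsClassical w} ReidRel M₂ M₁) ∧
  Realizes {w | IsLink w ∧ IsClassical w} ReidRel M₂ M₁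

/-- `M₂` w-generates `M₁`: on virtual string link diagrams with any number of strands, and on
virtual link diagrams, `M₁` can be realized using `M₂` and welded Reidemeister moves. -/
def WGenerates (M₂ M₁ : Move) : Prop :=
  (∀ n, Realizes {w | IsStringLink n w} WReidRel M₂ M₁) ∧
  Realizes {w | IsLink w} WReidRel M₂ M₁

end LocalMoves

/-! Fix the allowed moves and consider tangle diagrams modulo them. Stacking makes these classes the
morphisms `Hom T n p` of a category, in which crossings are invertible (`u`) and extrema are
morphisms `cap` and `cup`. Every implication except SV to SC is proved as an identity in such a
category. Passing back to string links costs nothing: all moves preserve the way in which the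
strands join the points of a diagram (`StrandEquiv`), so a chain of tangle diagrams which starts at
a string link stays among string links (`realizes_of_mk_eq`).

Write σ for a classical crossing and v for the virtual one on the same places. Given the braid
relation, Delta is equivalent to σ₁σ₂²σ₁⁻¹ = σ₁⁻¹σ₂²σ₁: a clasp of the outer strands may move from
the front to the back of the middle one. From BP one obtains σ² = σ⁻² by closing a band crossing
into the two-cable of a curl (`cable_kink`). Capping one band shows that a finger over two strands
may pass under them (`HasBandPass.flip_two`). If one of these strands turns back at a maximum, this
gives the flip past a single strand (`HasBandPass.conj_sq`).

In the welded case the basic objects are the arrows σv and vσ: two strands cross classically and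
cross back virtually. OC says that two arrows with tails on a common strand commute, and F that a
tail commutes with a head. By R3 heads then commute as well, and Delta is an identity between
commuting arrows (`WeldedTriple.delta_of_fused`). WBP makes arrows involutions
(`HasWeldedBandPass.sq`), hence contains BP. The finger flip of BP, applied to an arrow whose
carrying strand turns back, yields F (`HasWeldedBandPass.hasFused`).

For SC and SV one removes a twist between two pieces of one strand: a full twist under Delta, an
arrow under F. The partner of the twist is first made an auxiliary last strand. The resulting clasp
can be slid along its strand past all crossings and extrema (`Slider`,
`Slider.isSlid_iff_of_sameStrand`), until it is absorbed by a minimum or a maximum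
(`Slider.comp_twist_comp_of_last`). The remaining implications are immediate: under CC or V all the
crossings involved become equal, and SV realizes SC through a virtual crossing. -/

namespace LocalMoves

/-! ### Tangle words -/

theorem isTangle_cons {m n k : ℕ} {g : Gen} {w : Word} :
    IsTangle m ((k, g) :: w) n ↔ ∃ r, m = k + g.ins + r ∧ IsTangle (k + g.outs + r) w n := by
  constructor
  · intro h
    cases h with
    | cons k r g w n h => exact ⟨r, rfl, h⟩
  · rintro ⟨r, rfl, h⟩
    exact .cons k r g w n h

theorem isTangle_nil {m n : ℕ} : IsTangle m [] n ↔ m = n := by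
  constructor
  · intro h
    cases h
    rfl
  · rintro rfl
    exact .nil m

theorem isTangle_append {m n : ℕ} {v w : Word} :
    IsTangle m (v ++ w) n ↔ ∃ p, IsTangle m v p ∧ IsTangle p w n := by
  induction v generalizing m with
  | nil => simp [isTangle_nil]
  | cons a v ih =>
    obtain ⟨k, g⟩ := a
    simp only [List.cons_append, isTangle_cons, ih]
    constructor
    · rintro ⟨r, h, p, h1, h2⟩
      exact ⟨p, ⟨r, h, h1⟩, h2⟩
    · rintro ⟨p, ⟨r, h, h1⟩, h2⟩
      exact ⟨r, h, p, h1, h2⟩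

theorem IsTangle.append {m p n : ℕ} {v w : Word} (h : IsTangle m v p) (h' : IsTangle p w n) :
    IsTangle m (v ++ w) n :=
  isTangle_append.2 ⟨p, h, h'⟩

theorem IsTangle.add_right {m n : ℕ} {w : Word} (h : IsTangle m w n) (a : ℕ) :
    IsTangle (m + a) w (n + a) := by
  induction h with
  | nil m => exact .nil _
  | cons k r g w n h ih =>
    exact isTangle_cons.2 ⟨r + a, by omega, by simpa only [← add_assoc] using ih⟩

theorem IsTangle.unique {m p q : ℕ} {w : Word} (h : IsTangle m w p) (h' : IsTangle m w q) :
    p = q := by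
  induction h with
  | nil m => exact isTangle_nil.1 h'
  | cons k r g w n h ih =>
    obtain ⟨r', h1, h2⟩ := isTangle_cons.1 h'
    obtain rfl : r = r' := by omega
    exact ih h2

theorem isTangle_cross {n k : ℕ} {x : Crossing} (h : k + 2 ≤ n) :
    IsTangle n [(k, .cross x)] n :=
  isTangle_cons.2 ⟨n - (k + 2), by simp only [Gen.ins]; omega,
    isTangle_nil.2 (by simp only [Gen.outs]; omega)⟩

theorem isTangle_cap {n k : ℕ} (h : k ≤ n) : IsTangle (n + 2) [(k, .cap)] n :=
  isTangle_cons.2 ⟨n - k, by simp only [Gen.ins]; omega,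
    isTangle_nil.2 (by simp only [Gen.outs]; omega)⟩

theorem isTangle_cup {n k : ℕ} (h : k ≤ n) : IsTangle n [(k, .cup)] (n + 2) :=
  isTangle_cons.2 ⟨n - k, by simp only [Gen.ins]; omega,
    isTangle_nil.2 (by simp only [Gen.outs]; omega)⟩

/-! ### Diagrams modulo local relations -/

/-- Local relations between words, together with the kinds of crossings that may be used. -/
structure Theory where
  /-- The local relations. -/
  rel : Word → Word → Prop
  /-- The crossings which may be used. -/
  ok : Crossing → Prop

/-- All crossings of the word are allowed in the theory. -/
def Theory.Good (T : Theory) (w : Word) : Prop := ∀ k x, (k, Gen.cross x) ∈ w → T.ok x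

variable {T : Theory}

theorem Theory.Good.append {v w : Word} (h : T.Good v) (h' : T.Good w) : T.Good (v ++ w) := by
  intro k x hx
  rcases List.mem_append.1 hx with hx | hx
  exacts [h k x hx, h' k x hx]

theorem Theory.good_nil : T.Good [] := by
  intro k x hx
  simp at hx

theorem Theory.good_cross {k : ℕ} {x : Crossing} (h : T.ok x) : T.Good [(k, .cross x)] := by
  intro j y hy
  simp only [List.mem_singleton, Prod.mk.injEq, Gen.cross.injEq] at hy
  exact hy.2 ▸ h

theorem Theory.good_cap {k : ℕ} : T.Good [(k, .cap)] := by
  intro j y hy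
  simp at hy

theorem Theory.good_cup {k : ℕ} : T.Good [(k, .cup)] := by
  intro j y hy
  simp at hy

/-- Tangle diagrams with `n` endpoints at the bottom and `p` endpoints at the top. -/
abbrev Diag (T : Theory) (n p : ℕ) := {w : Word // IsTangle n w p ∧ T.Good w}

theorem Locally.append_left {P : Word → Word → Prop} {v w : Word} (h : Locally P v w) (u : Word) :
    Locally P (u ++ v) (u ++ w) := by
  obtain ⟨A, B, k, a, b, hab, rfl, rfl⟩ := h
  exact ⟨u ++ A, B, k, a, b, hab, by simp, by simp⟩

theorem Locally.append_right {P : Word → Word → Prop} {v w : Word} (h : Locally P v w) (u : Word) :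
    Locally P (v ++ u) (w ++ u) := by
  obtain ⟨A, B, k, a, b, hab, rfl, rfl⟩ := h
  exact ⟨A, B ++ u, k, a, b, hab, by simp, by simp⟩

/-- Tangle diagrams modulo the local relations of a theory. -/
def Hom (T : Theory) (n p : ℕ) : Type :=
  Quot fun v w : Diag T n p => Locally T.rel v.1 w.1

/-- The class of a diagram. -/
def Hom.mk (w : Word) {n p : ℕ} (h : IsTangle n w p) (hg : T.Good w) : Hom T n p :=
  Quot.mk _ ⟨w, h, hg⟩

/-- Stacking of diagrams, the first one below the second one. -/
def Hom.comp {n p q : ℕ} : Hom T n p → Hom T p q → Hom T n q :=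
  Quot.map₂ (fun v w => ⟨v.1 ++ w.1, v.2.1.append w.2.1, v.2.2.append w.2.2⟩)
    (fun v _ _ h => h.append_left v.1) (fun _ _ w h => h.append_right w.1)

infixl:72 "⬝" => Hom.comp

/-- The trivial diagram. -/
def Hom.id (n : ℕ) : Hom T n n := Hom.mk [] (.nil n) Theory.good_nil

theorem Hom.comp_assoc {n p q r : ℕ} (f : Hom T n p) (g : Hom T p q) (h : Hom T q r) :
    f ⬝ g ⬝ h = f ⬝ (g ⬝ h) := by
  induction f using Quot.ind
  induction g using Quot.ind
  induction h using Quot.ind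
  exact congrArg (Quot.mk _) (Subtype.ext (List.append_assoc _ _ _))

theorem Hom.id_comp {n p : ℕ} (f : Hom T n p) : Hom.id n ⬝ f = f := by
  induction f using Quot.ind
  rfl

theorem Hom.comp_id {n p : ℕ} (f : Hom T n p) : f ⬝ Hom.id p = f := by
  induction f using Quot.ind
  exact congrArg (Quot.mk _) (Subtype.ext (List.append_nil _))

instance (n : ℕ) : Monoid (Hom T n n) where
  mul f g := f ⬝ g
  one := Hom.id n
  mul_assoc := Hom.comp_assoc
  one_mul := Hom.id_comp
  mul_one := Hom.comp_id

/-- Stacking of an invertible diagram and a diagram. -/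
def Hom.act {n p : ℕ} (g : (Hom T n n)ˣ) (f : Hom T n p) : Hom T n p := g.1 ⬝ f

/-- Stacking of a diagram and an invertible diagram. -/
def Hom.ract {n p : ℕ} (f : Hom T n p) (g : (Hom T p p)ˣ) : Hom T n p := f ⬝ g.1

infixr:73 "▷" => Hom.act
infixl:72 "◁" => Hom.ract

section Act

variable {n p q : ℕ}

theorem Hom.mul_act (g h : (Hom T n n)ˣ) (f : Hom T n p) : (g * h) ▷ f = g ▷ h ▷ f :=
  Hom.comp_assoc _ _ _

theorem Hom.one_act (f : Hom T n p) : (1 : (Hom T n n)ˣ) ▷ f = f := Hom.id_comp f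

theorem Hom.ract_mul (f : Hom T n p) (g h : (Hom T p p)ˣ) : f ◁ (g * h) = f ◁ g ◁ h :=
  (Hom.comp_assoc _ _ _).symm

theorem Hom.ract_one (f : Hom T n p) : f ◁ (1 : (Hom T p p)ˣ) = f := Hom.comp_id f

theorem Hom.act_comp (g : (Hom T n n)ˣ) (f : Hom T n p) (f' : Hom T p q) :
    (g ▷ f) ⬝ f' = g ▷ (f ⬝ f') :=
  Hom.comp_assoc _ _ _

theorem Hom.comp_ract (f : Hom T n p) (f' : Hom T p q) (g : (Hom T q q)ˣ) :
    (f ⬝ f') ◁ g = f ⬝ (f' ◁ g) :=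
  Hom.comp_assoc _ _ _

theorem Hom.ract_comp (f : Hom T n p) (g : (Hom T p p)ˣ) (f' : Hom T p q) :
    (f ◁ g) ⬝ f' = f ⬝ (g ▷ f') :=
  Hom.comp_assoc _ _ _

theorem Hom.act_ract (g : (Hom T n n)ˣ) (f : Hom T n p) (g' : (Hom T p p)ˣ) :
    (g ▷ f) ◁ g' = g ▷ (f ◁ g') :=
  Hom.comp_assoc _ _ _

theorem Hom.act_id (g : (Hom T n n)ˣ) : g ▷ Hom.id n = g.1 := Hom.comp_id _

end Act

/-- Theories with the planar isotopies and the Reidemeister moves. -/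
class ReidTheory (T : Theory) : Prop where
  ok_over : T.ok .over
  ok_under : T.ok .under
  iso : ∀ u u', IsotopyRel u u' → T.rel u u'
  r1 : ∀ x, T.ok x → T.rel [(1, .cup), cr 0 x, (1, .cap)] []
  r2 : ∀ x, T.ok x → T.rel [cr 0 x, cr 0 x.rot] []
  r3 : ∀ x y z : Crossing, x.IsClassical → y.IsClassical → z.IsClassical → y = x ∨ y = z →
    T.rel (tri x y z) (tri' x y z)

/-- Theories with the planar isotopies and the welded Reidemeister moves. -/
class WeldedTheory (T : Theory) : Prop extends ReidTheory T where
  ok_virt : T.ok .virt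
  welded : ∀ u u', WReidRel u u' → T.rel u u'

theorem Crossing.rot_rot (x : Crossing) : x.rot.rot = x := by cases x <;> rfl

theorem ReidTheory.ok_rot [ReidTheory T] {x : Crossing} (h : T.ok x) : T.ok x.rot := by
  cases x
  exacts [ReidTheory.ok_under, ReidTheory.ok_over, h]

/-- The maximum with `k` strands on its left. -/
def cap (T : Theory) (n k : ℕ) : Hom T (n + 2) n :=
  -- `min` keeps the definition free of a side condition; the name has its meaning only for `k ≤ n`,
  -- see `cap_eq`.
  Hom.mk [(min k n, .cap)] (isTangle_cap (min_le_right k n)) Theory.good_cap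

/-- The minimum with `k` strands on its left. -/
def cup (T : Theory) (n k : ℕ) : Hom T n (n + 2) :=
  Hom.mk [(min k n, .cup)] (isTangle_cup (min_le_right k n)) Theory.good_cup

theorem cap_eq {n k : ℕ} (h : k ≤ n) :
    cap T n k = Hom.mk [(k, .cap)] (isTangle_cap h) Theory.good_cap := by
  simp only [cap, min_eq_left h]

theorem cup_eq {n k : ℕ} (h : k ≤ n) :
    cup T n k = Hom.mk [(k, .cup)] (isTangle_cup h) Theory.good_cup := by
  simp only [cup, min_eq_left h]

open Classical in
/-- The crossing `x` between the strands `k` and `k + 1`, or the trivial diagram if there is no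
such crossing. -/
noncomputable def crossing (T : Theory) (n k : ℕ) (x : Crossing) : Hom T n n :=
  if h : k + 2 ≤ n ∧ T.ok x then
    Hom.mk [(k, .cross x)] (isTangle_cross h.1) (Theory.good_cross h.2)
  else Hom.id n

theorem crossing_eq {n k : ℕ} {x : Crossing} (h : k + 2 ≤ n) (hx : T.ok x) :
    crossing T n k x = Hom.mk [(k, .cross x)] (isTangle_cross h) (Theory.good_cross hx) :=
  dif_pos ⟨h, hx⟩

theorem crossing_eq_id {n k : ℕ} {x : Crossing} (h : ¬ (k + 2 ≤ n ∧ T.ok x)) :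
    crossing T n k x = Hom.id n :=
  dif_neg h

/-! ### Relations between crossings, maxima and minima -/

section Laws

variable [ReidTheory T] {n : ℕ}

theorem crossing_comp_rot (k : ℕ) (x : Crossing) :
    crossing T n k x ⬝ crossing T n k x.rot = Hom.id n := by
  by_cases h : k + 2 ≤ n ∧ T.ok x
  · rw [crossing_eq h.1 h.2, crossing_eq h.1 (ReidTheory.ok_rot h.2)]
    exact Quot.sound ⟨[], [], k, _, _, ReidTheory.r2 x h.2, by simp [shift, cr], by simp [shift]⟩
  · rw [crossing_eq_id h, crossing_eq_id, Hom.id_comp]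
    rintro ⟨h1, h2⟩
    exact h ⟨h1, x.rot_rot ▸ ReidTheory.ok_rot h2⟩

/-- The crossing `x` between the strands `k` and `k + 1`, as an invertible diagram. -/
noncomputable def u (T : Theory) [ReidTheory T] (n k : ℕ) (x : Crossing) : (Hom T n n)ˣ where
  val := crossing T n k x
  inv := crossing T n k x.rot
  val_inv := crossing_comp_rot k x
  inv_val := by
    change crossing T n k x.rot ⬝ crossing T n k x = Hom.id n
    simpa only [x.rot_rot] using crossing_comp_rot (T := T) (n := n) k x.rot

theorem u_inv (k : ℕ) (x : Crossing) : (u T n k x)⁻¹ = u T n k x.rot := Units.ext rfl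

theorem u_over_inv (k : ℕ) : (u T n k .over)⁻¹ = u T n k .under := u_inv k _

theorem u_virt_inv (k : ℕ) : (u T n k .virt)⁻¹ = u T n k .virt := u_inv k _

theorem u_virt_mul_self (k : ℕ) : u T n k .virt * u T n k .virt = 1 := by
  nth_rewrite 1 [← u_virt_inv k]
  exact inv_mul_cancel _

theorem u_commute {j k : ℕ} (x y : Crossing) (h : j + 2 ≤ k) : Commute (u T n j x) (u T n k y) := by
  refine Units.ext ?_
  change crossing T n j x ⬝ crossing T n k y = crossing T n k y ⬝ crossing T n j x
  by_cases hx : j + 2 ≤ n ∧ T.ok x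
  · by_cases hy : k + 2 ≤ n ∧ T.ok y
    · rw [crossing_eq hx.1 hx.2, crossing_eq hy.1 hy.2]
      obtain ⟨i, rfl⟩ := Nat.exists_eq_add_of_le h
      exact Quot.sound ⟨[], [], j, _, _, ReidTheory.iso _ _ (.far (.cross x) (.cross y) i),
        by simp [shift, Gen.outs]; omega, by simp [shift, Gen.ins]; omega⟩
    · rw [crossing_eq_id hy, Hom.id_comp, Hom.comp_id]
  · rw [crossing_eq_id hx, Hom.id_comp, Hom.comp_id]

theorem u_act_cap_left {j k : ℕ} (x : Crossing) (h : j + 2 ≤ k) (hk : k ≤ n) :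
    u T (n + 2) j x ▷ cap T n k = cap T n k ◁ u T n j x := by
  change crossing T (n + 2) j x ⬝ cap T n k = cap T n k ⬝ crossing T n j x
  by_cases hx : T.ok x
  · rw [crossing_eq (by omega) hx, crossing_eq (by omega) hx, cap_eq hk]
    obtain ⟨i, rfl⟩ := Nat.exists_eq_add_of_le h
    exact Quot.sound ⟨[], [], j, _, _, ReidTheory.iso _ _ (.far (.cross x) .cap i),
        by simp [shift, Gen.outs]; omega, by simp [shift, Gen.ins]; omega⟩
  · rw [crossing_eq_id (by tauto), crossing_eq_id (by tauto), Hom.id_comp, Hom.comp_id]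

theorem u_act_cap_right {j k : ℕ} (x : Crossing) (h : k ≤ j) (hk : k ≤ n) :
    u T (n + 2) (j + 2) x ▷ cap T n k = cap T n k ◁ u T n j x := by
  change crossing T (n + 2) (j + 2) x ⬝ cap T n k = cap T n k ⬝ crossing T n j x
  by_cases hx : j + 2 ≤ n ∧ T.ok x
  · rw [crossing_eq (by omega) hx.2, crossing_eq (by omega) hx.2, cap_eq hk]
    obtain ⟨i, rfl⟩ := Nat.exists_eq_add_of_le h
    refine (Quot.sound ⟨[], [], k, _, _, ReidTheory.iso _ _ (.far .cap (.cross x) i),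
        by simp [shift, Gen.outs], by simp [shift, Gen.ins]; omega⟩).symm
  · rw [crossing_eq_id (by rintro ⟨h1, h2⟩; exact hx ⟨by omega, h2⟩), crossing_eq_id hx,
      Hom.id_comp, Hom.comp_id]

theorem cup_ract_left {j k : ℕ} (x : Crossing) (h : j + 2 ≤ k) (hk : k ≤ n) :
    cup T n k ◁ u T (n + 2) j x = u T n j x ▷ cup T n k := by
  change cup T n k ⬝ crossing T (n + 2) j x = crossing T n j x ⬝ cup T n k
  by_cases hx : T.ok x
  · rw [crossing_eq (by omega) hx, crossing_eq (by omega) hx, cup_eq hk]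
    obtain ⟨i, rfl⟩ := Nat.exists_eq_add_of_le h
    exact (Quot.sound ⟨[], [], j, _, _, ReidTheory.iso _ _ (.far (.cross x) .cup i),
        by simp [shift, Gen.outs]; omega, by simp [shift, Gen.ins]; omega⟩).symm
  · rw [crossing_eq_id (by tauto), crossing_eq_id (by tauto), Hom.id_comp, Hom.comp_id]

theorem cup_ract_right {j k : ℕ} (x : Crossing) (h : k ≤ j) (hk : k ≤ n) :
    cup T n k ◁ u T (n + 2) (j + 2) x = u T n j x ▷ cup T n k := by
  change cup T n k ⬝ crossing T (n + 2) (j + 2) x = crossing T n j x ⬝ cup T n k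
  by_cases hx : j + 2 ≤ n ∧ T.ok x
  · rw [crossing_eq (by omega) hx.2, crossing_eq (by omega) hx.2, cup_eq hk]
    obtain ⟨i, rfl⟩ := Nat.exists_eq_add_of_le h
    refine Quot.sound ⟨[], [], k, _, _, ReidTheory.iso _ _ (.far .cup (.cross x) i),
        by simp [shift, Gen.outs]; omega, by simp [shift, Gen.ins]⟩
  · rw [crossing_eq_id (by rintro ⟨h1, h2⟩; exact hx ⟨by omega, h2⟩), crossing_eq_id hx,
      Hom.id_comp, Hom.comp_id]

theorem cap_comp_cap {k : ℕ} (h : k ≤ n) :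
    cap T (n + 2) (k + 2) ⬝ cap T n k = cap T (n + 2) k ⬝ cap T n k := by
  rw [cap_eq h, cap_eq (k := k + 2) (by omega), cap_eq (k := k) (n := n + 2) (by omega)]
  exact (Quot.sound ⟨[], [], k, _, _, ReidTheory.iso _ _ (.far .cap .cap 0),
        by simp [shift, Gen.outs], by simp [shift, Gen.ins]⟩).symm

theorem cup_comp_cup {k : ℕ} (h : k ≤ n) :
    cup T n k ⬝ cup T (n + 2) (k + 2) = cup T n k ⬝ cup T (n + 2) k := by
  rw [cup_eq h, cup_eq (k := k + 2) (by omega), cup_eq (k := k) (n := n + 2) (by omega)]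
  exact Quot.sound ⟨[], [], k, _, _, ReidTheory.iso _ _ (.far .cup .cup 0),
        by simp [shift, Gen.outs], by simp [shift, Gen.ins]⟩

theorem cup_succ_comp_cap {k : ℕ} (h : k + 1 ≤ n) : cup T n (k + 1) ⬝ cap T n k = Hom.id n := by
  rw [cup_eq h, cap_eq (by omega)]
  exact Quot.sound ⟨[], [], k, _, _, ReidTheory.iso _ _ .zigzag, by simp [shift], by simp [shift]⟩

theorem cup_comp_cap_succ {k : ℕ} (h : k + 1 ≤ n) : cup T n k ⬝ cap T n (k + 1) = Hom.id n := by
  rw [cap_eq h, cup_eq (by omega)]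
  exact Quot.sound ⟨[], [], k, _, _, ReidTheory.iso _ _ .zigzag', by simp [shift], by simp [shift]⟩

theorem u_succ_act_cap {k : ℕ} {x : Crossing} (hx : T.ok x) (h : k + 1 ≤ n) :
    u T (n + 2) (k + 1) x ▷ cap T n k = u T (n + 2) k x.rot ▷ cap T n (k + 1) := by
  change crossing T (n + 2) (k + 1) x ⬝ cap T n k = crossing T (n + 2) k x.rot ⬝ cap T n (k + 1)
  rw [crossing_eq (by omega) hx, crossing_eq (by omega) (ReidTheory.ok_rot hx), cap_eq h,
    cap_eq (by omega)]
  exact Quot.sound ⟨[], [], k, _, _, ReidTheory.iso _ _ (.capSlide x), by simp [shift, cr],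
    by simp [shift, cr]⟩

theorem cup_ract_succ {k : ℕ} {x : Crossing} (hx : T.ok x) (h : k + 1 ≤ n) :
    cup T n k ◁ u T (n + 2) (k + 1) x = cup T n (k + 1) ◁ u T (n + 2) k x.rot := by
  change cup T n k ⬝ crossing T (n + 2) (k + 1) x = cup T n (k + 1) ⬝ crossing T (n + 2) k x.rot
  rw [crossing_eq (by omega) hx, crossing_eq (by omega) (ReidTheory.ok_rot hx), cup_eq h,
    cup_eq (by omega)]
  exact Quot.sound ⟨[], [], k, _, _, ReidTheory.iso _ _ (.cupSlide x), by simp [shift, cr],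
    by simp [shift, cr]⟩

theorem u_act_cap_succ {k : ℕ} {x : Crossing} (hx : T.ok x) (h : k + 1 ≤ n) :
    u T (n + 2) k x ▷ cap T n (k + 1) = u T (n + 2) (k + 1) x.rot ▷ cap T n k := by
  rw [u_succ_act_cap (ReidTheory.ok_rot hx) h, x.rot_rot]

theorem cup_succ_ract {k : ℕ} {x : Crossing} (hx : T.ok x) (h : k + 1 ≤ n) :
    cup T n (k + 1) ◁ u T (n + 2) k x = cup T n k ◁ u T (n + 2) (k + 1) x.rot := by
  rw [cup_ract_succ (ReidTheory.ok_rot hx) h, x.rot_rot]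

theorem cup_crossing_cap {k : ℕ} {x : Crossing} (hx : T.ok x) (h : k + 1 ≤ n) :
    cup T n (k + 1) ⬝ (u T (n + 2) k x ▷ cap T n (k + 1)) = Hom.id n := by
  change cup T n (k + 1) ⬝ (crossing T (n + 2) k x ⬝ cap T n (k + 1)) = _
  rw [crossing_eq (by omega) hx, cup_eq h, cap_eq h]
  exact Quot.sound ⟨[], [], k, _, _, ReidTheory.r1 x hx, by simp [shift, cr],
    by simp [shift]⟩

/-- The move R1 is given for a curl on a vertical strand, whereas here it is needed at a maximum.
Insert a zigzag below the maximum and use distant commutation: the crossing with its maximum and the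
new minimum form a curl, up to a slide of the crossing past the minimum. -/
theorem u_act_cap {k : ℕ} {x : Crossing} (hx : T.ok x) (h : k ≤ n) :
    u T (n + 2) k x ▷ cap T n k = cap T n k := by
  have h1 : cup T (n + 2) (k + 1) ⬝ (u T (n + 2 + 2) (k + 2) x ▷ cap T (n + 2) (k + 2)) =
      Hom.id (n + 2) := by
    rw [← Hom.ract_comp, cup_ract_succ hx (by omega), Hom.ract_comp,
      cup_crossing_cap (ReidTheory.ok_rot hx) (by omega)]
  calc u T (n + 2) k x ▷ cap T n k
      = cup T (n + 2) (k + 1) ⬝ cap T (n + 2) k ⬝ (u T (n + 2) k x ▷ cap T n k) := by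
        rw [cup_succ_comp_cap (by omega), Hom.id_comp]
    _ = cup T (n + 2) (k + 1) ⬝ (u T (n + 2 + 2) (k + 2) x ▷ cap T (n + 2) (k + 2)) ⬝
        cap T n k := by
        rw [Hom.comp_assoc, Hom.comp_assoc, ← Hom.ract_comp,
          ← u_act_cap_right x le_rfl (by omega), Hom.act_comp, Hom.act_comp, cap_comp_cap h]
    _ = _ := by rw [h1, Hom.id_comp]

theorem cup_ract {k : ℕ} {x : Crossing} (hx : T.ok x) (h : k ≤ n) :
    cup T n k ◁ u T (n + 2) k x = cup T n k := by
  have h1 : cup T (n + 2) (k + 2) ⬝ (u T (n + 2 + 2) (k + 2) x ▷ cap T (n + 2) (k + 1)) =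
      Hom.id (n + 2) := by
    rw [u_succ_act_cap hx (by omega), cup_crossing_cap (ReidTheory.ok_rot hx) (by omega)]
  calc cup T n k ◁ u T (n + 2) k x
      = (cup T n k ◁ u T (n + 2) k x) ⬝ (cup T (n + 2) k ⬝ cap T (n + 2) (k + 1)) := by
        rw [cup_comp_cap_succ (by omega), Hom.comp_id]
    _ = cup T n k ⬝ (cup T (n + 2) (k + 2) ⬝
        (u T (n + 2 + 2) (k + 2) x ▷ cap T (n + 2) (k + 1))) := by
        rw [Hom.ract_comp, ← Hom.act_comp, ← cup_ract_right x le_rfl (by omega), Hom.ract_comp,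
          ← Hom.comp_assoc, ← Hom.comp_assoc, cup_comp_cup h]
    _ = _ := by rw [h1, Hom.comp_id]

theorem u_tri {x y z : Crossing} (hx : T.ok x) (hy : T.ok y) (hz : T.ok z)
    (h : T.rel (tri x y z) (tri' x y z)) {k : ℕ} (hk : k + 3 ≤ n) :
    u T n k x * u T n (k + 1) y * u T n k z =
      u T n (k + 1) z * u T n k y * u T n (k + 1) x := by
  refine Units.ext ?_
  change crossing T n k x ⬝ crossing T n (k + 1) y ⬝ crossing T n k z =
    crossing T n (k + 1) z ⬝ crossing T n k y ⬝ crossing T n (k + 1) x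
  simp only [crossing_eq (show k + 2 ≤ n by omega) hx, crossing_eq (show k + 2 ≤ n by omega) hy,
    crossing_eq (show k + 2 ≤ n by omega) hz, crossing_eq (show k + 1 + 2 ≤ n by omega) hx,
    crossing_eq (show k + 1 + 2 ≤ n by omega) hy, crossing_eq (show k + 1 + 2 ≤ n by omega) hz]
  exact Quot.sound ⟨[], [], k, _, _, h, by simp [shift, tri, cr], by simp [shift, tri', cr]⟩

theorem braid_relation {k : ℕ} (hk : k + 3 ≤ n) :
    u T n k .over * u T n (k + 1) .over * u T n k .over =
      u T n (k + 1) .over * u T n k .over * u T n (k + 1) .over :=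
  u_tri ReidTheory.ok_over ReidTheory.ok_over ReidTheory.ok_over
    (ReidTheory.r3 _ _ _ nofun nofun nofun (Or.inl rfl)) hk

end Laws

end LocalMoves

namespace LocalMoves

/-! ### Group theory of three strands -/

section Group

set_option linter.unusedSimpArgs false

variable {G : Type*} [Group G] {s t v w : G}

/-- Both sides are the clasp of the two outer strands in front of the middle one: on the left the
first strand travels to the third, on the right the third to the first. -/
theorem conj_sq_of_braid (hb : s * t * s = t * s * t) :
    s * (t * t) * s⁻¹ = t⁻¹ * (s * s) * t := by
  have h2 : t * s * t * t = s * s * t * s := by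
    rw [← hb, mul_assoc s t s, mul_assoc, ← hb]
    group
  calc s * (t * t) * s⁻¹ = t⁻¹ * (t * s * t * t) * s⁻¹ := by group
    _ = _ := by rw [h2]; group

/-- The Delta relation is a consequence, and by the next lemma also a source, of moving the clasp of
the outer strands from the front of the middle strand to its back. Inverting the relation and
multiplying by the half twist gives the two forms of the clasp. -/
theorem conj_sq_eq_of_delta (hb : s * t * s = t * s * t) (hd : s * t⁻¹ * s = t * s⁻¹ * t) :
    s * (t * t) * s⁻¹ = s⁻¹ * (t * t) * s := by
  have h1 := conj_sq_of_braid hb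
  have h3 : s⁻¹ * t * s⁻¹ = t⁻¹ * s * t⁻¹ := by
    have := congrArg (·⁻¹) hd
    simpa [mul_assoc] using this
  calc s * (t * t) * s⁻¹ = t⁻¹ * (s * s) * t := h1
    _ = t⁻¹ * s * t⁻¹ * (t * s * t) := by group
    _ = s⁻¹ * t * s⁻¹ * (s * t * s) := by rw [← h3, hb]
    _ = _ := by group

theorem delta_of_conj_sq_eq (hb : s * t * s = t * s * t)
    (hd : s * (t * t) * s⁻¹ = s⁻¹ * (t * t) * s) : s * t⁻¹ * s = t * s⁻¹ * t := by
  have h1 := conj_sq_of_braid hb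
  have h3 : s⁻¹ * t * s⁻¹ = t⁻¹ * s * t⁻¹ := by
    calc s⁻¹ * t * s⁻¹ = s⁻¹ * (t * t) * s * (s * t * s)⁻¹ := by group
      _ = t⁻¹ * (s * s) * t * (t * s * t)⁻¹ := by rw [← hd, h1, hb]
      _ = _ := by group
  have := congrArg (·⁻¹) h3
  simpa [mul_assoc] using this

/-- Used with `v * s` an arrow and `t` another arrow with tail on the same strand: the carrying
strand may pass over a third strand instead of crossing it virtually. -/
theorem conj_eq_of_commute (hv : v⁻¹ = v) (h : Commute (v * s) t) : s * t * s⁻¹ = v * t * v := by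
  calc s * t * s⁻¹ = v⁻¹ * (v * s * t) * s⁻¹ := by group
    _ = v⁻¹ * t * v := by rw [h.eq]; group
    _ = _ := by rw [hv]

/-- The relations between the crossings of three strands which hold in presence of the welded
Reidemeister moves: `s`, `t` are the classical crossings and `v`, `w` the virtual ones. -/
structure WeldedTriple (s t v w : G) : Prop where
  v_mul_v : v * v = 1
  w_mul_w : w * w = 1
  vwv : v * w * v = w * v * w
  mixed : v * t * v = w * s * w
  braid : s * t * s = t * s * t
  oc : s⁻¹ * w * s = t * v * t⁻¹

namespace WeldedTriple

/-- Eliminates `t`: afterwards identities are compared as words in `s` and the symmetric group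
generated by `v` and `w`, which the lemmas below bring to a normal form. -/
theorem t_eq (h : WeldedTriple s t v w) : t = v * (w * (s * (w * v))) := by
  calc t = v * v * t * (v * v) := by rw [h.v_mul_v]; group
    _ = v * (v * t * v) * v := by group
    _ = _ := by rw [h.mixed]; group

theorem vv (h : WeldedTriple s t v w) (x : G) : v * (v * x) = x := by
  rw [← mul_assoc, h.v_mul_v, one_mul]

theorem ww (h : WeldedTriple s t v w) (x : G) : w * (w * x) = x := by
  rw [← mul_assoc, h.w_mul_w, one_mul]

theorem wvw (h : WeldedTriple s t v w) : w * (v * w) = v * (w * v) := by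
  rw [← mul_assoc, ← h.vwv, mul_assoc]

theorem wvw' (h : WeldedTriple s t v w) (x : G) : w * (v * (w * x)) = v * (w * (v * x)) := by
  rw [← mul_assoc v w x, ← mul_assoc w, h.wvw]
  simp only [mul_assoc]

/-- Let a_ij be the arrow in which strand i passes over strand j, with strands numbered at the
bottom. Then `s * v`, `v * s`, `t * w`, `w * t` are a₁₂, a₂₁, a₂₃, a₃₂, and conjugation by `v` and
`w` permutes the indices. The over-commute move says that a₂₁ and a₂₃, both with tail on strand 2,
commute. -/
theorem commute_oc (h : WeldedTriple s t v w) : Commute (v * s) (t * w) := by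
  have h1 : s * t * v = w * s * t := by
    calc s * t * v = s * (t * v * t⁻¹) * t := by group
      _ = _ := by rw [← h.oc]; group
  have h2 : s * t = w * s * t * v := by rw [← h1, mul_assoc (s * t), h.v_mul_v, mul_one]
  change v * s * (t * w) = t * w * (v * s)
  calc v * s * (t * w) = v * (s * t) * w := by group
    _ = v * (w * s * t * v) * w := by rw [← h2]
    _ = _ := by
      rw [h.t_eq]
      simp only [mul_assoc, h.vv, h.ww, h.wvw, h.wvw', h.v_mul_v, h.w_mul_w, mul_one]

/-- The products a₁₂a₂₃ and a₂₃a₁₂ are the two sides of the fused move followed by the same virtual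
half twist. -/
theorem fused_iff (h : WeldedTriple s t v w) : s * w * s = t * v * t ↔ Commute (s * v) (t * w) := by
  have h1 : s * v * (t * w) = s * w * s * (w * v * w) := by
    rw [h.t_eq]
    simp only [mul_assoc, h.vv, h.ww, h.wvw, h.wvw', h.v_mul_v, h.w_mul_w, mul_one]
  have h2 : t * w * (s * v) = t * v * t * (w * v * w) := by
    rw [h.t_eq]
    simp only [mul_assoc, h.vv, h.ww, h.wvw, h.wvw', h.v_mul_v, h.w_mul_w, mul_one]
  rw [commute_iff_eq, h1, h2, mul_left_inj]

/-- Conjugation by the virtual half twist exchanges strands 1 and 3, and so turns a₁₂, a₂₃ into a₃₂,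
a₂₁. -/
theorem commute_fused (h : WeldedTriple s t v w) (hF : Commute (s * v) (t * w)) :
    Commute (v * s) (w * t) := by
  have h1 : v * s = v * w * v * (t * w) * (v * w * v)⁻¹ := by
    rw [eq_mul_inv_iff_mul_eq, h.t_eq]
    simp only [mul_assoc, h.vv, h.ww, h.wvw, h.wvw', h.v_mul_v, h.w_mul_w, mul_one]
  have h2 : w * t = v * w * v * (s * v) * (v * w * v)⁻¹ := by
    rw [eq_mul_inv_iff_mul_eq, h.t_eq]
    simp only [mul_assoc, h.vv, h.ww, h.wvw, h.wvw', h.v_mul_v, h.w_mul_w, mul_one]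
  rw [h1, h2]
  exact (Commute.conj_iff _).2 hF.symm

/-- Heads on a common strand commute. Up to a virtual half twist, R3 reads a₁₂a₁₃a₂₃ = a₂₃a₁₃a₁₂.
Since a₁₂ commutes with a₁₃ by OC and with a₂₃ by F, it cancels, so a₁₃ and a₂₃ commute; conjugating
by `w` gives a₁₂ and a₃₂. -/
theorem commute_uc (h : WeldedTriple s t v w) (hF : Commute (s * v) (t * w)) :
    Commute (s * v) (w * t) := by
  have h1 : Commute (s * v) (v * (t * w) * v⁻¹) := by
    have : s * v = v * (v * s) * v⁻¹ := by
      rw [eq_mul_inv_iff_mul_eq]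
      simp only [mul_assoc, h.vv, h.v_mul_v, mul_one]
    rw [this]
    exact (Commute.conj_iff _).2 h.commute_oc
  have hb := h.braid
  have h2 : s * t * s = s * v * (v * (t * w) * v⁻¹) * (t * w) * (v * w * v) := by
    rw [inv_eq_of_mul_eq_one_right h.v_mul_v, h.t_eq]
    simp only [mul_assoc, h.vv, h.ww, h.wvw, h.wvw', h.v_mul_v, h.w_mul_w, mul_one]
  have h3 : t * s * t = t * w * (v * (t * w) * v⁻¹) * (s * v) * (v * w * v) := by
    rw [inv_eq_of_mul_eq_one_right h.v_mul_v, h.t_eq]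
    simp only [mul_assoc, h.vv, h.ww, h.wvw, h.wvw', h.v_mul_v, h.w_mul_w, mul_one]
  rw [h2, h3, mul_left_inj, h1.eq, mul_assoc _ (s * v), hF.eq, ← mul_assoc, mul_left_inj] at hb
  have h4 : Commute (v * (t * w) * v⁻¹) (t * w) := hb
  have h5 : s * v = w * (v * (t * w) * v⁻¹) * w⁻¹ := by
    rw [eq_mul_inv_iff_mul_eq, inv_eq_of_mul_eq_one_right h.v_mul_v, h.t_eq]
    simp only [mul_assoc, h.vv, h.ww, h.wvw, h.wvw', h.v_mul_v, h.w_mul_w, mul_one]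
  have h6 : w * t = w * (t * w) * w⁻¹ := by group
  rw [h5, h6]
  exact (Commute.conj_iff _).2 h4

/-- Up to the virtual half twist, the two sides of Delta are a₁₂a₃₁⁻¹a₂₃ and a₂₃a₃₁⁻¹a₁₂. The three
arrows form a cycle, so any two of them meet tail to head on a strand and commute. -/
theorem delta_of_fused (h : WeldedTriple s t v w) (hF : Commute (s * v) (t * w)) :
    s * t⁻¹ * s = t * s⁻¹ * t := by
  have hF' := h.commute_fused hF
  have hv : v⁻¹ = v := inv_eq_of_mul_eq_one_right h.v_mul_v
  have hw : w⁻¹ = w := inv_eq_of_mul_eq_one_right h.w_mul_w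
  have hz : v * (w * t) * v⁻¹ = w * (v * s) * w⁻¹ := by
    rw [hv, hw, h.t_eq]
    simp only [mul_assoc, h.vv, h.ww, h.wvw, h.wvw', h.v_mul_v, h.w_mul_w, mul_one]
  have h1 : Commute (s * v) (v * (w * t) * v⁻¹) := by
    have : s * v = v * (v * s) * v⁻¹ := by
      rw [eq_mul_inv_iff_mul_eq]
      simp only [mul_assoc, h.vv, h.v_mul_v, mul_one]
    rw [this]
    exact (Commute.conj_iff _).2 hF'
  have h2 : Commute (t * w) (v * (w * t) * v⁻¹) := by
    have : t * w = w * (w * t) * w⁻¹ := by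
      rw [eq_mul_inv_iff_mul_eq]
      simp only [mul_assoc, h.ww, h.w_mul_w, mul_one]
    rw [this, hz]
    exact (Commute.conj_iff _).2 hF'.symm
  have h3 : s * t⁻¹ * s = s * v * (v * (w * t) * v⁻¹)⁻¹ * (t * w) * (v * w * v) := by
    have : t⁻¹ = v * (w * (s⁻¹ * (w * v))) := by
      rw [inv_eq_iff_eq_inv, h.t_eq]
      simp only [mul_inv_rev, inv_inv, hv, hw, mul_assoc]
    simp only [mul_inv_rev, inv_inv, this, hv, hw]
    rw [h.t_eq]
    simp only [mul_assoc, h.vv, h.ww, h.wvw, h.wvw', h.v_mul_v, h.w_mul_w, mul_one]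
  have h4 : t * s⁻¹ * t = t * w * (w * (v * s) * w⁻¹)⁻¹ * (s * v) * (v * w * v) := by
    simp only [mul_inv_rev, inv_inv, hv, hw]
    rw [h.t_eq]
    simp only [mul_assoc, h.vv, h.ww, h.wvw, h.wvw', h.v_mul_v, h.w_mul_w, mul_one]
  rw [h3, h4, ← hz, mul_left_inj, h2.inv_right.eq, h1.inv_right.eq, mul_assoc _ (t * w), ← hF.eq,
    mul_assoc]

end WeldedTriple

end Group

end LocalMoves

namespace LocalMoves

variable {T : Theory}

/-! ### Twists of two strands -/

section Twist

variable [ReidTheory T] {n : ℕ}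

/-- The crossings `l` between the strands `k` and `k + 1`. -/
noncomputable def twist (T : Theory) [ReidTheory T] (n k : ℕ) (l : List Crossing) : (Hom T n n)ˣ :=
  (l.map (u T n k)).prod

theorem twist_nil (k : ℕ) : twist T n k [] = 1 := rfl

theorem twist_cons (k : ℕ) (x : Crossing) (l : List Crossing) :
    twist T n k (x :: l) = u T n k x * twist T n k l := by
  simp [twist]

theorem u_commute_twist {j k : ℕ} (x : Crossing) (l : List Crossing) (h : j + 2 ≤ k) :
    Commute (u T n j x) (twist T n k l) := by
  induction l with
  | nil => exact Commute.one_right _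
  | cons y l ih =>
    rw [twist_cons]
    exact (u_commute x y h).mul_right ih

theorem twist_act_cap_right {j k : ℕ} (l : List Crossing) (h : k ≤ j) (hk : k ≤ n) :
    twist T (n + 2) (j + 2) l ▷ cap T n k = cap T n k ◁ twist T n j l := by
  induction l with
  | nil => rw [twist_nil, twist_nil, Hom.one_act, Hom.ract_one]
  | cons y l ih =>
    rw [twist_cons, twist_cons, Hom.mul_act, ih, ← Hom.act_ract, u_act_cap_right y h hk,
      Hom.ract_mul]

theorem cup_ract_twist_right {j k : ℕ} (l : List Crossing) (h : k ≤ j) (hk : k ≤ n) :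
    cup T n k ◁ twist T (n + 2) (j + 2) l = twist T n j l ▷ cup T n k := by
  induction l with
  | nil => rw [twist_nil, twist_nil, Hom.one_act, Hom.ract_one]
  | cons y l ih =>
    rw [twist_cons, twist_cons, Hom.mul_act, ← ih, Hom.ract_mul, cup_ract_right y h hk,
      Hom.act_ract]

theorem cup_ract_twist_left {j k : ℕ} (l : List Crossing) (h : j + 2 ≤ k) (hk : k ≤ n) :
    cup T n k ◁ twist T (n + 2) j l = twist T n j l ▷ cup T n k := by
  induction l with
  | nil => rw [twist_nil, twist_nil, Hom.one_act, Hom.ract_one]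
  | cons y l ih =>
    rw [twist_cons, twist_cons, Hom.mul_act, ← ih, Hom.ract_mul, cup_ract_left y h hk,
      Hom.act_ract]

theorem twist_act_cap {k : ℕ} {l : List Crossing} (hl : ∀ x ∈ l, T.ok x) (h : k ≤ n) :
    twist T (n + 2) k l ▷ cap T n k = cap T n k := by
  induction l with
  | nil => rw [twist_nil, Hom.one_act]
  | cons y l ih =>
    rw [twist_cons, Hom.mul_act, ih fun x hx => hl x (List.mem_cons_of_mem _ hx),
      u_act_cap (hl y List.mem_cons_self) h]

theorem cup_ract_twist {k : ℕ} {l : List Crossing} (hl : ∀ x ∈ l, T.ok x) (h : k ≤ n) :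
    cup T n k ◁ twist T (n + 2) k l = cup T n k := by
  induction l with
  | nil => rw [twist_nil, Hom.ract_one]
  | cons y l ih =>
    rw [twist_cons, Hom.ract_mul, cup_ract (hl y List.mem_cons_self) h,
      ih fun x hx => hl x (List.mem_cons_of_mem _ hx)]

/-! ### Straightening of strands -/

theorem ract_mul_of_transport {T : Theory} {p q : ℕ} {f : Hom T p q} {a b : (Hom T p p)ˣ}
    {a' b' : (Hom T q q)ˣ} (ha : f ◁ a' = a ▷ f) (hb : f ◁ b' = b ▷ f) :
    f ◁ (a' * b') = (a * b) ▷ f := by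
  rw [Hom.ract_mul, ha, Hom.act_ract, hb, Hom.mul_act]

theorem act_mul_of_transport {T : Theory} {p q : ℕ} {f : Hom T p q} {a b : (Hom T p p)ˣ}
    {a' b' : (Hom T q q)ˣ} (ha : a ▷ f = f ◁ a') (hb : b ▷ f = f ◁ b') :
    (a * b) ▷ f = f ◁ (a' * b') := by
  rw [Hom.mul_act, hb, ← Hom.act_ract, ha, Hom.ract_mul]

/-- Lets one argue with a maximum attached. The hypotheses `ha` and `hb` say that `a'` and `b'` do
not involve the strands of the minimum, so adding it below straightens the maximum away. -/
theorem eq_of_cup_cap_succ {k : ℕ} {a b : (Hom T n n)ˣ} {a' b' : (Hom T (n + 2) (n + 2))ˣ}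
    (hk : k + 1 ≤ n) (ha : cup T n k ◁ a' = a ▷ cup T n k) (hb : cup T n k ◁ b' = b ▷ cup T n k)
    (h : a' ▷ cap T n (k + 1) = b' ▷ cap T n (k + 1)) : a = b := by
  have key : cup T n k ⬝ (a' ▷ cap T n (k + 1)) = cup T n k ⬝ (b' ▷ cap T n (k + 1)) := by rw [h]
  rw [← Hom.ract_comp, ← Hom.ract_comp, ha, hb, Hom.act_comp, Hom.act_comp,
    cup_comp_cap_succ hk, Hom.act_id, Hom.act_id] at key
  exact Units.ext key

theorem eq_of_cup_succ_cap {k : ℕ} {a b : (Hom T n n)ˣ} {a' b' : (Hom T (n + 2) (n + 2))ˣ}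
    (hk : k + 1 ≤ n) (ha : cup T n (k + 1) ◁ a' = a ▷ cup T n (k + 1))
    (hb : cup T n (k + 1) ◁ b' = b ▷ cup T n (k + 1))
    (h : a' ▷ cap T n k = b' ▷ cap T n k) : a = b := by
  have key : cup T n (k + 1) ⬝ (a' ▷ cap T n k) = cup T n (k + 1) ⬝ (b' ▷ cap T n k) := by rw [h]
  rw [← Hom.ract_comp, ← Hom.ract_comp, ha, hb, Hom.act_comp, Hom.act_comp,
    cup_succ_comp_cap hk, Hom.act_id, Hom.act_id] at key
  exact Units.ext key

end Twist

/-! ### Consequences of the band-pass move -/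

section BandPass

variable [ReidTheory T] {n : ℕ}

/-- Two parallel strands cross two other parallel strands. -/
noncomputable def band (T : Theory) [ReidTheory T] (n k : ℕ) (x : Crossing) : (Hom T n n)ˣ :=
  u T n (k + 1) x * u T n k x * u T n (k + 2) x * u T n (k + 1) x

theorem band_eq (k : ℕ) (x : Crossing) :
    band T n k x = u T n (k + 1) x * u T n (k + 2) x * (u T n k x * u T n (k + 1) x) := by
  rw [band, mul_assoc (u T n (k + 1) x), (u_commute x x le_rfl).eq]
  group

/-- The theory has the band-pass move. -/
def HasBandPass (T : Theory) [ReidTheory T] : Prop :=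
  ∀ n k, k + 4 ≤ n → band T n k .over = band T n k .under

theorem ok_of_isClassical {x : Crossing} (hx : x.IsClassical) : T.ok x := by
  cases x
  exacts [ReidTheory.ok_over, ReidTheory.ok_under, absurd rfl hx]

theorem braid_of_isClassical {x : Crossing} (hx : x.IsClassical) {k : ℕ} (hk : k + 3 ≤ n) :
    u T n k x * u T n (k + 1) x * u T n k x =
      u T n (k + 1) x * u T n k x * u T n (k + 1) x :=
  u_tri (ok_of_isClassical hx) (ok_of_isClassical hx) (ok_of_isClassical hx)
    (ReidTheory.r3 _ _ _ hx hx hx (Or.inl rfl)) hk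

/-- The nested minima and maxima close the crossing of two bands into a curl with two parallel
strands. Undoing the two single curls by R1, with R3 in between, leaves the full twist which the
two-cable of a curl contains. -/
theorem cable_kink {x : Crossing} (hx : x.IsClassical) {k : ℕ} (hk : k + 2 ≤ n) :
    cup T n (k + 2) ⬝ (cup T (n + 2) (k + 3) ⬝
      (band T (n + 2 + 2) k x ▷ (cap T (n + 2) (k + 3) ⬝ cap T n (k + 2)))) =
    (u T n k x * u T n k x).1 := by
  have ok : T.ok x := ok_of_isClassical hx
  have h1 : u T (n + 2 + 2) (k + 1) x ▷ (cap T (n + 2) (k + 3) ⬝ cap T n (k + 2)) =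
      cap T (n + 2) (k + 3) ⬝ (u T (n + 2) (k + 1) x ▷ cap T n (k + 2)) := by
    rw [← Hom.act_comp, u_act_cap_left x (by omega) (by omega), Hom.ract_comp]
  have h2 (f : Hom T (n + 2) n) : u T (n + 2 + 2) k x ▷ (cap T (n + 2) (k + 3) ⬝ f) =
      cap T (n + 2) (k + 3) ⬝ (u T (n + 2) k x ▷ f) := by
    rw [← Hom.act_comp, u_act_cap_left x (by omega) (by omega), Hom.ract_comp]
  have h3 (f : Hom T (n + 2) n) : cup T (n + 2) (k + 3) ⬝ (u T (n + 2 + 2) (k + 1) x ▷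
      u T (n + 2 + 2) (k + 2) x ▷ (cap T (n + 2) (k + 3) ⬝ f)) = u T (n + 2) (k + 1) x ▷ f := by
    rw [← Hom.ract_comp, cup_ract_left x (by omega) (by omega), Hom.act_comp, ← Hom.act_comp _ _ f,
      ← Hom.comp_assoc, cup_crossing_cap ok (by omega), Hom.id_comp]
  rw [band_eq, Hom.mul_act, Hom.mul_act, Hom.mul_act, h1, h2, h3, ← Hom.mul_act, ← Hom.mul_act,
    ← braid_of_isClassical hx (by omega), Hom.mul_act,
    u_act_cap_left x le_rfl hk, Hom.mul_act, ← Hom.ract_comp,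
    cup_ract_left x le_rfl hk, Hom.act_comp, ← Hom.act_ract, ← Hom.comp_ract,
    cup_crossing_cap ok (by omega)]
  change crossing T n k x ⬝ (Hom.id n ⬝ crossing T n k x) = crossing T n k x ⬝ crossing T n k x
  rw [Hom.id_comp]

theorem HasBandPass.sq (h : HasBandPass T) {k : ℕ} (hk : k + 2 ≤ n) :
    u T n k .over * u T n k .over = u T n k .under * u T n k .under := by
  refine Units.ext ?_
  rw [← cable_kink (x := .over) nofun hk, ← cable_kink (x := .under) nofun hk, h _ _ (by omega)]

/-- The maximum joins the two strands of one band above the crossing. Its left leg can be pulled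
back through the other band; what remains is a finger of the right leg, which crosses the other
band, forms the twist `l` with the next strand and returns. -/
theorem band_act_cap {x : Crossing} (hx : x.IsClassical) {k : ℕ} (l : List Crossing)
    (hk : k + 2 ≤ n) :
    (band T (n + 2) k x * twist T (n + 2) (k + 3) l) ▷ cap T n (k + 2) =
      (u T (n + 2) (k + 1) x * u T (n + 2) (k + 2) x * twist T (n + 2) (k + 3) l *
        u T (n + 2) (k + 2) x.rot * u T (n + 2) (k + 1) x.rot) ▷ cap T n k := by
  have ok : T.ok x := ok_of_isClassical hx
  have h1 : (u T (n + 2) k x * u T (n + 2) (k + 1) x) ▷ cap T n (k + 2) =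
      (u T (n + 2) (k + 2) x.rot * u T (n + 2) (k + 1) x.rot) ▷ cap T n k := by
    rw [Hom.mul_act, u_act_cap_succ ok hk, ← Hom.mul_act, (u_commute _ _ le_rfl).eq, Hom.mul_act,
      u_act_cap_succ ok (by omega), Hom.mul_act]
  have h2 : Commute (u T (n + 2) k x * u T (n + 2) (k + 1) x) (twist T (n + 2) (k + 3) l) :=
    (u_commute_twist x l (by omega)).mul_left (u_commute_twist x l (by omega))
  rw [band_eq, mul_assoc, h2.eq, ← mul_assoc, Hom.mul_act, h1, ← Hom.mul_act]
  simp only [mul_assoc]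

/-- A finger of a strand passing over two strands may pass under them. -/
theorem HasBandPass.flip_two (h : HasBandPass T) {k : ℕ} (l : List Crossing) (hk : k + 4 ≤ n) :
    u T n k .over * u T n (k + 1) .over * twist T n (k + 2) l * u T n (k + 1) .under *
        u T n k .under =
      u T n k .under * u T n (k + 1) .under * twist T n (k + 2) l * u T n (k + 1) .over *
        u T n k .over := by
  -- A band-pass on a capped band changes its finger from above to below. The minimum at `k` then
  -- cuts off the maximum and leaves an identity on `n` strands.
  have key : (band T (n + 2) (k + 1) .over * twist T (n + 2) (k + 4) l) ▷ cap T n (k + 3) =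
      (band T (n + 2) (k + 1) .under * twist T (n + 2) (k + 4) l) ▷ cap T n (k + 3) := by
    rw [h _ _ (by omega)]
  rw [band_act_cap (x := .over) nofun l (by omega), band_act_cap (x := .under) nofun l (by omega)]
    at key
  have h1 (i : ℕ) (hi : k ≤ i) (y : Crossing) := cup_ract_right (T := T) y hi (by omega : k ≤ n)
  have h2 := cup_ract_twist_right (T := T) l (by omega : k ≤ k + 2) (by omega : k ≤ n)
  exact eq_of_cup_cap_succ (by omega)
    (ract_mul_of_transport (ract_mul_of_transport (ract_mul_of_transport (ract_mul_of_transport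
      (h1 k le_rfl _) (h1 (k + 1) (by omega) _)) h2) (h1 (k + 1) (by omega) _)) (h1 k le_rfl _))
    (ract_mul_of_transport (ract_mul_of_transport (ract_mul_of_transport (ract_mul_of_transport
      (h1 k le_rfl _) (h1 (k + 1) (by omega) _)) h2) (h1 (k + 1) (by omega) _)) (h1 k le_rfl _))
    key

/-- The last two strands are the legs of a maximum. A clasp of the first strand with the far leg can
be pushed across the maximum to the near leg; two of the crossings cancel there. -/
theorem clasp_act_cap {x : Crossing} (hx : T.ok x) {k : ℕ} (hk : k + 1 ≤ n) :
    (u T (n + 2) k x * (u T (n + 2) (k + 1) x.rot * u T (n + 2) (k + 1) x.rot) *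
      u T (n + 2) k x.rot) ▷ cap T n (k + 1) =
    (u T (n + 2) k x * u T (n + 2) k x) ▷ cap T n (k + 1) := by
  have hx' := ReidTheory.ok_rot hx
  rw [Hom.mul_act, u_act_cap_succ hx' hk, x.rot_rot, ← Hom.mul_act, mul_assoc, mul_assoc,
    ← u_inv (k + 1) x, inv_mul_cancel, mul_one, u_inv, Hom.mul_act, u_succ_act_cap hx' hk,
    x.rot_rot, Hom.mul_act]

/-- Flip a finger of the first strand past two strands, in the case where the second of these and
the strand that it clasps are the two legs of a maximum. By `clasp_act_cap` the clasp moves to the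
near leg, so that only one passed strand remains. -/
theorem HasBandPass.conj_sq (h : HasBandPass T) {k : ℕ} (hk : k + 3 ≤ n) :
    u T n k .over * (u T n (k + 1) .over * u T n (k + 1) .over) * (u T n k .over)⁻¹ =
      (u T n k .over)⁻¹ * (u T n (k + 1) .over * u T n (k + 1) .over) * u T n k .over := by
  have key : _ ▷ cap T n (k + 2) = _ ▷ cap T n (k + 2) := congrArg (Hom.act · (cap T n (k + 2)))
    (h.flip_two (T := T) (n := n + 2) (k := k) [.over, .over] (by omega))
  have conj (x : Crossing) (g : (Hom T (n + 2) (n + 2))ˣ) :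
      (u T (n + 2) k x * g * u T (n + 2) k x.rot) ▷ cap T n (k + 2) =
        u T (n + 2) k x ▷ (g ▷ cap T n (k + 2)) ◁ u T n k x.rot := by
    rw [Hom.mul_act, u_act_cap_left _ le_rfl (by omega), Hom.mul_act, Hom.act_ract, Hom.act_ract]
  have e1 : (u T (n + 2) (k + 1) .over * (u T (n + 2) (k + 2) .under * u T (n + 2) (k + 2) .under) *
      u T (n + 2) (k + 1) .under) ▷ cap T n (k + 2) = _ :=
    clasp_act_cap (x := .over) ReidTheory.ok_over (by omega)
  have e2 : (u T (n + 2) (k + 1) .under * (u T (n + 2) (k + 2) .over * u T (n + 2) (k + 2) .over) *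
      u T (n + 2) (k + 1) .over) ▷ cap T n (k + 2) = _ :=
    clasp_act_cap (x := .under) ReidTheory.ok_under (by omega)
  have regroup (a b c d e : (Hom T (n + 2) (n + 2))ˣ) :
    a * b * c * d * e = a * (b * c * d) * e := by
    group
  simp only [twist_cons, twist_nil, mul_one] at key
  rw [regroup, regroup] at key
  -- `clasp_act_cap` needs a twist opposite to the crossing by which the finger reaches it; σ² = σ⁻²
  -- changes the sign on the left side.
  nth_rewrite 1 [h.sq (n := n + 2) (k := k + 2) (by omega)] at key
  have key' := ((conj .over _).symm.trans key).trans (conj .under _)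
  rw [e1, e2, ← conj, ← conj, ← h.sq (n := n + 2) (k := k + 1) (by omega)] at key'
  have h1 (i : ℕ) (hi : i ≤ k + 1) (y : Crossing) :=
    cup_ract_left (T := T) (n := n) (j := i) (k := k + 3) y (by omega) (by omega)
  simpa only [u_over_inv, Crossing.rot] using eq_of_cup_succ_cap (by omega)
    (ract_mul_of_transport (ract_mul_of_transport (h1 k (by omega) _) (ract_mul_of_transport
      (h1 (k + 1) le_rfl _) (h1 (k + 1) le_rfl _))) (h1 k (by omega) _))
    (ract_mul_of_transport (ract_mul_of_transport (h1 k (by omega) _) (ract_mul_of_transport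
      (h1 (k + 1) le_rfl _) (h1 (k + 1) le_rfl _))) (h1 k (by omega) _)) key'

end BandPass

end LocalMoves

namespace LocalMoves

variable {T : Theory}

/-- The theory has the Delta move. -/
def HasDelta (T : Theory) [ReidTheory T] : Prop :=
  ∀ n k, k + 3 ≤ n → u T n k .over * (u T n (k + 1) .over)⁻¹ * u T n k .over =
    u T n (k + 1) .over * (u T n k .over)⁻¹ * u T n (k + 1) .over

theorem HasBandPass.hasDelta [ReidTheory T] (h : HasBandPass T) : HasDelta T :=
  fun _ _ hk => delta_of_conj_sq_eq (braid_relation hk) (h.conj_sq hk)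

/-! ### The fused move and the welded band-pass move -/

section Welded

variable [WeldedTheory T] {n : ℕ}

theorem WeldedTheory.ok (x : Crossing) : T.ok x := by
  cases x
  exacts [ReidTheory.ok_over, ReidTheory.ok_under, WeldedTheory.ok_virt]

theorem u_welded_tri {x y z : Crossing} (h : WReidRel (tri x y z) (tri' x y z)) {k : ℕ}
    (hk : k + 3 ≤ n) :
    u T n k x * u T n (k + 1) y * u T n k z =
      u T n (k + 1) z * u T n k y * u T n (k + 1) x :=
  u_tri (WeldedTheory.ok x) (WeldedTheory.ok y) (WeldedTheory.ok z) (WeldedTheory.welded _ _ h) hk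

theorem weldedTriple {k : ℕ} (hk : k + 3 ≤ n) :
    WeldedTriple (u T n k .over) (u T n (k + 1) .over) (u T n k .virt) (u T n (k + 1) .virt) where
  v_mul_v := u_virt_mul_self k
  w_mul_w := u_virt_mul_self (k + 1)
  vwv := u_welded_tri .vr3 hk
  mixed := u_welded_tri (.mixed .over nofun) hk
  braid := braid_relation hk
  oc := by
    rw [u_over_inv, u_over_inv]
    exact u_welded_tri .oc hk

/-- The theory has the fused move. -/
def HasFused (T : Theory) [ReidTheory T] : Prop :=
  ∀ n k, k + 3 ≤ n → u T n k .over * u T n (k + 1) .virt * u T n k .over =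
    u T n (k + 1) .over * u T n k .virt * u T n (k + 1) .over

theorem HasFused.commute (h : HasFused T) {k : ℕ} (hk : k + 3 ≤ n) :
    Commute (u T n k .over * u T n k .virt) (u T n (k + 1) .over * u T n (k + 1) .virt) :=
  (weldedTriple hk).fused_iff.1 (h n k hk)

theorem HasFused.hasDelta (h : HasFused T) : HasDelta T :=
  fun _ _ hk => (weldedTriple hk).delta_of_fused (h.commute hk)

/-- The theory has the welded band-pass move. -/
def HasWeldedBandPass (T : Theory) [ReidTheory T] : Prop :=
  ∀ n k, k + 4 ≤ n → band T n k .over =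
    u T n (k + 1) .under * u T n k .under * u T n (k + 2) .under *
      (u T n (k + 1) .virt * u T n (k + 1) .over * u T n (k + 1) .virt)

/-- A maximum joining the two strands of a band is pulled back through the other band. -/
theorem band_over_act_cap_succ {k : ℕ} (hk : k + 2 ≤ n) :
    band T (n + 2) k .over ▷ cap T n (k + 2) = cap T n k := by
  have h := band_act_cap (T := T) (x := .over) nofun [] hk
  rw [twist_nil, mul_one, mul_one] at h
  rw [h, ← u_inv, ← u_inv, mul_inv_cancel_right, mul_inv_cancel, Hom.one_act]

theorem band_over_act_cap {k : ℕ} (hk : k + 2 ≤ n) :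
    band T (n + 2) k .over ▷ cap T n k = cap T n (k + 2) := by
  have ok : T.ok .over := ReidTheory.ok_over
  rw [band_eq, Hom.mul_act, Hom.mul_act (u T (n + 2) k _), u_succ_act_cap ok (by omega),
    ← Hom.mul_act (u T (n + 2) k _), ← u_inv, mul_inv_cancel, Hom.one_act, Hom.mul_act,
    u_succ_act_cap ok hk, ← Hom.mul_act, ← u_inv, mul_inv_cancel, Hom.one_act]

/-- Write one of two stacked band crossings in its welded band-pass form: all but the conjugated
crossing cancel, and the product is the square of an arrow. On a capped band each of the two
crossings is undone by isotopy, so this square acts trivially on the maximum. -/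
theorem HasWeldedBandPass.sq_act_cap (h : HasWeldedBandPass T) {k : ℕ} (hk : k + 2 ≤ n) :
    twist T (n + 2) (k + 1) [.over, .virt, .over, .virt] ▷ cap T n (k + 2) = cap T n (k + 2) := by
  have h1 : band T (n + 2) k .over * band T (n + 2) k .over =
      twist T (n + 2) (k + 1) [.over, .virt, .over, .virt] := by
    nth_rewrite 2 [h (n + 2) k (by omega)]
    rw [band_eq]
    simp only [twist_cons, twist_nil, ← u_over_inv]
    group
  rw [← h1, Hom.mul_act, band_over_act_cap_succ hk, band_over_act_cap hk]

/-- The square of the arrow σv is trivial. In `sq_act_cap` the twist sits beside further strands of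
the bands: one zigzag on its right removes the maximum, one on its left the two surplus strands. -/
theorem HasWeldedBandPass.sq (h : HasWeldedBandPass T) {k : ℕ} (hk : k + 2 ≤ n) :
    twist T n k [.over, .virt, .over, .virt] = 1 := by
  have h1 : twist T (n + 2) (k + 2) [.over, .virt, .over, .virt] = 1 :=
    eq_of_cup_succ_cap (k := k + 3) (by omega) (cup_ract_twist_left _ le_rfl (by omega))
      (by rw [Hom.ract_one, Hom.one_act]) (by rw [h.sq_act_cap (by omega), Hom.one_act])
  exact eq_of_cup_cap_succ (k := k) (by omega) (cup_ract_twist_right _ le_rfl (by omega))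
    (by rw [Hom.ract_one, Hom.one_act]) (by rw [h1])

/-- Since σv is an involution, virtual conjugation inverts the crossing; the welded and the ordinary
band-pass moves therefore coincide here. -/
theorem HasWeldedBandPass.virt_conj (h : HasWeldedBandPass T) {k : ℕ} (hk : k + 2 ≤ n) :
    u T n k .virt * u T n k .over * u T n k .virt = u T n k .under := by
  have h1 := h.sq hk
  simp only [twist_cons, twist_nil, mul_one] at h1
  rw [← u_over_inv, eq_inv_iff_mul_eq_one, ← mul_eq_one_comm (a := u T n k .over), mul_assoc, h1]

theorem HasWeldedBandPass.hasBandPass (h : HasWeldedBandPass T) : HasBandPass T := by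
  intro n k hk
  rw [h n k hk, h.virt_conj (by omega), band]

theorem eq_of_cup_ract {k : ℕ} (hk : k + 1 ≤ n) {a b : (Hom T n n)ˣ}
    {a' b' : (Hom T (n + 2) (n + 2))ˣ} (ha : a' ▷ cap T n k = cap T n k ◁ a)
    (hb : b' ▷ cap T n k = cap T n k ◁ b) (h : cup T n (k + 1) ◁ a' = cup T n (k + 1) ◁ b') :
    a = b := by
  have key : (cup T n (k + 1) ◁ a') ⬝ cap T n k = (cup T n (k + 1) ◁ b') ⬝ cap T n k := by rw [h]
  rw [Hom.ract_comp, Hom.ract_comp, ha, hb, ← Hom.comp_ract, ← Hom.comp_ract,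
    cup_succ_comp_cap hk] at key
  refine Units.ext ?_
  simpa only [Hom.ract, Hom.id_comp] using key

/-- The arrow from strand `k` to strand `k + 2`. -/
theorem commute_oc_far {k : ℕ} (hk : k + 4 ≤ n) :
    Commute (u T n k .virt * u T n k .over)
      (u T n (k + 1) .virt * (u T n (k + 2) .over * u T n (k + 2) .virt) *
        u T n (k + 1) .virt) := by
  have h1 : u T n (k + 1) .virt * (u T n (k + 2) .over * u T n (k + 2) .virt) *
      u T n (k + 1) .virt =
      u T n (k + 2) .virt * (u T n (k + 1) .over * u T n (k + 1) .virt) * u T n (k + 2) .virt := by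
    have h : WeldedTriple (u T n (k + 1) .over) (u T n (k + 2) .over) (u T n (k + 1) .virt)
      (u T n (k + 2) .virt) := weldedTriple (by omega)
    rw [h.t_eq]
    simp only [mul_assoc, h.vv, h.wvw, h.v_mul_v, mul_one]
  have h2 (x : Crossing) := u_commute (T := T) (n := n) x .virt (le_refl (k + 2))
  rw [h1]
  exact (((h2 _).mul_left (h2 _)).mul_right (weldedTriple (by omega)).commute_oc).mul_right
    ((h2 _).mul_left (h2 _))

/-- The tail of an arrow slides through the minimum joining its strand to the neighbouring one. In
general such a slide inverts the arrow; by `virt_conj` the arrow equals its inverse. Both sides are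
brought to a common diagram with the minimum two places further right. -/
theorem HasWeldedBandPass.cup_slide (h : HasWeldedBandPass T) {k : ℕ} (hk : k + 2 ≤ n) :
    cup T n k ◁ (u T (n + 2) (k + 1) .virt *
      (u T (n + 2) (k + 2) .over * u T (n + 2) (k + 2) .virt) * u T (n + 2) (k + 1) .virt) =
    cup T n k ◁ (u T (n + 2) k .virt * (u T (n + 2) (k + 1) .virt *
      (u T (n + 2) (k + 2) .over * u T (n + 2) (k + 2) .virt) * u T (n + 2) (k + 1) .virt) *
      u T (n + 2) k .virt) := by
  have okv : T.ok .virt := WeldedTheory.ok_virt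
  have oko : T.ok .over := ReidTheory.ok_over
  have e1 : cup T n k ◁ u T (n + 2) (k + 1) .virt = cup T n (k + 1) ◁ u T (n + 2) k .virt :=
    cup_ract_succ okv (by omega)
  have e2 : cup T n (k + 1) ◁ u T (n + 2) (k + 2) .over =
      cup T n (k + 2) ◁ u T (n + 2) (k + 1) .under := cup_ract_succ oko hk
  have e3 : cup T n (k + 1) ◁ u T (n + 2) (k + 2) .virt =
      cup T n (k + 2) ◁ u T (n + 2) (k + 1) .virt := cup_ract_succ okv hk
  have h1 : u T (n + 2) (k + 2) .over * u T (n + 2) (k + 2) .virt =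
      u T (n + 2) (k + 2) .virt * u T (n + 2) (k + 2) .under := by
    rw [← h.virt_conj (by omega), ← mul_assoc, ← mul_assoc, u_virt_mul_self, one_mul]
  have c (x : Crossing) := (u_commute (T := T) (n := n + 2) .virt x (le_refl (k + 2))).eq
  have h2 : u T (n + 2) (k + 1) .virt * u T (n + 2) (k + 2) .under * u T (n + 2) (k + 1) .virt =
      u T (n + 2) (k + 2) .virt * u T (n + 2) (k + 1) .under * u T (n + 2) (k + 2) .virt :=
    u_welded_tri (.mixed .under nofun) (by omega)
  have h3 := u_welded_tri (T := T) (n := n + 2) (k := k) .vr3 (by omega)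
  trans cup T n (k + 2) ◁ (u T (n + 2) (k + 1) .under * (u T (n + 2) (k + 2) .virt *
    (u T (n + 2) k .virt * u T (n + 2) (k + 1) .virt)))
  · rw [mul_assoc, Hom.ract_mul, e1, ← Hom.ract_mul, mul_assoc (u T (n + 2) (k + 2) .over),
      ← mul_assoc, c, mul_assoc, Hom.ract_mul, e2, ← Hom.ract_mul,
      ← mul_assoc (u T (n + 2) k .virt), c, mul_assoc]
  · have g1 : u T (n + 2) k .virt * (u T (n + 2) (k + 2) .virt * u T (n + 2) (k + 2) .under *
        (u T (n + 2) (k + 1) .virt * u T (n + 2) k .virt)) =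
        u T (n + 2) (k + 2) .virt * (u T (n + 2) (k + 2) .under * (u T (n + 2) k .virt *
          u T (n + 2) (k + 1) .virt * u T (n + 2) k .virt)) := by
      rw [← mul_assoc, ← mul_assoc (u T (n + 2) k .virt), c,
        mul_assoc (u T (n + 2) (k + 2) .virt), c]
      simp only [mul_assoc]
    have g2 : u T (n + 2) (k + 1) .virt * (u T (n + 2) (k + 2) .under * (u T (n + 2) k .virt *
          u T (n + 2) (k + 1) .virt * u T (n + 2) k .virt)) =
        u T (n + 2) (k + 2) .virt * (u T (n + 2) (k + 1) .under * (u T (n + 2) (k + 2) .virt *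
          (u T (n + 2) k .virt * u T (n + 2) (k + 1) .virt))) := by
      rw [h3, ← mul_assoc, mul_assoc (u T (n + 2) (k + 1) .virt) (u T (n + 2) k .virt),
        ← mul_assoc _ (u T (n + 2) (k + 1) .virt), h2]
      simp only [mul_assoc]
    rw [h1, mul_assoc (u T (n + 2) k .virt), Hom.ract_mul _ (u T (n + 2) k .virt),
      cup_ract okv (by omega), mul_assoc _ _ (u T (n + 2) k .virt),
      mul_assoc (u T (n + 2) (k + 1) .virt), Hom.ract_mul _ (u T (n + 2) (k + 1) .virt), e1,
      ← Hom.ract_mul _ (u T (n + 2) k .virt), g1, Hom.ract_mul _ (u T (n + 2) (k + 2) .virt), e3,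
      ← Hom.ract_mul _ (u T (n + 2) (k + 1) .virt), g2, Hom.ract_mul _ (u T (n + 2) (k + 2) .virt),
      cup_ract okv hk]

/-- By `fused_iff` the arrow s v must commute with y = a₂₃, which is the same as v y v = s⁻¹ y s:
the strand carrying the tail of y may pass under strand 1 instead of crossing it virtually. OC gives
this for passing over. BP exchanges over and under, but only for a finger past two strands; the
extra one is absorbed by letting the carrying strand turn back at a minimum. -/
theorem HasWeldedBandPass.hasFused (h : HasWeldedBandPass T) : HasFused T := by
  intro n k hk
  rw [(weldedTriple hk).fused_iff]
  have hF := h.hasBandPass.flip_two (n := n + 2) (k := k + 1) [.over, .virt] (by omega)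
  simp only [twist_cons, twist_nil, mul_one] at hF
  have hs := h.cup_slide (n := n) (k := k + 1) (by omega)
  have hc := commute_oc_far (T := T) (n := n + 2) (k := k + 1) (by omega)
  have ho := (weldedTriple (T := T) (n := n + 2) (k := k + 2) (by omega)).commute_oc
  have hb := weldedTriple (T := T) (n := n + 2) (k := k + 1) (by omega)
  have t0 (i : ℕ) (hi : k ≤ i) (x : Crossing) :=
    u_act_cap_right (T := T) (n := n) (k := k) x hi (by omega)
  have okv : T.ok .virt := WeldedTheory.ok_virt
  have oku : T.ok .under := ReidTheory.ok_under
  -- Number the strands from place `k + 1`: the minimum joins 1 and 2, and the arrow ends on strand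
  -- 4. The claim is that its tail, starting from strand 2, may pass under strand 3 instead of
  -- virtually.
  have key : cup T n (k + 1) ◁ (u T (n + 2) (k + 2) .virt *
      (u T (n + 2) (k + 3) .over * u T (n + 2) (k + 3) .virt) * u T (n + 2) (k + 2) .virt) =
      cup T n (k + 1) ◁ (u T (n + 2) (k + 2) .under *
      (u T (n + 2) (k + 3) .over * u T (n + 2) (k + 3) .virt) * u T (n + 2) (k + 2) .over) := by
    have k1 := cup_ract (T := T) (n := n) (k := k + 1) okv (by omega)
    have k2 := cup_ract (T := T) (n := n) (k := k + 1) oku (by omega)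
    generalize cup T n (k + 1) = f at *
    simp only [← u_over_inv] at hF k2 ⊢
    change Commute (u T (n + 2) (k + 2) .virt * u T (n + 2) (k + 2) .over)
      (u T (n + 2) (k + 3) .over * u T (n + 2) (k + 3) .virt) at ho
    change Commute (u T (n + 2) (k + 1) .virt * u T (n + 2) (k + 1) .over)
      (u T (n + 2) (k + 2) .virt * (u T (n + 2) (k + 3) .over * u T (n + 2) (k + 3) .virt) *
        u T (n + 2) (k + 2) .virt) at hc
    have hv := u_virt_inv (T := T) (n := n + 2)
    generalize u T (n + 2) (k + 3) .over * u T (n + 2) (k + 3) .virt = y at *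
    generalize hs0 : u T (n + 2) (k + 1) .over = s at *
    generalize hv0 : u T (n + 2) (k + 1) .virt = v at *
    generalize hs1 : u T (n + 2) (k + 2) .over = t at *
    generalize hv1 : u T (n + 2) (k + 2) .virt = w at *
    have hv' : v⁻¹ = v := hv0 ▸ hv (k + 1)
    have hw' : w⁻¹ = w := hv1 ▸ hv (k + 2)
    have e1 : t * y * t⁻¹ = w * y * w := conj_eq_of_commute hw' ho
    have e2 : s * (w * y * w) * s⁻¹ = v * (w * y * w) * v := conj_eq_of_commute hv' hc
    -- OC turns the finger over two strands into the arrow a₁₄, and the finger flip of BP turns it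
    -- into a finger under them.
    have e3 : v * (w * y * w) * v = s⁻¹ * (t⁻¹ * y * t) * s := by
      rw [← e2, ← e1]
      simpa only [mul_assoc] using hF
    -- The minimum `f` absorbs any crossing of its own two legs, so the leading `v` and `s⁻¹`
    -- disappear.
    have e4 : f ◁ (w * y * w * (v * s⁻¹)) = f ◁ (t⁻¹ * y * t) := by
      have : f ◁ (v * (w * y * w * (v * s⁻¹))) = f ◁ (s⁻¹ * (t⁻¹ * y * t)) := by
        congr 1
        rw [← mul_assoc, ← mul_assoc, e3, mul_inv_cancel_right]
      rwa [Hom.ract_mul, k1, Hom.ract_mul _ s⁻¹, k2] at this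
    rw [← e4, Hom.ract_mul _ _ (v * s⁻¹), hs, ← Hom.ract_mul]
    have e5 : v * (w * y * w) * v * (v * s⁻¹) = v * s⁻¹ * (v * (w * y * w) * v) := by
      calc v * (w * y * w) * v * (v * s⁻¹) = v * (w * y * w) * (v * v) * s⁻¹ := by group
        _ = v * s⁻¹ * (s * (w * y * w) * s⁻¹) := by rw [hb.v_mul_v]; group
        _ = _ := by rw [e2]
    have e6 : f ◁ (v * s⁻¹) = f := by rw [Hom.ract_mul, k1, k2]
    rw [e5, Hom.ract_mul _ (v * s⁻¹), e6]
  -- The maximum at `k` straightens the minimum at `k + 1` and removes two of the strands.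
  have hc : _ = _ := eq_of_cup_ract (by omega) (act_mul_of_transport (act_mul_of_transport
    (t0 k le_rfl _) (act_mul_of_transport (t0 (k + 1) (by omega) _) (t0 (k + 1) (by omega) _)))
    (t0 k le_rfl _)) (act_mul_of_transport (act_mul_of_transport (t0 k le_rfl _)
    (act_mul_of_transport (t0 (k + 1) (by omega) _) (t0 (k + 1) (by omega) _))) (t0 k le_rfl _)) key
  rw [← u_over_inv] at hc
  generalize u T n (k + 1) .over * u T n (k + 1) .virt = y at *
  calc u T n k .over * u T n k .virt * y
      = u T n k .over * (u T n k .virt * y * u T n k .virt) * (u T n k .virt)⁻¹ := by group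
    _ = y * (u T n k .over * u T n k .virt) := by rw [hc, u_virt_inv]; group

end Welded

end LocalMoves

/-! ### Clasps that slide along a strand -/

namespace LocalMoves

variable {T : Theory}

/-- The inverse of a twist. -/
def twistInv (l : List Crossing) : List Crossing := (l.map Crossing.rot).reverse

theorem twistInv_pair (x y : Crossing) : twistInv [x, y] = [y.rot, x.rot] := rfl

theorem twistInv_twistInv (l : List Crossing) : twistInv (twistInv l) = l := by
  simp [twistInv, Function.comp_def, Crossing.rot_rot]

/-- A carrier `c`, along which a strand reaches a distant strand passing all strands in between,
and twists which it can form there, such that these clasps can be moved along the strand. -/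
structure Slider (T : Theory) [ReidTheory T] (c : Crossing) (cores : Set (List Crossing)) :
    Prop where
  ok_carrier : T.ok c
  ok_core : ∀ l ∈ cores, ∀ x ∈ l, T.ok x
  inv_core : ∀ l ∈ cores, twistInv l ∈ cores
  slide_right : ∀ {n k : ℕ} {x : Crossing}, T.ok x → k + 3 ≤ n →
    u T n k c * u T n (k + 1) c * u T n k x = u T n (k + 1) x * (u T n k c * u T n (k + 1) c)
  slide_left : ∀ {n k : ℕ} {x : Crossing}, T.ok x → k + 3 ≤ n →
    u T n (k + 1) c * u T n k c * u T n (k + 1) x = u T n k x * (u T n (k + 1) c * u T n k c)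
  commute_left : ∀ {n k : ℕ} {x : Crossing} {l : List Crossing}, T.ok x → l ∈ cores → k + 3 ≤ n →
    Commute (twist T n (k + 1) l) ((u T n k c)⁻¹ * u T n k x)
  commute_right : ∀ {n k : ℕ} {x : Crossing} {l : List Crossing}, T.ok x → l ∈ cores → k + 3 ≤ n →
    Commute (twist T n (k + 1) l) (u T n k x * u T n k c)
  core_act_cap : ∀ {n k : ℕ} {l : List Crossing}, l ∈ cores → k + 1 ≤ n →
    (u T (n + 2) k c * twist T (n + 2) (k + 1) l * u T (n + 2) k c.rot) ▷ cap T n k =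
      twist T (n + 2) (k + 1) (twistInv l) ▷ cap T n k
  cup_ract_core : ∀ {n k : ℕ} {l : List Crossing}, l ∈ cores → k + 1 ≤ n →
    cup T n k ◁ (u T (n + 2) k c * twist T (n + 2) (k + 1) l * u T (n + 2) k c.rot) =
      cup T n k ◁ twist T (n + 2) (k + 1) (twistInv l)
  core_act_cap_succ : ∀ {n k : ℕ} {l : List Crossing}, l ∈ cores → k + 1 ≤ n →
    (u T (n + 2) k c * twist T (n + 2) (k + 1) l * u T (n + 2) k c.rot) ▷ cap T n (k + 1) =
      twist T (n + 2) k (twistInv l) ▷ cap T n (k + 1)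

/-- The strand `k` passes the `d` strands on its right along the carrier `c`, forms the twist `l`
with the next strand and goes back. -/
noncomputable def clasp (T : Theory) [ReidTheory T] (c : Crossing) (l : List Crossing) (n : ℕ) :
    ℕ → ℕ → (Hom T n n)ˣ
  | 0, k => twist T n k l
  | d + 1, k => u T n k c * clasp T c l n d (k + 1) * u T n k c.rot

section Clasp

variable [ReidTheory T] {c : Crossing} {cores : Set (List Crossing)} {n : ℕ} {l : List Crossing}

theorem clasp_zero (k : ℕ) : clasp T c l n 0 k = twist T n k l := rfl

theorem clasp_succ (d k : ℕ) :
    clasp T c l n (d + 1) k = u T n k c * clasp T c l n d (k + 1) * u T n k c.rot := rfl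

theorem u_commute_clasp {j k : ℕ} (x : Crossing) (d : ℕ) (h : j + 2 ≤ k) :
    Commute (u T n j x) (clasp T c l n d k) := by
  induction d generalizing k with
  | zero => exact u_commute_twist x l h
  | succ d ih =>
    exact ((u_commute _ _ h).mul_right (ih (by omega))).mul_right (u_commute _ _ h)

theorem clasp_act_cap_right {j k : ℕ} (d : ℕ) (h : k ≤ j) (hk : k ≤ n) :
    clasp T c l (n + 2) d (j + 2) ▷ cap T n k = cap T n k ◁ clasp T c l n d j := by
  induction d generalizing j with
  | zero => exact twist_act_cap_right l h hk
  | succ d ih =>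
    exact act_mul_of_transport (act_mul_of_transport (u_act_cap_right _ h hk)
      (ih (Nat.le_succ_of_le h))) (u_act_cap_right _ h hk)

theorem cup_ract_clasp_right {j k : ℕ} (d : ℕ) (h : k ≤ j) (hk : k ≤ n) :
    cup T n k ◁ clasp T c l (n + 2) d (j + 2) = clasp T c l n d j ▷ cup T n k := by
  induction d generalizing j with
  | zero => exact cup_ract_twist_right l h hk
  | succ d ih =>
    exact ract_mul_of_transport (ract_mul_of_transport (cup_ract_right _ h hk)
      (ih (Nat.le_succ_of_le h))) (cup_ract_right _ h hk)

namespace Slider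

/-- Induction on the distance: by `slide_left`, carrier crossings conjugate the crossings at `k`
into those at `k + 1`, and a carrier crossing at `k` commutes with a clasp starting at `k + 2`. The
base case is the axiom `commute_left`. -/
theorem clasp_commute_left (S : Slider T c cores) {x : Crossing} (hx : T.ok x) (hl : l ∈ cores)
    {d k : ℕ} (h : k + d + 3 ≤ n) :
    Commute (clasp T c l n d (k + 1)) ((u T n k c)⁻¹ * u T n k x) := by
  induction d generalizing k with
  | zero => exact S.commute_left hx hl h
  | succ d ih =>
    have e (y : Crossing) (hy : T.ok y) : u T n k y = u T n (k + 1) c *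
        (u T n k c * u T n (k + 1) y * (u T n k c)⁻¹) * (u T n (k + 1) c)⁻¹ := by
      rw [eq_mul_inv_iff_mul_eq, ← mul_assoc, eq_mul_inv_iff_mul_eq, ← mul_assoc,
        S.slide_left hy (by omega), mul_assoc]
    have e' : (u T n k c)⁻¹ * u T n k x = u T n (k + 1) c *
        (u T n k c * ((u T n (k + 1) c)⁻¹ * u T n (k + 1) x) * (u T n k c)⁻¹) *
          (u T n (k + 1) c)⁻¹ := by
      nth_rewrite 1 [e c S.ok_carrier]
      rw [e x hx]
      group
    have h1 := u_commute_clasp (T := T) (c := c) (l := l) (n := n) (k := k + 2) c d le_rfl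
    rw [e', clasp_succ, ← u_inv]
    exact (Commute.conj_iff _).2
      ((h1.symm.mul_right (ih (by omega))).mul_right h1.symm.inv_right)

theorem clasp_commute_right (S : Slider T c cores) {x : Crossing} (hx : T.ok x) (hl : l ∈ cores)
    {d k : ℕ} (h : k + d + 3 ≤ n) :
    Commute (clasp T c l n d (k + 1)) (u T n k x * u T n k c) := by
  induction d generalizing k with
  | zero => exact S.commute_right hx hl h
  | succ d ih =>
    have e (y : Crossing) (hy : T.ok y) : u T n k y = u T n (k + 1) c *
        (u T n k c * u T n (k + 1) y * (u T n k c)⁻¹) * (u T n (k + 1) c)⁻¹ := by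
      rw [eq_mul_inv_iff_mul_eq, ← mul_assoc, eq_mul_inv_iff_mul_eq, ← mul_assoc,
        S.slide_left hy (by omega), mul_assoc]
    have e' : u T n k x * u T n k c = u T n (k + 1) c *
        (u T n k c * (u T n (k + 1) x * u T n (k + 1) c) * (u T n k c)⁻¹) *
          (u T n (k + 1) c)⁻¹ := by
      refine (congrArg₂ (· * ·) (e x hx) (e c S.ok_carrier)).trans ?_
      group
    have h1 := u_commute_clasp (T := T) (c := c) (l := l) (n := n) (k := k + 2) c d le_rfl
    rw [e', clasp_succ, ← u_inv]
    exact (Commute.conj_iff _).2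
      ((h1.symm.mul_right (ih (by omega))).mul_right h1.symm.inv_right)

/-- The near end of the clasp passes a crossing of its strand with the next one, whatever its kind:
changing the carrier crossing at `k` into `x` costs a factor with which the shorter clasp commutes.
-/
theorem clasp_mul_u (S : Slider T c cores) {x : Crossing} (hx : T.ok x) (hl : l ∈ cores)
    {d k : ℕ} (h : k + d + 3 ≤ n) :
    clasp T c l n (d + 1) k * u T n k x = u T n k x * clasp T c l n d (k + 1) := by
  rw [clasp_succ, ← u_inv, mul_assoc, mul_assoc, (S.clasp_commute_left hx hl h).eq]
  group

theorem clasp_succ_mul_u (S : Slider T c cores) {x : Crossing} (hx : T.ok x) (hl : l ∈ cores)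
    {d k : ℕ} (h : k + d + 3 ≤ n) :
    clasp T c l n d (k + 1) * u T n k x = u T n k x * clasp T c l n (d + 1) k := by
  rw [clasp_succ, ← u_inv, ← mul_assoc, ← mul_assoc, ← (S.clasp_commute_right hx hl h).eq]
  group

/-- The crossing is one of two strands that the carrier passes, and such a crossing can be moved
across the carrier by `slide_right`. -/
theorem clasp_commute (S : Slider T c cores) {x : Crossing} (hx : T.ok x)
    {d i e : ℕ} (he : e + 2 ≤ d) (h : i + d + 2 ≤ n) :
    Commute (clasp T c l n d i) (u T n (i + 1 + e) x) := by
  induction e generalizing d i with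
  | zero =>
    obtain ⟨d, rfl⟩ := Nat.exists_eq_add_of_le' he
    have e1 : u T n (i + 1) x = u T n i c * u T n (i + 1) c * u T n i x *
        (u T n i c * u T n (i + 1) c)⁻¹ := by
      rw [S.slide_right hx (by omega), mul_inv_cancel_right]
    have e2 : clasp T c l n (d + 2) i = u T n i c * u T n (i + 1) c * clasp T c l n d (i + 2) *
        (u T n i c * u T n (i + 1) c)⁻¹ := by
      rw [clasp_succ, clasp_succ, ← u_inv, ← u_inv]
      group
    rw [add_zero, e1, e2]
    exact (Commute.conj_iff _).2 (u_commute_clasp _ _ le_rfl).symm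
  | succ e ih =>
    obtain ⟨d, rfl⟩ := Nat.exists_eq_add_of_le' (show 1 ≤ d by omega)
    have h1 := ih (d := d) (i := i + 1) (by omega) (by omega)
    rw [show i + 1 + 1 + e = i + 1 + (e + 1) by omega] at h1
    exact (((u_commute _ _ (by omega)).mul_left h1).mul_left (u_commute _ _ (by omega)))

theorem carrier_act_cap (S : Slider T c cores) {k : ℕ} (hk : k + 1 ≤ n) :
    (u T (n + 2) (k + 1) c * u T (n + 2) k c) ▷ cap T n (k + 1) = cap T n k := by
  rw [Hom.mul_act, u_act_cap_succ S.ok_carrier hk, ← Hom.mul_act, ← u_inv, mul_inv_cancel,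
    Hom.one_act]

theorem carrier_act_cap' (S : Slider T c cores) {k : ℕ} (hk : k + 1 ≤ n) :
    (u T (n + 2) k c * u T (n + 2) (k + 1) c) ▷ cap T n k = cap T n (k + 1) := by
  rw [Hom.mul_act, u_succ_act_cap S.ok_carrier hk, ← Hom.mul_act, ← u_inv, mul_inv_cancel,
    Hom.one_act]

theorem cup_ract_carrier (S : Slider T c cores) {k : ℕ} (hk : k + 1 ≤ n) :
    cup T n (k + 1) ◁ (u T (n + 2) k c * u T (n + 2) (k + 1) c) = cup T n k := by
  rw [Hom.ract_mul, cup_succ_ract S.ok_carrier hk, ← Hom.ract_mul, ← u_inv, inv_mul_cancel,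
    Hom.ract_one]

/-- The near end of the clasp passes from one leg of a maximum to the other; since the direction of
the strand is reversed, the twist is inverted. Carrier crossings replace the maximum by one a place
further right, which reduces the distance to the partner. -/
theorem clasp_act_cap (S : Slider T c cores) (hl : l ∈ cores) {d k : ℕ} (h : k + d + 1 ≤ n) :
    clasp T c l (n + 2) (d + 1) k ▷ cap T n k =
      clasp T c (twistInv l) (n + 2) d (k + 1) ▷ cap T n k := by
  induction d generalizing k with
  | zero => exact S.core_act_cap hl h
  | succ d ih =>
    have h1 (l : List Crossing) (hl : l ∈ cores) : clasp T c l (n + 2) (d + 2) k *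
        (u T (n + 2) (k + 1) c * u T (n + 2) k c) =
        u T (n + 2) (k + 1) c * u T (n + 2) k c * clasp T c l (n + 2) (d + 1) (k + 1) := by
      rw [← mul_assoc, (S.clasp_commute (e := 0) S.ok_carrier (by omega) (by omega)).eq, mul_assoc,
        S.clasp_mul_u S.ok_carrier hl (by omega), mul_assoc]
    have h2 (l : List Crossing) (hl : l ∈ cores) : clasp T c l (n + 2) (d + 1) (k + 1) *
        (u T (n + 2) (k + 1) c * u T (n + 2) k c) =
        u T (n + 2) (k + 1) c * u T (n + 2) k c * clasp T c l (n + 2) d (k + 2) := by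
      rw [← mul_assoc, S.clasp_mul_u S.ok_carrier hl (by omega), mul_assoc,
        (u_commute_clasp c d le_rfl).symm.eq, mul_assoc]
    rw [← S.carrier_act_cap (by omega), ← Hom.mul_act, h1 l hl, ← Hom.mul_act,
      h2 _ (S.inv_core l hl), Hom.mul_act, Hom.mul_act _ (clasp _ _ _ _ _ _), ih (by omega)]

theorem cup_ract_clasp (S : Slider T c cores) (hl : l ∈ cores) {d k : ℕ} (h : k + d + 1 ≤ n) :
    cup T n k ◁ clasp T c l (n + 2) (d + 1) k =
      cup T n k ◁ clasp T c (twistInv l) (n + 2) d (k + 1) := by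
  induction d generalizing k with
  | zero => exact S.cup_ract_core hl h
  | succ d ih =>
    have h1 (l : List Crossing) (hl : l ∈ cores) : u T (n + 2) k c * u T (n + 2) (k + 1) c *
        clasp T c l (n + 2) (d + 2) k = clasp T c l (n + 2) (d + 1) (k + 1) *
        (u T (n + 2) k c * u T (n + 2) (k + 1) c) := by
      rw [mul_assoc, ← (S.clasp_commute (e := 0) S.ok_carrier (by omega) (by omega)).eq,
        ← mul_assoc, ← S.clasp_succ_mul_u S.ok_carrier hl (by omega), mul_assoc]
    have h2 (l : List Crossing) (hl : l ∈ cores) : u T (n + 2) k c * u T (n + 2) (k + 1) c *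
        clasp T c l (n + 2) (d + 1) (k + 1) = clasp T c l (n + 2) d (k + 2) *
        (u T (n + 2) k c * u T (n + 2) (k + 1) c) := by
      rw [mul_assoc, ← S.clasp_succ_mul_u S.ok_carrier hl (by omega), ← mul_assoc,
        (u_commute_clasp c d le_rfl).eq, mul_assoc]
    rw [← S.cup_ract_carrier (by omega), ← Hom.ract_mul, h1 l hl, ← Hom.ract_mul,
      h2 _ (S.inv_core l hl), Hom.ract_mul, Hom.ract_mul _ (clasp _ _ _ _ _ _), ih (by omega)]

/-- Here the maximum joins two strands passed by the carrier, which is pulled across it; the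
distance drops by two. -/
theorem clasp_act_cap_left (S : Slider T c cores) {d i e : ℕ} (he : e ≤ d)
    (h : i + d + 2 ≤ n) :
    clasp T c l (n + 2) (d + 2) i ▷ cap T n (i + 1 + e) =
      cap T n (i + 1 + e) ◁ clasp T c l n d i := by
  induction e generalizing d i with
  | zero =>
    have e2 : clasp T c l (n + 2) (d + 2) i = u T (n + 2) i c * u T (n + 2) (i + 1) c *
        clasp T c l (n + 2) d (i + 2) * (u T (n + 2) i c * u T (n + 2) (i + 1) c)⁻¹ := by
      rw [clasp_succ, clasp_succ, ← u_inv, ← u_inv]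
      group
    rw [e2, add_zero, ← S.carrier_act_cap' (by omega), ← Hom.mul_act, inv_mul_cancel_right,
      Hom.mul_act, clasp_act_cap_right _ le_rfl (by omega), Hom.act_ract]
  | succ e ih =>
    obtain ⟨d, rfl⟩ := Nat.exists_eq_add_of_le' (show 1 ≤ d by omega)
    have h1 := ih (d := d) (i := i + 1) (by omega) (by omega)
    rw [show i + 1 + 1 + e = i + 1 + (e + 1) by omega] at h1
    exact act_mul_of_transport (act_mul_of_transport (u_act_cap_left _ (by omega) (by omega)) h1)
      (u_act_cap_left _ (by omega) (by omega))

theorem cup_ract_clasp_left (S : Slider T c cores) {d i e : ℕ} (he : e ≤ d)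
    (h : i + d + 2 ≤ n) :
    cup T n (i + 1 + e) ◁ clasp T c l (n + 2) (d + 2) i =
      clasp T c l n d i ▷ cup T n (i + 1 + e) := by
  induction e generalizing d i with
  | zero =>
    have e2 : clasp T c l (n + 2) (d + 2) i = u T (n + 2) i c * u T (n + 2) (i + 1) c *
        clasp T c l (n + 2) d (i + 2) * (u T (n + 2) i c * u T (n + 2) (i + 1) c)⁻¹ := by
      rw [clasp_succ, clasp_succ, ← u_inv, ← u_inv]
      group
    have e3 : cup T n (i + 1) ◁ (u T (n + 2) i c * u T (n + 2) (i + 1) c) = cup T n i :=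
      S.cup_ract_carrier (by omega)
    have e4 : cup T n i ◁ (u T (n + 2) i c * u T (n + 2) (i + 1) c)⁻¹ = cup T n (i + 1) := by
      rw [← e3, ← Hom.ract_mul, mul_inv_cancel, Hom.ract_one]
    rw [e2, add_zero, Hom.ract_mul, Hom.ract_mul, e3,
      cup_ract_clasp_right _ le_rfl (by omega), Hom.act_ract, e4]
  | succ e ih =>
    obtain ⟨d, rfl⟩ := Nat.exists_eq_add_of_le' (show 1 ≤ d by omega)
    have h1 := ih (d := d) (i := i + 1) (by omega) (by omega)
    rw [show i + 1 + 1 + e = i + 1 + (e + 1) by omega] at h1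
    exact ract_mul_of_transport (ract_mul_of_transport (cup_ract_left _ (by omega) (by omega)) h1)
      (cup_ract_left _ (by omega) (by omega))

end Slider

end Clasp

end LocalMoves

namespace LocalMoves

variable {T : Theory}

/-! ### Full twists as sliding clasps under the Delta move -/

section Classical

variable [ReidTheory T] {n : ℕ}

/-- The first two strands are the legs of a maximum. Untwisting the crossing of the legs by R1 and
sliding crossings past the maximum, with R3 in between, transfers the full twist from one leg to the
other with the opposite sign. -/
theorem conj_sq_act_cap {x : Crossing} (hx : x.IsClassical) {k : ℕ} (hk : k + 1 ≤ n) :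
    (u T (n + 2) k x * (u T (n + 2) (k + 1) x * u T (n + 2) (k + 1) x) *
      (u T (n + 2) k x)⁻¹) ▷ cap T n k =
    ((u T (n + 2) (k + 1) x)⁻¹ * (u T (n + 2) (k + 1) x)⁻¹) ▷ cap T n k := by
  have ok : T.ok x := ok_of_isClassical hx
  have hb := braid_of_isClassical (T := T) (n := n + 2) hx (k := k) (by omega)
  have h1 : u T (n + 2) k x * u T (n + 2) (k + 1) x * (u T (n + 2) k x)⁻¹ =
      (u T (n + 2) (k + 1) x)⁻¹ * u T (n + 2) k x * u T (n + 2) (k + 1) x := by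
    rw [mul_inv_eq_iff_eq_mul, mul_assoc, mul_assoc, ← mul_assoc (u T (n + 2) k x), hb]
    group
  rw [Hom.mul_act, u_inv, u_act_cap (ReidTheory.ok_rot ok) (by omega), ← mul_assoc, Hom.mul_act,
    u_succ_act_cap ok hk, ← Hom.mul_act, ← u_inv, h1, Hom.mul_act, u_act_cap ok hk, Hom.mul_act,
    u_act_cap_succ ok hk, ← Hom.mul_act, ← u_inv]

theorem cup_ract_conj_sq {x : Crossing} (hx : x.IsClassical) {k : ℕ} (hk : k + 1 ≤ n) :
    cup T n k ◁ (u T (n + 2) k x * ((u T (n + 2) (k + 1) x)⁻¹ * (u T (n + 2) (k + 1) x)⁻¹) *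
      (u T (n + 2) k x)⁻¹) =
    cup T n k ◁ (u T (n + 2) (k + 1) x * u T (n + 2) (k + 1) x) := by
  have ok : T.ok x := ok_of_isClassical hx
  have ok' : T.ok x.rot := ReidTheory.ok_rot ok
  have hb := braid_of_isClassical (T := T) (n := n + 2) hx (k := k) (by omega)
  have h1 : u T (n + 2) k x * ((u T (n + 2) (k + 1) x)⁻¹ * (u T (n + 2) k x)⁻¹) =
      (u T (n + 2) (k + 1) x)⁻¹ * ((u T (n + 2) k x)⁻¹ * u T (n + 2) (k + 1) x) := by
    rw [← mul_inv_rev, ← mul_assoc _ _ (u T (n + 2) (k + 1) x), ← mul_inv_rev,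
      mul_inv_eq_iff_eq_mul, mul_assoc, eq_inv_mul_iff_mul_eq, ← mul_assoc, hb, mul_assoc]
  have h2 : cup T n k ◁ (u T (n + 2) (k + 1) x)⁻¹ = cup T n (k + 1) ◁ u T (n + 2) k x := by
    rw [u_inv, cup_ract_succ ok' hk, x.rot_rot]
  have h3 : cup T n (k + 1) ◁ (u T (n + 2) k x)⁻¹ = cup T n k ◁ u T (n + 2) (k + 1) x := by
    rw [u_inv, cup_succ_ract ok' hk, x.rot_rot]
  rw [mul_assoc, Hom.ract_mul, cup_ract ok (by omega), mul_assoc, Hom.ract_mul, h2,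
    ← Hom.ract_mul, h1, Hom.ract_mul, u_inv (k + 1), cup_ract ok' hk, Hom.ract_mul, h3,
    ← Hom.ract_mul]

/-- The full twists of two strands. -/
def fullTwists : Set (List Crossing) := {[.over, .over], [.under, .under]}

theorem HasDelta.conj_sq (h : HasDelta T) {k : ℕ} (hk : k + 3 ≤ n) :
    u T n k .over * (u T n (k + 1) .over * u T n (k + 1) .over) * (u T n k .over)⁻¹ =
      (u T n k .over)⁻¹ * (u T n (k + 1) .over * u T n (k + 1) .over) * u T n k .over :=
  conj_sq_eq_of_delta (braid_relation hk) (h n k hk)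

theorem HasDelta.conj_inv_sq (h : HasDelta T) {k : ℕ} (hk : k + 3 ≤ n) :
    u T n k .over * ((u T n (k + 1) .over)⁻¹ * (u T n (k + 1) .over)⁻¹) * (u T n k .over)⁻¹ =
      (u T n k .over)⁻¹ * ((u T n (k + 1) .over)⁻¹ * (u T n (k + 1) .over)⁻¹) * u T n k .over := by
  have := congrArg (·⁻¹) (h.conj_sq hk)
  simpa only [mul_inv_rev, inv_inv, mul_assoc] using this

/-- A rearrangement of `conj_sq`: under Delta, adjacent full twists commute. -/
theorem HasDelta.commute_sq (h : HasDelta T) {k : ℕ} (hk : k + 3 ≤ n) :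
    Commute (u T n (k + 1) .over * u T n (k + 1) .over) (u T n k .over * u T n k .over) := by
  have h1 := h.conj_sq hk
  generalize u T n (k + 1) .over * u T n (k + 1) .over = y at *
  rw [mul_inv_eq_iff_eq_mul, mul_assoc, mul_assoc, eq_inv_mul_iff_mul_eq] at h1
  rw [commute_iff_eq, ← h1, mul_assoc]

/-- A carrier passing over everything slides by R3. Replacing the carrier crossing by another
classical one costs nothing or a full twist, and adjacent full twists commute. -/
theorem HasDelta.slider (h : HasDelta T) (hT : ∀ x, T.ok x → x.IsClassical) :
    Slider T .over fullTwists where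
  ok_carrier := ReidTheory.ok_over
  ok_core := by
    rintro l (rfl | rfl) x hx
    all_goals
      obtain rfl : x = _ := by simpa using hx
      first | exact ReidTheory.ok_over | exact ReidTheory.ok_under
  inv_core := by
    rintro l (rfl | rfl)
    exacts [Or.inr rfl, Or.inl rfl]
  slide_right hx hk := by
    rw [← mul_assoc]
    exact u_tri ReidTheory.ok_over ReidTheory.ok_over hx
      (ReidTheory.r3 _ _ _ nofun nofun (hT _ hx) (Or.inl rfl)) hk
  slide_left hx hk := by
    rw [← mul_assoc]
    exact (u_tri hx ReidTheory.ok_over ReidTheory.ok_over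
      (ReidTheory.r3 _ _ _ (hT _ hx) nofun nofun (Or.inr rfl)) hk).symm
  commute_left := by
    rintro n k x l hx hl hk
    have h1 := h.commute_sq hk
    cases x
    · rw [inv_mul_cancel]
      exact Commute.one_right _
    · rw [← u_over_inv, ← mul_inv_rev]
      rcases hl with rfl | rfl
      · simpa only [twist_cons, twist_nil, mul_one] using h1.inv_right
      · simpa only [twist_cons, twist_nil, mul_one, ← u_over_inv, mul_inv_rev] using h1.inv_inv
    · exact absurd rfl (hT _ hx)
  commute_right := by
    rintro n k x l hx hl hk
    have h1 := h.commute_sq hk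
    cases x
    · rcases hl with rfl | rfl
      · simpa only [twist_cons, twist_nil, mul_one] using h1
      · simpa only [twist_cons, twist_nil, mul_one, ← u_over_inv, mul_inv_rev] using h1.inv_left
    · rw [← u_over_inv, inv_mul_cancel]
      exact Commute.one_right _
    · exact absurd rfl (hT _ hx)
  core_act_cap := by
    rintro n k l (rfl | rfl) hk
    · simpa [twistInv, Crossing.rot, twist_cons, twist_nil, u_over_inv] using
        conj_sq_act_cap (T := T) (x := .over) nofun hk
    · have h1 := conj_sq_act_cap (T := T) (x := .under) nofun hk
      -- For this twist `conj_sq_act_cap` provides a carrier passing under; Delta exchanges it for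
      -- one passing over.
      rw [← u_over_inv, ← u_over_inv, inv_inv, inv_inv, ← h.conj_inv_sq (by omega)] at h1
      simpa [twistInv, Crossing.rot, twist_cons, twist_nil, u_over_inv] using h1
  cup_ract_core := by
    rintro n k l (rfl | rfl) hk
    · have h1 := cup_ract_conj_sq (T := T) (x := .under) nofun hk
      rw [← u_over_inv, ← u_over_inv, inv_inv, inv_inv, ← h.conj_sq (by omega)] at h1
      simpa [twistInv, Crossing.rot, twist_cons, twist_nil, u_over_inv] using h1
    · simpa [twistInv, Crossing.rot, twist_cons, twist_nil, u_over_inv] using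
        cup_ract_conj_sq (T := T) (x := .over) nofun hk
  core_act_cap_succ := by
    rintro n k l (rfl | rfl) hk
    · have h1 := clasp_act_cap (T := T) (x := .under) ReidTheory.ok_under hk
      simp only [Crossing.rot, ← u_over_inv] at h1
      rw [← h.conj_sq (by omega)] at h1
      simpa [twistInv, Crossing.rot, twist_cons, twist_nil, u_over_inv] using h1
    · simpa [twistInv, Crossing.rot, twist_cons, twist_nil, u_over_inv] using
        clasp_act_cap (T := T) (x := .over) ReidTheory.ok_over hk

end Classical

/-! ### Arrows as sliding clasps under the fused move -/

section Welded

variable [WeldedTheory T] {n : ℕ}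

/-- The twists consisting of a virtual crossing and one further crossing. -/
def arrowTwists : Set (List Crossing) := {l | ∃ x, l = [x, .virt] ∨ l = [.virt, x]}

theorem Crossing.rot_virt : Crossing.virt.rot = .virt := rfl

/-- Together the mixed move and vR3 let a strand that crosses only virtually pass every kind of
crossing, which makes the virtual crossing a carrier. -/
theorem virt_conj {k : ℕ} (x : Crossing) (hk : k + 3 ≤ n) :
    u T n k .virt * u T n (k + 1) x * u T n k .virt =
      u T n (k + 1) .virt * u T n k x * u T n (k + 1) .virt := by
  cases x
  exacts [u_welded_tri (.mixed .over nofun) hk, u_welded_tri (.mixed .under nofun) hk,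
    u_welded_tri .vr3 hk]

theorem virt_slide_right {k : ℕ} (x : Crossing) (hk : k + 3 ≤ n) :
    u T n k .virt * u T n (k + 1) .virt * u T n k x =
      u T n (k + 1) x * (u T n k .virt * u T n (k + 1) .virt) := by
  calc u T n k .virt * u T n (k + 1) .virt * u T n k x
      = u T n k .virt * (u T n (k + 1) .virt * u T n k x * u T n (k + 1) .virt) *
        (u T n (k + 1) .virt)⁻¹ := by group
    _ = u T n k .virt * u T n k .virt *
      (u T n (k + 1) x * (u T n k .virt * u T n (k + 1) .virt)) := by
      rw [← virt_conj x hk, u_virt_inv]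
      group
    _ = _ := by rw [u_virt_mul_self, one_mul]

theorem virt_slide_left {k : ℕ} (x : Crossing) (hk : k + 3 ≤ n) :
    u T n (k + 1) .virt * u T n k .virt * u T n (k + 1) x =
      u T n k x * (u T n (k + 1) .virt * u T n k .virt) := by
  calc u T n (k + 1) .virt * u T n k .virt * u T n (k + 1) x
      = u T n (k + 1) .virt * (u T n k .virt * u T n (k + 1) x * u T n k .virt) *
        (u T n k .virt)⁻¹ := by group
    _ = u T n (k + 1) .virt * u T n (k + 1) .virt *
        (u T n k x * (u T n (k + 1) .virt * u T n k .virt)) := by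
      rw [virt_conj x hk, u_virt_inv]
      group
    _ = _ := by rw [u_virt_mul_self, one_mul]

/-- Two arrows on adjacent pairs of strands meet on the middle strand tail to tail, tail to head or
head to head. These cases are OC, F and their consequence `commute_uc`; arrows with the opposite
crossing are inverses of these, and two virtual crossings cancel. -/
theorem HasFused.commute_arrows (h : HasFused T) {k : ℕ} (hk : k + 3 ≤ n) (x : Crossing)
    {l : List Crossing} (hl : l ∈ arrowTwists) :
    Commute (twist T n (k + 1) l) (u T n k .virt * u T n k x) ∧
      Commute (twist T n (k + 1) l) (u T n k x * u T n k .virt) := by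
  have W := weldedTriple (T := T) hk
  have hF := h.commute hk
  have h1 := W.commute_oc
  have h2 := W.commute_fused hF
  have h3 := W.commute_uc hF
  have hv := u_virt_inv (T := T) (n := n) k
  have hw := u_virt_inv (T := T) (n := n) (k + 1)
  have e1 : u T n (k + 1) .under * u T n (k + 1) .virt =
      (u T n (k + 1) .virt * u T n (k + 1) .over)⁻¹ := by rw [mul_inv_rev, u_over_inv, hw]
  have e2 : u T n (k + 1) .virt * u T n (k + 1) .under =
      (u T n (k + 1) .over * u T n (k + 1) .virt)⁻¹ := by rw [mul_inv_rev, u_over_inv, hw]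
  have e3 : u T n k .under * u T n k .virt =
      (u T n k .virt * u T n k .over)⁻¹ := by rw [mul_inv_rev, u_over_inv, hv]
  have e4 : u T n k .virt * u T n k .under =
      (u T n k .over * u T n k .virt)⁻¹ := by rw [mul_inv_rev, u_over_inv, hv]
  obtain ⟨y, rfl | rfl⟩ := hl
  all_goals
    simp only [twist_cons, twist_nil, mul_one]
    cases x <;> cases y <;> (try rw [e1]) <;> (try rw [e2]) <;> (try rw [e3]) <;> (try rw [e4]) <;>
      (try rw [u_virt_mul_self k]) <;> (try rw [u_virt_mul_self (k + 1)]) <;>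
      simp [-mul_inv_rev, h1.symm, hF.symm, h2.symm, h3.symm]

/-- With a virtual carrier the quotient of a crossing by the carrier crossing is itself an arrow, so
the commutation axioms are `commute_arrows`. At extrema the arrow is reversed by virtual slides
alone. -/
theorem HasFused.slider (h : HasFused T) : Slider T .virt arrowTwists where
  ok_carrier := WeldedTheory.ok _
  ok_core := fun _ _ _ _ => WeldedTheory.ok _
  inv_core := by
    rintro l ⟨x, rfl | rfl⟩
    exacts [⟨x.rot, Or.inr rfl⟩, ⟨x.rot, Or.inl rfl⟩]
  slide_right _ hk := virt_slide_right _ hk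
  slide_left _ hk := virt_slide_left _ hk
  commute_left _ hl hk := by
    rw [u_virt_inv]
    exact (h.commute_arrows hk _ hl).1
  commute_right _ hl hk := (h.commute_arrows hk _ hl).2
  core_act_cap := by
    rintro n k l ⟨x, rfl | rfl⟩ hk
    · have hc := virt_conj (T := T) (n := n + 2) (k := k) x (by omega)
      simp only [twistInv_pair, Crossing.rot_virt, twist_cons, twist_nil, mul_one]
      rw [Hom.mul_act, u_act_cap (WeldedTheory.ok _) (by omega), ← mul_assoc, Hom.mul_act,
        u_succ_act_cap (WeldedTheory.ok _) hk, ← Hom.mul_act, Crossing.rot_virt, hc, Hom.mul_act,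
        u_act_cap (WeldedTheory.ok _) hk, Hom.mul_act, u_act_cap_succ (WeldedTheory.ok _) hk,
        Hom.mul_act]
    · have hc := virt_slide_right (T := T) (n := n + 2) (k := k) x.rot (by omega)
      simp only [twistInv_pair, Crossing.rot_virt, twist_cons, twist_nil, mul_one]
      rw [Hom.mul_act, u_act_cap (WeldedTheory.ok _) (by omega), ← mul_assoc, Hom.mul_act,
        u_succ_act_cap (WeldedTheory.ok _) hk, ← Hom.mul_act, hc, Hom.mul_act, Hom.mul_act,
        u_act_cap (WeldedTheory.ok _) hk, u_act_cap_succ (WeldedTheory.ok _) hk,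
        Hom.mul_act, Crossing.rot_virt]
  cup_ract_core := by
    rintro n k l ⟨x, rfl | rfl⟩ hk
    · have hc := virt_slide_left (T := T) (n := n + 2) (k := k) x.rot (by omega)
      simp only [twistInv_pair, Crossing.rot_virt, twist_cons, twist_nil, mul_one]
      rw [mul_assoc, Hom.ract_mul, cup_ract (WeldedTheory.ok _) (by omega), mul_assoc,
        Hom.ract_mul, cup_ract_succ (WeldedTheory.ok _) hk, ← Hom.ract_mul, ← hc, mul_assoc,
        Hom.ract_mul, cup_ract (WeldedTheory.ok _) hk, Hom.ract_mul,
        cup_succ_ract (WeldedTheory.ok _) hk, ← Hom.ract_mul, Crossing.rot_virt]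
    · have hc := virt_conj (T := T) (n := n + 2) (k := k) x (by omega)
      simp only [twistInv_pair, Crossing.rot_virt, twist_cons, twist_nil, mul_one]
      rw [mul_assoc, Hom.ract_mul, cup_ract (WeldedTheory.ok _) (by omega), mul_assoc,
        Hom.ract_mul, cup_ract_succ (WeldedTheory.ok _) hk, ← Hom.ract_mul, Crossing.rot_virt,
        ← mul_assoc, hc, mul_assoc, Hom.ract_mul, cup_ract (WeldedTheory.ok _) hk, Hom.ract_mul,
        cup_succ_ract (WeldedTheory.ok _) hk, ← Hom.ract_mul]
  core_act_cap_succ := by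
    rintro n k l ⟨x, rfl | rfl⟩ hk
    · simp only [twistInv_pair, Crossing.rot_virt, twist_cons, twist_nil, mul_one]
      rw [Hom.mul_act, u_act_cap_succ (WeldedTheory.ok _) hk, ← Hom.mul_act, Crossing.rot_virt,
        mul_assoc, mul_assoc, u_virt_mul_self, mul_one, Hom.mul_act,
        u_succ_act_cap (WeldedTheory.ok _) hk, Hom.mul_act]
    · have h1 := virt_slide_right (T := T) (n := n + 2) (k := k) x (by omega)
      have h2 := virt_slide_left (T := T) (n := n + 2) (k := k) x.rot (by omega)
      have h3 := virt_conj (T := T) (n := n + 2) (k := k) .virt (by omega)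
      have e : (u T (n + 2) (k + 1) x * u T (n + 2) (k + 1) .virt) ▷ cap T n k =
          (u T (n + 2) k .virt * u T (n + 2) (k + 1) .virt * u T (n + 2) (k + 1) x.rot) ▷
            cap T n k := by
        rw [Hom.mul_act, u_succ_act_cap (WeldedTheory.ok _) hk, Hom.mul_act,
          ← u_act_cap_succ (WeldedTheory.ok _) hk, ← Hom.mul_act, ← Hom.mul_act, h1, Hom.mul_act,
          Hom.mul_act, Hom.mul_act,
          u_act_cap (WeldedTheory.ok _) hk, Crossing.rot_virt]
      simp only [twistInv_pair, Crossing.rot_virt, twist_cons, twist_nil, mul_one]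
      have e' : u T (n + 2) k .virt * u T (n + 2) (k + 1) .virt * (u T (n + 2) k .virt *
          u T (n + 2) (k + 1) .virt * u T (n + 2) (k + 1) x.rot) =
          u T (n + 2) k x.rot * (u T (n + 2) (k + 1) .virt * u T (n + 2) k .virt) := by
        rw [← h2, ← mul_assoc, ← mul_assoc, h3, mul_assoc _ _ (u T (n + 2) (k + 1) .virt),
          u_virt_mul_self, mul_one]
      rw [Hom.mul_act, u_act_cap_succ (WeldedTheory.ok _) hk, Crossing.rot_virt,
        ← mul_assoc, Hom.mul_act, ← Hom.mul_act _ _ (cap T n k), e, ← Hom.mul_act, e', Hom.mul_act,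
        Hom.mul_act, u_act_cap (WeldedTheory.ok _) (by omega),
        u_succ_act_cap (WeldedTheory.ok _) hk, Hom.mul_act, Crossing.rot_virt]

end Welded

end LocalMoves

namespace LocalMoves

/-! ### Strands of composed words -/

/-- The point `a` levels higher. -/
def raise (a : ℕ) (x : ℕ × ℕ) : ℕ × ℕ := (a + x.1, x.2)

/-- The point `k` places to the right. -/
def moveRight (k : ℕ) (x : ℕ × ℕ) : ℕ × ℕ := (x.1, k + x.2)

theorem SameStrand.refl {w : Word} (x : ℕ × ℕ) : SameStrand w x x := Relation.EqvGen.refl x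

theorem SameStrand.symm {w : Word} {x y : ℕ × ℕ} (h : SameStrand w x y) : SameStrand w y x :=
  Relation.EqvGen.symm _ _ h

theorem SameStrand.trans {w : Word} {x y z : ℕ × ℕ} (h : SameStrand w x y)
    (h' : SameStrand w y z) : SameStrand w x z :=
  Relation.EqvGen.trans _ _ _ h h'

theorem Adj.sameStrand {w : Word} {x y : ℕ × ℕ} (h : Adj w x y) : SameStrand w x y :=
  Relation.EqvGen.rel _ _ h

theorem SameStrand.map {v w : Word} {f : ℕ × ℕ → ℕ × ℕ}
    (hf : ∀ x y, Adj v x y → SameStrand w (f x) (f y)) {x y : ℕ × ℕ} (h : SameStrand v x y) :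
    SameStrand w (f x) (f y) := by
  induction h with
  | rel x y h => exact hf x y h
  | refl x => exact .refl _
  | symm x y _ ih => exact ih.symm
  | trans x y z _ _ ih ih' => exact ih.trans ih'

theorem adj_append {v w : Word} {x y : ℕ × ℕ} : Adj (v ++ w) x y ↔
    Adj v x y ∨ ∃ x' y', Adj w x' y' ∧ x = raise v.length x' ∧ y = raise v.length y' := by
  have get {l : ℕ} {p : ℕ × Gen} (h : (v ++ w)[l]? = some p) :
      v[l]? = some p ∨ ∃ l', l = v.length + l' ∧ w[l']? = some p := by
    rcases lt_or_ge l v.length with hl | hl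
    · rw [List.getElem?_append_left hl] at h
      exact Or.inl h
    · obtain ⟨l', rfl⟩ := Nat.exists_eq_add_of_le hl
      refine Or.inr ⟨l', rfl, ?_⟩
      rwa [List.getElem?_append_right hl, Nat.add_sub_cancel_left] at h
  have left {l : ℕ} {p : ℕ × Gen} (h : v[l]? = some p) : (v ++ w)[l]? = some p := by
    rw [List.getElem?_append_left, h]
    exact (List.getElem?_eq_some_iff.1 h).1
  have right {l : ℕ} {p : ℕ × Gen} (h : w[l]? = some p) : (v ++ w)[v.length + l]? = some p := by
    rw [List.getElem?_append_right (Nat.le_add_right _ _), Nat.add_sub_cancel_left, h]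
  constructor
  · intro h
    cases h with
    | left l k i g h hi =>
      rcases get h with h' | ⟨l', rfl, h'⟩
      exacts [Or.inl (.left l k i g h' hi), Or.inr ⟨_, _, .left l' k i g h' hi, rfl, rfl⟩]
    | right l k i g h =>
      rcases get h with h' | ⟨l', rfl, h'⟩
      exacts [Or.inl (.right l k i g h'), Or.inr ⟨_, _, .right l' k i g h', rfl, rfl⟩]
    | crossRight l k x h =>
      rcases get h with h' | ⟨l', rfl, h'⟩
      exacts [Or.inl (.crossRight l k x h'), Or.inr ⟨_, _, .crossRight l' k x h', rfl, rfl⟩]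
    | crossLeft l k x h =>
      rcases get h with h' | ⟨l', rfl, h'⟩
      exacts [Or.inl (.crossLeft l k x h'), Or.inr ⟨_, _, .crossLeft l' k x h', rfl, rfl⟩]
    | cap l k h =>
      rcases get h with h' | ⟨l', rfl, h'⟩
      exacts [Or.inl (.cap l k h'), Or.inr ⟨_, _, .cap l' k h', rfl, rfl⟩]
    | cup l k h =>
      rcases get h with h' | ⟨l', rfl, h'⟩
      exacts [Or.inl (.cup l k h'), Or.inr ⟨_, _, .cup l' k h', rfl, rfl⟩]
  · rintro (h | ⟨x', y', h, rfl, rfl⟩)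
    · cases h with
      | left l k i g h hi => exact .left l k i g (left h) hi
      | right l k i g h => exact .right l k i g (left h)
      | crossRight l k x h => exact .crossRight l k x (left h)
      | crossLeft l k x h => exact .crossLeft l k x (left h)
      | cap l k h => exact .cap l k (left h)
      | cup l k h => exact .cup l k (left h)
    · cases h with
      | left l k i g h hi => exact .left _ k i g (right h) hi
      | right l k i g h => exact .right _ k i g (right h)
      | crossRight l k x h => exact .crossRight _ k x (right h)
      | crossLeft l k x h => exact .crossLeft _ k x (right h)
      | cap l k h => exact .cap _ k (right h)
      | cup l k h => exact .cup _ k (right h)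

theorem adj_cons {p : ℕ × Gen} {w : Word} {x y : ℕ × ℕ} : Adj (p :: w) x y ↔
    Adj [p] x y ∨ ∃ x' y', Adj w x' y' ∧ x = raise 1 x' ∧ y = raise 1 y' :=
  adj_append (v := [p])

theorem adj_nil {x y : ℕ × ℕ} : ¬ Adj [] x y := by
  intro h
  cases h <;> simp_all

theorem adj_cross {k : ℕ} {c : Crossing} {x y : ℕ × ℕ} : Adj [(k, .cross c)] x y ↔
    ∃ i, x = (0, i) ∧ y = (1, Equiv.swap k (k + 1) i) := by
  constructor
  · intro h
    cases h with
    | left l k i g h hi =>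
      simp only [List.getElem?_singleton, Option.ite_none_right_eq_some, Option.some.injEq,
        Prod.mk.injEq] at h
      obtain ⟨rfl, rfl, rfl⟩ := h
      exact ⟨i, rfl, by rw [Equiv.swap_apply_of_ne_of_ne (by omega) (by omega)]⟩
    | right l k i g h =>
      simp only [List.getElem?_singleton, Option.ite_none_right_eq_some, Option.some.injEq,
        Prod.mk.injEq] at h
      obtain ⟨rfl, rfl, rfl⟩ := h
      refine ⟨_, rfl, ?_⟩
      simp only [Gen.ins, Gen.outs]
      rw [Equiv.swap_apply_of_ne_of_ne (by omega) (by omega)]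
    | crossRight l k x h =>
      simp only [List.getElem?_singleton, Option.ite_none_right_eq_some, Option.some.injEq,
        Prod.mk.injEq, Gen.cross.injEq] at h
      obtain ⟨rfl, rfl, rfl⟩ := h
      exact ⟨_, rfl, by rw [Equiv.swap_apply_left]⟩
    | crossLeft l k x h =>
      simp only [List.getElem?_singleton, Option.ite_none_right_eq_some, Option.some.injEq,
        Prod.mk.injEq, Gen.cross.injEq] at h
      obtain ⟨rfl, rfl, rfl⟩ := h
      exact ⟨_, rfl, by rw [Equiv.swap_apply_right]⟩
    | cap l k h => simp [List.getElem?_singleton] at h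
    | cup l k h => simp [List.getElem?_singleton] at h
  · rintro ⟨i, rfl, rfl⟩
    rcases lt_trichotomy i k with hi | rfl | hi
    · rw [Equiv.swap_apply_of_ne_of_ne (by omega) (by omega)]
      exact .left 0 k i _ rfl hi
    · rw [Equiv.swap_apply_left]
      exact .crossRight 0 i c rfl
    · rcases eq_or_lt_of_le (Nat.succ_le_of_lt hi) with rfl | hi
      · rw [Equiv.swap_apply_right]
        exact .crossLeft 0 k c rfl
      · obtain ⟨i, rfl⟩ := Nat.exists_eq_add_of_le (show k + 2 ≤ i by omega)
        rw [Equiv.swap_apply_of_ne_of_ne (by omega) (by omega)]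
        exact .right 0 k i (.cross c) rfl

/-- The place `i`, after two places to the right of `k` strands have been inserted. -/
def skip (k i : ℕ) : ℕ := if i < k then i else i + 2

theorem adj_cap {k : ℕ} {x y : ℕ × ℕ} : Adj [(k, .cap)] x y ↔
    (x = (0, k) ∧ y = (0, k + 1)) ∨ ∃ i, x = (0, skip k i) ∧ y = (1, i) := by
  constructor
  · intro h
    cases h with
    | left l k i g h hi =>
      simp only [List.getElem?_singleton, Option.ite_none_right_eq_some, Option.some.injEq,
        Prod.mk.injEq] at h
      obtain ⟨rfl, rfl, rfl⟩ := h
      exact Or.inr ⟨i, by rw [skip, if_pos hi], rfl⟩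
    | right l k i g h =>
      simp only [List.getElem?_singleton, Option.ite_none_right_eq_some, Option.some.injEq,
        Prod.mk.injEq] at h
      obtain ⟨rfl, rfl, rfl⟩ := h
      refine Or.inr ⟨_, ?_, rfl⟩
      simp only [Gen.ins, Gen.outs]
      rw [skip, if_neg (by omega)]
      congr 1
      omega
    | crossRight l k x h => simp [List.getElem?_singleton] at h
    | crossLeft l k x h => simp [List.getElem?_singleton] at h
    | cap l k h =>
      simp only [List.getElem?_singleton, Option.ite_none_right_eq_some, Option.some.injEq,
        Prod.mk.injEq, and_true] at h
      obtain ⟨rfl, rfl⟩ := h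
      exact Or.inl ⟨rfl, rfl⟩
    | cup l k h => simp [List.getElem?_singleton] at h
  · rintro (⟨rfl, rfl⟩ | ⟨i, rfl, rfl⟩)
    · exact .cap 0 k rfl
    · rw [skip]
      split_ifs with hi
      · exact .left 0 k i _ rfl hi
      · obtain ⟨i, rfl⟩ := Nat.exists_eq_add_of_le (not_lt.1 hi)
        rw [Nat.add_right_comm]
        exact .right 0 k i .cap rfl

theorem adj_cup {k : ℕ} {x y : ℕ × ℕ} : Adj [(k, .cup)] x y ↔
    (x = (1, k) ∧ y = (1, k + 1)) ∨ ∃ i, x = (0, i) ∧ y = (1, skip k i) := by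
  constructor
  · intro h
    cases h with
    | left l k i g h hi =>
      simp only [List.getElem?_singleton, Option.ite_none_right_eq_some, Option.some.injEq,
        Prod.mk.injEq] at h
      obtain ⟨rfl, rfl, rfl⟩ := h
      exact Or.inr ⟨i, rfl, by rw [skip, if_pos hi]⟩
    | right l k i g h =>
      simp only [List.getElem?_singleton, Option.ite_none_right_eq_some, Option.some.injEq,
        Prod.mk.injEq] at h
      obtain ⟨rfl, rfl, rfl⟩ := h
      refine Or.inr ⟨_, rfl, ?_⟩
      simp only [Gen.ins, Gen.outs]
      rw [skip, if_neg (by omega)]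
      congr 1
      omega
    | crossRight l k x h => simp [List.getElem?_singleton] at h
    | crossLeft l k x h => simp [List.getElem?_singleton] at h
    | cap l k h => simp [List.getElem?_singleton] at h
    | cup l k h =>
      simp only [List.getElem?_singleton, Option.ite_none_right_eq_some, Option.some.injEq,
        Prod.mk.injEq, and_true] at h
      obtain ⟨rfl, rfl⟩ := h
      exact Or.inl ⟨rfl, rfl⟩
  · rintro (⟨rfl, rfl⟩ | ⟨i, rfl, rfl⟩)
    · exact .cup 0 k rfl
    · rw [skip]
      split_ifs with hi
      · exact .left 0 k i _ rfl hi
      · obtain ⟨i, rfl⟩ := Nat.exists_eq_add_of_le (not_lt.1 hi)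
        rw [Nat.add_right_comm]
        exact .right 0 k i .cup rfl

theorem SameStrand.append_right {v : Word} {x y : ℕ × ℕ} (h : SameStrand v x y) (w : Word) :
    SameStrand (v ++ w) x y :=
  SameStrand.map (f := _root_.id) (fun _ _ h => (adj_append.2 (Or.inl h)).sameStrand) h

theorem SameStrand.append_left {w : Word} {x y : ℕ × ℕ} (h : SameStrand w x y) (v : Word) :
    SameStrand (v ++ w) (raise v.length x) (raise v.length y) :=
  SameStrand.map (fun _ _ h => (adj_append.2 (Or.inr ⟨_, _, h, rfl, rfl⟩)).sameStrand) h

theorem length_shift (k : ℕ) (w : Word) : (shift k w).length = w.length := List.length_map _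

theorem getElem?_shift {k l a : ℕ} {g : Gen} {w : Word} :
    (shift k w)[l]? = some (a, g) ↔ ∃ b, w[l]? = some (b, g) ∧ a = k + b := by
  simp only [shift, List.getElem?_map, Option.map_eq_some_iff, Prod.mk.injEq]
  constructor
  · rintro ⟨⟨b, g'⟩, h, rfl, rfl⟩
    exact ⟨b, h, rfl⟩
  · rintro ⟨b, h, rfl⟩
    exact ⟨_, h, rfl, rfl⟩

theorem adj_shift {k : ℕ} {w : Word} {x y : ℕ × ℕ} : Adj (shift k w) x y ↔
    (∃ x' y', Adj w x' y' ∧ x = moveRight k x' ∧ y = moveRight k y') ∨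
      ∃ l i, l < w.length ∧ i < k ∧ x = (l, i) ∧ y = (l + 1, i) := by
  constructor
  · intro h
    cases h with
    | left l a i g h hi =>
      obtain ⟨b, h', rfl⟩ := getElem?_shift.1 h
      rcases lt_or_ge i k with hk | hk
      · exact Or.inr ⟨l, i, (List.getElem?_eq_some_iff.1 h').1, hk, rfl, rfl⟩
      · obtain ⟨i, rfl⟩ := Nat.exists_eq_add_of_le hk
        exact Or.inl ⟨_, _, .left l b i g h' (by omega), rfl, rfl⟩
    | right l a i g h =>
      obtain ⟨b, h', rfl⟩ := getElem?_shift.1 h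
      exact Or.inl ⟨_, _, .right l b i g h', by simp [moveRight, add_assoc],
        by simp [moveRight, add_assoc]⟩
    | crossRight l a x h =>
      obtain ⟨b, h', rfl⟩ := getElem?_shift.1 h
      exact Or.inl ⟨_, _, .crossRight l b x h', rfl, rfl⟩
    | crossLeft l a x h =>
      obtain ⟨b, h', rfl⟩ := getElem?_shift.1 h
      exact Or.inl ⟨_, _, .crossLeft l b x h', rfl, rfl⟩
    | cap l a h =>
      obtain ⟨b, h', rfl⟩ := getElem?_shift.1 h
      exact Or.inl ⟨_, _, .cap l b h', rfl, rfl⟩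
    | cup l a h =>
      obtain ⟨b, h', rfl⟩ := getElem?_shift.1 h
      exact Or.inl ⟨_, _, .cup l b h', rfl, rfl⟩
  · rintro (⟨x', y', h, rfl, rfl⟩ | ⟨l, i, hl, hi, rfl, rfl⟩)
    · cases h with
      | left l a i g h hi =>
        exact .left _ (k + a) _ g (getElem?_shift.2 ⟨_, h, rfl⟩) (by simpa using hi)
      | right l a i g h =>
        have := Adj.right l (k + a) i g (getElem?_shift.2 ⟨_, h, rfl⟩)
        simpa only [moveRight, add_assoc] using this
      | crossRight l a x h => exact .crossRight _ (k + a) x (getElem?_shift.2 ⟨_, h, rfl⟩)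
      | crossLeft l a x h => exact .crossLeft _ (k + a) x (getElem?_shift.2 ⟨_, h, rfl⟩)
      | cap l a h => exact .cap _ (k + a) (getElem?_shift.2 ⟨_, h, rfl⟩)
      | cup l a h => exact .cup _ (k + a) (getElem?_shift.2 ⟨_, h, rfl⟩)
    · exact .left l (k + w[l].1) i w[l].2
        (getElem?_shift.2 ⟨_, List.getElem?_eq_getElem hl, rfl⟩) (by omega)

theorem SameStrand.shift {w : Word} {x y : ℕ × ℕ} (h : SameStrand w x y) (k : ℕ) :
    SameStrand (shift k w) (moveRight k x) (moveRight k y) :=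
  SameStrand.map (fun _ _ h => (adj_shift.2 (Or.inl ⟨_, _, h, rfl, rfl⟩)).sameStrand) h

theorem sameStrand_shift_vertical {k i l : ℕ} {w : Word} (hi : i < k) (hl : l ≤ w.length) :
    SameStrand (LocalMoves.shift k w) (l, i) (0, i) := by
  induction l with
  | zero => exact .refl _
  | succ l ih =>
    exact (adj_shift.2 (Or.inr ⟨l, i, hl, hi, rfl, rfl⟩)).sameStrand.symm.trans
      (ih (Nat.le_of_succ_le hl))

end LocalMoves

namespace LocalMoves

/-! ### Invariance of strands -/

/-- A map of points which maps strands to strands and respects the endpoints. -/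
structure StrandMap (v w : Word) (f : ℕ × ℕ → ℕ × ℕ) : Prop where
  adj : ∀ x y, Adj v x y → SameStrand w (f x) (f y)
  bot : ∀ i, SameStrand w (f (0, i)) (0, i)
  top : ∀ i, SameStrand w (f (v.length, i)) (w.length, i)
  level : ∀ x, x.1 ≤ v.length → (f x).1 ≤ w.length

/-- Two words have the same strands. -/
def StrandEquiv (v w : Word) : Prop :=
  ∃ f g, StrandMap v w f ∧ StrandMap w v g ∧
    (∀ x, x.1 ≤ v.length → SameStrand v (g (f x)) x) ∧
    ∀ x, x.1 ≤ w.length → SameStrand w (f (g x)) x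

theorem StrandEquiv.symm {v w : Word} (h : StrandEquiv v w) : StrandEquiv w v := by
  obtain ⟨f, g, hf, hg, h1, h2⟩ := h
  exact ⟨g, f, hg, hf, h2, h1⟩

/-- Extension of a map of points to words with `a` further layers below. -/
def extendBelow (a : ℕ) (f : ℕ × ℕ → ℕ × ℕ) (x : ℕ × ℕ) : ℕ × ℕ :=
  if x.1 < a then x else raise a (f (x.1 - a, x.2))

theorem extendBelow_raise (a : ℕ) (f : ℕ × ℕ → ℕ × ℕ) (x : ℕ × ℕ) :
    extendBelow a f (raise a x) = raise a (f x) := by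
  rw [extendBelow, if_neg (by simp [raise])]
  simp [raise]

theorem extendBelow_of_le {w : Word} {f : ℕ × ℕ → ℕ × ℕ}
    (hf : ∀ i, SameStrand w (f (0, i)) (0, i)) (u : Word) {x : ℕ × ℕ} (hx : x.1 ≤ u.length) :
    SameStrand (u ++ w) (extendBelow u.length f x) x := by
  obtain ⟨l, i⟩ := x
  rcases eq_or_lt_of_le hx with rfl | hx
  · have := extendBelow_raise u.length f (0, i)
    simp only [raise, add_zero] at this
    rw [this]
    exact (hf i).append_left u
  · rw [extendBelow, if_pos hx]
    exact .refl _

theorem length_pos_of_adj {v : Word} {x y : ℕ × ℕ} (h : Adj v x y) :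
    x.1 ≤ v.length ∧ y.1 ≤ v.length := by
  cases h <;> rename_i h <;> have h' := (List.getElem?_eq_some_iff.1 ‹_›).1 <;>
    constructor <;> simp <;> omega

theorem StrandMap.append_left {v w : Word} {f : ℕ × ℕ → ℕ × ℕ} (h : StrandMap v w f) (u : Word) :
    StrandMap (u ++ v) (u ++ w) (extendBelow u.length f) where
  adj x y hxy := by
    rcases adj_append.1 hxy with hxy | ⟨x, y, hxy', rfl, rfl⟩
    · have hl := length_pos_of_adj hxy
      exact (extendBelow_of_le h.bot u hl.1).trans ((hxy.sameStrand.append_right w).trans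
        (extendBelow_of_le h.bot u hl.2).symm)
    · rw [extendBelow_raise, extendBelow_raise]
      exact (h.adj x y hxy').append_left u
  bot i := extendBelow_of_le h.bot u (Nat.zero_le _)
  top i := by
    rw [List.length_append, List.length_append]
    have := extendBelow_raise u.length f (v.length, i)
    simp only [raise] at this
    rw [this]
    exact (h.top i).append_left u
  level x hx := by
    rw [List.length_append] at hx ⊢
    rw [extendBelow]
    split_ifs with h1
    · omega
    · have := h.level (x.1 - u.length, x.2) (by simp only; omega)
      simp only [raise]
      omega

theorem StrandEquiv.append_left {v w : Word} (h : StrandEquiv v w) (u : Word) :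
    StrandEquiv (u ++ v) (u ++ w) := by
  obtain ⟨f, g, hf, hg, h1, h2⟩ := h
  refine ⟨_, _, hf.append_left u, hg.append_left u, ?_, ?_⟩
  · intro x hx
    rw [List.length_append] at hx
    rcases lt_or_ge x.1 u.length with hl | hl
    · rw [extendBelow, extendBelow, if_pos hl, if_pos hl]
      exact .refl _
    · obtain ⟨y, rfl⟩ : ∃ y, x = raise u.length y :=
        ⟨(x.1 - u.length, x.2), by simp [raise, Nat.add_sub_cancel' hl]⟩
      rw [extendBelow_raise, extendBelow_raise]
      exact (h1 y (by simpa [raise] using hx)).append_left u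
  · intro x hx
    rw [List.length_append] at hx
    rcases lt_or_ge x.1 u.length with hl | hl
    · rw [extendBelow, extendBelow, if_pos hl, if_pos hl]
      exact .refl _
    · obtain ⟨y, rfl⟩ : ∃ y, x = raise u.length y :=
        ⟨(x.1 - u.length, x.2), by simp [raise, Nat.add_sub_cancel' hl]⟩
      rw [extendBelow_raise, extendBelow_raise]
      exact (h2 y (by simpa [raise] using hx)).append_left u

/-- Extension of a map from the points of a word with `a` layers to the points of a word with `b`
layers, to words with further layers above. -/
def extendAbove (a b : ℕ) (f : ℕ × ℕ → ℕ × ℕ) (x : ℕ × ℕ) : ℕ × ℕ :=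
  if x.1 ≤ a then f x else (b + (x.1 - a), x.2)

theorem StrandMap.extendAbove_raise {v w : Word} {f : ℕ × ℕ → ℕ × ℕ} (h : StrandMap v w f)
    (u : Word) (x : ℕ × ℕ) :
    SameStrand (w ++ u) (extendAbove v.length w.length f (raise v.length x))
      (raise w.length x) := by
  obtain ⟨_ | l, i⟩ := x
  · simp only [extendAbove, raise, add_zero, le_refl, if_true]
    exact (h.top i).append_right u
  · rw [extendAbove, if_neg (by simp [raise])]
    simp only [raise, Nat.add_sub_cancel_left]
    exact .refl _

theorem StrandMap.append_right {v w : Word} {f : ℕ × ℕ → ℕ × ℕ} (h : StrandMap v w f) (u : Word) :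
    StrandMap (v ++ u) (w ++ u) (extendAbove v.length w.length f) where
  adj x y hxy := by
    rcases adj_append.1 hxy with hxy | ⟨x, y, hxy', rfl, rfl⟩
    · have hl := length_pos_of_adj hxy
      rw [extendAbove, extendAbove, if_pos hl.1, if_pos hl.2]
      exact (h.adj x y hxy).append_right u
    · exact (h.extendAbove_raise u x).trans ((hxy'.sameStrand.append_left w).trans
        (h.extendAbove_raise u y).symm)
  bot i := by
    rw [extendAbove, if_pos (Nat.zero_le _)]
    exact (h.bot i).append_right u
  top i := by
    rw [List.length_append, List.length_append]
    exact h.extendAbove_raise u (u.length, i)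
  level x hx := by
    rw [List.length_append] at hx ⊢
    rw [extendAbove]
    split_ifs with h1
    · have := h.level x h1
      omega
    · simp only
      omega

theorem extendAbove_extendAbove {v w : Word} {f g : ℕ × ℕ → ℕ × ℕ} (hf : StrandMap v w f)
    (h : ∀ x, x.1 ≤ v.length → SameStrand v (g (f x)) x) (u : Word) (x : ℕ × ℕ) :
    SameStrand (v ++ u)
      (extendAbove w.length v.length g (extendAbove v.length w.length f x)) x := by
  rcases le_or_gt x.1 v.length with hx | hx
  · have e1 : extendAbove v.length w.length f x = f x := if_pos hx
    have e2 : extendAbove w.length v.length g (f x) = g (f x) := if_pos (hf.level x hx)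
    rw [e1, e2]
    exact (h x hx).append_right u
  · have e1 : extendAbove v.length w.length f x = (w.length + (x.1 - v.length), x.2) :=
      if_neg (not_le.2 hx)
    have e2 : extendAbove w.length v.length g (w.length + (x.1 - v.length), x.2) = x := by
      rw [extendAbove, if_neg (by simp only; omega)]
      ext
      · simp only
        omega
      · rfl
    rw [e1, e2]
    exact .refl _

theorem StrandEquiv.append_right {v w : Word} (h : StrandEquiv v w) (u : Word) :
    StrandEquiv (v ++ u) (w ++ u) := by
  obtain ⟨f, g, hf, hg, h1, h2⟩ := h
  exact ⟨_, _, hf.append_right u, hg.append_right u,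
    fun x _ => extendAbove_extendAbove hf h1 u x, fun x _ => extendAbove_extendAbove hg h2 u x⟩

/-- Extension of a map of points to words with `k` further strands on the left. -/
def extendLeft (k : ℕ) (f : ℕ × ℕ → ℕ × ℕ) (x : ℕ × ℕ) : ℕ × ℕ :=
  -- The added strands are vertical, so all their points may be represented by the lowest one.
  if x.2 < k then (0, x.2) else moveRight k (f (x.1, x.2 - k))

theorem extendLeft_moveRight (k : ℕ) (f : ℕ × ℕ → ℕ × ℕ) (x : ℕ × ℕ) :
    extendLeft k f (moveRight k x) = moveRight k (f x) := by
  rw [extendLeft, if_neg (by simp [moveRight])]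
  simp [moveRight]

theorem eq_or_eq_moveRight (k : ℕ) (x : ℕ × ℕ) : x.2 < k ∨ ∃ y, x = moveRight k y := by
  rcases lt_or_ge x.2 k with h | h
  · exact Or.inl h
  · exact Or.inr ⟨(x.1, x.2 - k), by simp [moveRight, Nat.add_sub_cancel' h]⟩

theorem extendLeft_of_lt {k : ℕ} (f : ℕ × ℕ → ℕ × ℕ) {x : ℕ × ℕ} (h : x.2 < k) :
    extendLeft k f x = (0, x.2) := if_pos h

theorem StrandMap.shift {v w : Word} {f : ℕ × ℕ → ℕ × ℕ} (h : StrandMap v w f) (k : ℕ) :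
    StrandMap (shift k v) (shift k w) (extendLeft k f) where
  adj x y hxy := by
    rcases adj_shift.1 hxy with ⟨x, y, hxy', rfl, rfl⟩ | ⟨l, i, hl, hi, rfl, rfl⟩
    · rw [extendLeft_moveRight, extendLeft_moveRight]
      exact (h.adj x y hxy').shift k
    · rw [extendLeft_of_lt f hi, extendLeft_of_lt f hi]
      exact .refl _
  bot i := by
    rcases eq_or_eq_moveRight k (0, i) with hi | ⟨⟨l, j⟩, hj⟩
    · rw [extendLeft_of_lt f hi]
      exact .refl _
    · simp only [moveRight, Prod.mk.injEq] at hj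
      obtain ⟨rfl, rfl⟩ := hj
      have := (h.bot j).shift k
      rwa [← extendLeft_moveRight] at this
  top i := by
    rw [length_shift, length_shift]
    rcases eq_or_eq_moveRight k (v.length, i) with hi | ⟨⟨l, j⟩, hj⟩
    · rw [extendLeft_of_lt f hi]
      exact (sameStrand_shift_vertical hi le_rfl).symm
    · simp only [moveRight, Prod.mk.injEq] at hj
      obtain ⟨rfl, rfl⟩ := hj
      have := (h.top j).shift k
      rwa [← extendLeft_moveRight] at this
  level x hx := by
    rw [length_shift] at hx ⊢
    rcases eq_or_eq_moveRight k x with hi | ⟨y, rfl⟩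
    · rw [extendLeft_of_lt f hi]
      exact Nat.zero_le _
    · rw [extendLeft_moveRight]
      exact h.level y hx

theorem extendLeft_extendLeft {k : ℕ} {v : Word} {f g : ℕ × ℕ → ℕ × ℕ}
    (h : ∀ x, x.1 ≤ v.length → SameStrand v (g (f x)) x) {x : ℕ × ℕ}
    (hx : x.1 ≤ (shift k v).length) :
    SameStrand (shift k v) (extendLeft k g (extendLeft k f x)) x := by
  rw [length_shift] at hx
  rcases eq_or_eq_moveRight k x with hi | ⟨y, rfl⟩
  · rw [extendLeft_of_lt f hi, extendLeft_of_lt (x := (0, x.2)) g hi]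
    exact (sameStrand_shift_vertical hi hx).symm
  · rw [extendLeft_moveRight, extendLeft_moveRight]
    exact (h y hx).shift k

theorem StrandEquiv.shift {v w : Word} (h : StrandEquiv v w) (k : ℕ) :
    StrandEquiv (shift k v) (shift k w) := by
  obtain ⟨f, g, hf, hg, h1, h2⟩ := h
  exact ⟨_, _, hf.shift k, hg.shift k, fun _ hx => extendLeft_extendLeft h1 hx,
    fun _ hx => extendLeft_extendLeft h2 hx⟩

theorem StrandEquiv.of_locally {P : Word → Word → Prop} (h : ∀ u u', P u u' → StrandEquiv u u')
    {v w : Word} (hvw : Locally P v w) : StrandEquiv v w := by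
  obtain ⟨A, B, k, u, u', hP, rfl, rfl⟩ := hvw
  exact (((h u u' hP).shift k).append_left A).append_right B

/-! ### The strands of the elementary moves -/

/-- The endpoints of a word. -/
def endpoint (w : Word) : ℕ ⊕ ℕ → ℕ × ℕ
  | .inl i => (0, i)
  | .inr i => (w.length, i)

/-- A map which attaches to each point one of the endpoints of its strand. -/
structure IsTrace (w : Word) (φ : ℕ × ℕ → ℕ ⊕ ℕ) : Prop where
  adj : ∀ x y, Adj w x y → φ x = φ y
  trace : ∀ l ≤ w.length, ∀ i, SameStrand w (endpoint w (φ (l, i))) (l, i)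

/-- In a word without closed components each strand is known by one of its endpoints, so a point of
`v` can be sent to the endpoint of `w` with the same name. Two words whose traces agree on the
endpoints then have the same strands. -/
theorem IsTrace.strandMap {v w : Word} {φ ψ : ℕ × ℕ → ℕ ⊕ ℕ} (hv : IsTrace v φ)
    (hw : IsTrace w ψ) (h : ∀ b, φ (endpoint v b) = ψ (endpoint w b)) :
    StrandMap v w (fun x => endpoint w (φ x)) where
  adj x y hxy := by
    rw [hv.adj x y hxy]
    exact .refl _
  bot i := by
    have e := h (.inl i)
    simp only [endpoint] at e
    rw [e]
    exact hw.trace 0 (Nat.zero_le _) i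
  top i := by
    have e := h (.inr i)
    simp only [endpoint] at e
    rw [e]
    exact hw.trace _ le_rfl i
  level x _ := by
    rcases φ x with i | i
    exacts [Nat.zero_le _, le_rfl]

theorem IsTrace.apply_endpoint {v w : Word} {φ ψ : ℕ × ℕ → ℕ ⊕ ℕ} (hv : IsTrace v φ)
    (h : ∀ b, φ (endpoint v b) = ψ (endpoint w b)) {x : ℕ × ℕ} (hx : x.1 ≤ v.length) :
    SameStrand v (endpoint v (ψ (endpoint w (φ x)))) x := by
  rw [← h]
  have h1 := hv.trace x.1 hx x.2
  refine SameStrand.trans ?_ h1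
  have h2 (b : ℕ ⊕ ℕ) : (endpoint v b).1 ≤ v.length := by
    rcases b with i | i
    exacts [Nat.zero_le _, le_rfl]
  exact hv.trace _ (h2 _) _

theorem IsTrace.strandEquiv {v w : Word} {φ ψ : ℕ × ℕ → ℕ ⊕ ℕ} (hv : IsTrace v φ)
    (hw : IsTrace w ψ) (h : ∀ b, φ (endpoint v b) = ψ (endpoint w b)) : StrandEquiv v w :=
  ⟨_, _, hv.strandMap hw h, hw.strandMap hv fun b => (h b).symm,
    fun _ hx => hv.apply_endpoint h hx, fun _ hx => hw.apply_endpoint (fun b => (h b).symm) hx⟩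

/-- The permutation of the places from bottom to top by a word of crossings. -/
def perm : Word → ℕ ≃ ℕ
  | [] => Equiv.refl ℕ
  | p :: w => (Equiv.swap p.1 (p.1 + 1)).trans (perm w)

/-- All layers of the word are crossings. -/
def IsBraid (w : Word) : Prop := ∀ p ∈ w, ∃ x, p.2 = .cross x

theorem IsBraid.of_cons {p : ℕ × Gen} {w : Word} (h : IsBraid (p :: w)) :
    (∃ x, p = (p.1, .cross x)) ∧ IsBraid w := by
  refine ⟨?_, fun q hq => h q (List.mem_cons_of_mem _ hq)⟩
  obtain ⟨x, hx⟩ := h p List.mem_cons_self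
  exact ⟨x, Prod.ext rfl hx⟩

theorem IsBraid.isTrace {w : Word} (h : IsBraid w) :
    IsTrace w fun x => .inl ((perm (w.take x.1)).symm x.2) := by
  induction w with
  | nil =>
    refine ⟨fun x y h => absurd h adj_nil, fun l hl i => ?_⟩
    simp only [List.length_nil, nonpos_iff_eq_zero] at hl
    subst hl
    exact .refl _
  | cons p w ih =>
    obtain ⟨⟨c, hc⟩, hw⟩ := h.of_cons
    rw [hc]
    generalize p.1 = k
    have ih := ih hw
    constructor
    · intro x y hxy
      rcases adj_cons.1 hxy with hxy | ⟨x, y, hxy', rfl, rfl⟩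
      · obtain ⟨i, rfl, rfl⟩ := adj_cross.1 hxy
        simp [perm]
      · have := ih.adj x y hxy'
        simp only [Sum.inl.injEq] at this
        simp [raise, add_comm 1, perm, this]
    · intro l hl i
      rcases l with _ | l
      · exact .refl _
      · simp only [endpoint, List.take_succ_cons, perm, Equiv.symm_trans_apply,
          Equiv.symm_swap]
        have h1 := ((ih.trace l (by simpa using hl) i).append_left [(k, .cross c)])
        simp only [endpoint, raise, List.length_singleton, List.singleton_append] at h1
        rw [add_comm 1] at h1
        refine SameStrand.trans
          (Adj.sameStrand (adj_cons.2 (Or.inl (adj_cross.2 ⟨_, rfl, rfl⟩)))) ?_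
        rw [Equiv.swap_apply_self, add_comm l]
        exact (add_comm 1 l) ▸ h1

theorem IsBraid.strandEquiv {v w : Word} (hv : IsBraid v) (hw : IsBraid w)
    (h : perm v = perm w) : StrandEquiv v w := by
  refine hv.isTrace.strandEquiv hw.isTrace ?_
  rintro (i | i)
  · simp [endpoint, perm]
  · simp [endpoint, h]

end LocalMoves

namespace LocalMoves

theorem sameStrand_layer {w : Word} {l : ℕ} {p : ℕ × Gen} (h : w[l]? = some p) {x y : ℕ × ℕ}
    (hxy : Adj [p] x y) : SameStrand w (raise l x) (raise l y) := by
  obtain ⟨hl, rfl⟩ := List.getElem?_eq_some_iff.1 h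
  have h1 := (hxy.sameStrand.append_right (w.drop (l + 1))).append_left (w.take l)
  rwa [List.singleton_append, List.cons_getElem_drop_succ, List.take_append_drop,
    List.length_take, min_eq_left hl.le] at h1

theorem sameStrand_cross {w : Word} {l k : ℕ} {c : Crossing} (h : w[l]? = some (k, .cross c))
    (i : ℕ) : SameStrand w (l, i) (l + 1, Equiv.swap k (k + 1) i) :=
  sameStrand_layer h (adj_cross.2 ⟨i, rfl, rfl⟩)

theorem sameStrand_cross_swap {w : Word} {l k : ℕ} {c : Crossing} (h : w[l]? = some (k, .cross c))
    (i : ℕ) : SameStrand w (l, Equiv.swap k (k + 1) i) (l + 1, i) := by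
  simpa only [Equiv.swap_apply_self] using sameStrand_cross h (Equiv.swap k (k + 1) i)

theorem sameStrand_cap {w : Word} {l k : ℕ} (h : w[l]? = some (k, .cap)) (i : ℕ) :
    SameStrand w (l, skip k i) (l + 1, i) :=
  sameStrand_layer h (adj_cap.2 (Or.inr ⟨i, rfl, rfl⟩))

theorem sameStrand_cup {w : Word} {l k : ℕ} (h : w[l]? = some (k, .cup)) (i : ℕ) :
    SameStrand w (l, i) (l + 1, skip k i) :=
  sameStrand_layer h (adj_cup.2 (Or.inr ⟨i, rfl, rfl⟩))

theorem isTrace_nil : IsTrace [] fun x => .inl x.2 := by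
  simpa [perm] using IsBraid.isTrace (w := []) fun _ h => absurd h List.not_mem_nil

/-- At the middle level the places 0, 1, 2 all lie on the strand of endpoint 0, and place i + 2 on
that of endpoint i; truncated subtraction covers both cases. The curl below uses the same formula on
its two inner levels. -/
theorem isTrace_zigzag : IsTrace [(1, .cup), (0, .cap)]
    fun x => .inl (if x.1 = 1 then x.2 - 2 else x.2) where
  adj x y h := by
    rcases adj_cons.1 h with h | ⟨x, y, h', rfl, rfl⟩
    · rcases adj_cup.1 h with ⟨rfl, rfl⟩ | ⟨i, rfl, rfl⟩
      · rfl
      · simp only [skip]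
        split_ifs <;> simp_all
    · rcases adj_cap.1 h' with ⟨rfl, rfl⟩ | ⟨i, rfl, rfl⟩ <;> simp [raise, skip]
  trace l hl i := by
    have h1 (i : ℕ) : SameStrand [(1, .cup), (0, .cap)] (0, i) (1, skip 1 i) := sameStrand_cup rfl i
    have h2 : SameStrand [(1, .cup), (0, .cap)] (1, 1) (1, 2) := (Adj.cup 0 1 rfl).sameStrand
    have h3 : SameStrand [(1, .cup), (0, .cap)] (1, 0) (1, 1) := (Adj.cap 1 0 rfl).sameStrand
    have h4 (i : ℕ) : SameStrand [(1, .cup), (0, .cap)] (0, i - 2) (1, i) := by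
      rcases i with _ | _ | _ | i
      exacts [h1 0, (h1 0).trans h3, ((h1 0).trans h3).trans h2, h1 (i + 1)]
    obtain rfl | rfl | rfl : l = 0 ∨ l = 1 ∨ l = 2 := by simp at hl; omega
    exacts [.refl _, h4 i, (h4 (i + 2)).trans (sameStrand_cap (l := 1) (k := 0) rfl i)]

theorem isTrace_zigzag' : IsTrace [(0, .cup), (1, .cap)]
    fun x => .inl (if x.1 = 1 then x.2 - 2 else x.2) where
  adj x y h := by
    rcases adj_cons.1 h with h | ⟨x, y, h', rfl, rfl⟩
    · rcases adj_cup.1 h with ⟨rfl, rfl⟩ | ⟨i, rfl, rfl⟩ <;> simp [skip]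
    · rcases adj_cap.1 h' with ⟨rfl, rfl⟩ | ⟨i, rfl, rfl⟩
      · rfl
      · simp only [skip, raise]
        split_ifs <;> simp_all
  trace l hl i := by
    have h1 (i : ℕ) : SameStrand [(0, .cup), (1, .cap)] (0, i) (1, skip 0 i) := sameStrand_cup rfl i
    have h2 : SameStrand [(0, .cup), (1, .cap)] (1, 0) (1, 1) := (Adj.cup 0 0 rfl).sameStrand
    have h3 : SameStrand [(0, .cup), (1, .cap)] (1, 1) (1, 2) := (Adj.cap 1 1 rfl).sameStrand
    have h4 (i : ℕ) : SameStrand [(0, .cup), (1, .cap)] (0, i - 2) (1, i) := by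
      rcases i with _ | _ | i
      exacts [((h1 0).trans h3.symm).trans h2.symm, (h1 0).trans h3.symm, h1 i]
    have h5 : SameStrand [(0, .cup), (1, .cap)] (1, skip 1 i) (2, i) :=
      sameStrand_cap (l := 1) rfl i
    obtain rfl | rfl | rfl : l = 0 ∨ l = 1 ∨ l = 2 := by simp at hl; omega
    · exact .refl _
    · exact h4 i
    · rcases i with _ | i
      exacts [(h4 0).trans h5, (h4 (i + 3)).trans h5]

theorem isTrace_kink (c : Crossing) : IsTrace [(1, .cup), (0, .cross c), (1, .cap)]
    fun x => .inl (if x.1 = 1 ∨ x.1 = 2 then x.2 - 2 else x.2) where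
  adj x y h := by
    rcases adj_cons.1 h with h | ⟨x, y, h', rfl, rfl⟩
    · rcases adj_cup.1 h with ⟨rfl, rfl⟩ | ⟨i, rfl, rfl⟩
      · rfl
      · simp only [skip]
        split_ifs <;> simp_all
    rcases adj_cons.1 h' with h' | ⟨x, y, h'', rfl, rfl⟩
    · obtain ⟨i, rfl, rfl⟩ := adj_cross.1 h'
      rcases i with _ | _ | i
      · simp [raise]
      · simp [raise]
      · rw [Equiv.swap_apply_of_ne_of_ne (by omega) (by omega)]
        simp [raise]
    · rcases adj_cap.1 h'' with ⟨rfl, rfl⟩ | ⟨i, rfl, rfl⟩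
      · rfl
      · simp only [skip, raise]
        split_ifs <;> simp_all
  trace l hl i := by
    generalize hw : [(1, Gen.cup), (0, .cross c), (1, .cap)] = w at hl ⊢
    have h1 (i : ℕ) : SameStrand w (0, i) (1, skip 1 i) := sameStrand_cup (by subst hw; rfl) i
    have h2 : SameStrand w (1, 1) (1, 2) := (Adj.cup 0 1 (by subst hw; rfl)).sameStrand
    have h3 (i : ℕ) : SameStrand w (1, i) (2, Equiv.swap 0 1 i) :=
      sameStrand_cross (l := 1) (k := 0) (c := c) (by subst hw; rfl) i
    have h4 : SameStrand w (2, 1) (2, 2) := (Adj.cap 2 1 (by subst hw; rfl)).sameStrand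
    have h5 : SameStrand w (2, skip 1 i) (3, i) := sameStrand_cap (l := 2) (by subst hw; rfl) i
    have a2 : SameStrand w (1, 2) (2, 2) := h3 2
    have a1 : SameStrand w (1, 1) (2, 0) := h3 1
    have a0 : SameStrand w (1, 0) (2, 1) := h3 0
    have b0 : SameStrand w (0, 0) (1, 0) := h1 0
    have b2 : SameStrand w (0, 0) (1, 2) := ((b0.trans a0).trans h4).trans a2.symm
    have b1 : SameStrand w (0, 0) (1, 1) := b2.trans h2.symm
    have h6 (i : ℕ) : SameStrand w (0, i - 2) (1, i) := by
      rcases i with _ | _ | _ | i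
      exacts [b0, b1, b2, h1 (i + 1)]
    have h7 (i : ℕ) : SameStrand w (0, i - 2) (2, i) := by
      rcases i with _ | _ | i
      · exact b1.trans a1
      · exact b0.trans a0
      · have := h3 (i + 2)
        rw [Equiv.swap_apply_of_ne_of_ne (by omega) (by omega)] at this
        exact (h6 (i + 2)).trans this
    obtain rfl | rfl | rfl | rfl : l = 0 ∨ l = 1 ∨ l = 2 ∨ l = 3 := by
      subst hw; simp at hl; omega
    · exact .refl _
    · exact h6 i
    · exact h7 i
    · subst hw
      rcases i with _ | i
      exacts [(h7 0).trans h5, (h7 (i + 3)).trans h5]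

/-- Each point is traced down to the bottom, and `f` then chooses one name for the two bottom
endpoints that the maximum joins. -/
theorem isTrace_cross_cap (j k : ℕ) (c : Crossing) {f : ℕ → ℕ}
    (hf : f (Equiv.swap j (j + 1) k) = f (Equiv.swap j (j + 1) (k + 1)))
    (hs : ∀ i, SameStrand [(j, .cross c), (k, .cap)] (0, f i) (0, i)) :
    IsTrace [(j, .cross c), (k, .cap)] fun x => .inl (f (match x.1 with
      | 0 => x.2
      | 1 => Equiv.swap j (j + 1) x.2
      | _ => Equiv.swap j (j + 1) (skip k x.2))) where
  adj x y h := by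
    rcases adj_cons.1 h with h | ⟨x, y, h', rfl, rfl⟩
    · obtain ⟨i, rfl, rfl⟩ := adj_cross.1 h
      simp
    · rcases adj_cap.1 h' with ⟨rfl, rfl⟩ | ⟨i, rfl, rfl⟩
      · simp only [raise, hf]
      · simp only [raise]
  trace l hl i := by
    obtain rfl | rfl | rfl : l = 0 ∨ l = 1 ∨ l = 2 := by simp at hl; omega
    exacts [hs i, (hs _).trans (sameStrand_cross_swap rfl i),
      ((hs _).trans (sameStrand_cross_swap rfl _)).trans (sameStrand_cap (l := 1) rfl i)]

theorem isTrace_cup_cross (j k : ℕ) (c : Crossing) {f : ℕ → ℕ}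
    (hf : f (Equiv.swap j (j + 1) k) = f (Equiv.swap j (j + 1) (k + 1)))
    (hs : ∀ i, SameStrand [(k, .cup), (j, .cross c)] (2, f i) (2, i)) :
    IsTrace [(k, .cup), (j, .cross c)] fun x => .inr (f (match x.1 with
      | 0 => Equiv.swap j (j + 1) (skip k x.2)
      | 1 => Equiv.swap j (j + 1) x.2
      | _ => x.2)) where
  adj x y h := by
    rcases adj_cons.1 h with h | ⟨x, y, h', rfl, rfl⟩
    · rcases adj_cup.1 h with ⟨rfl, rfl⟩ | ⟨i, rfl, rfl⟩
      · simp only [hf]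
      · simp only
    · obtain ⟨i, rfl, rfl⟩ := adj_cross.1 h'
      simp [raise]
  trace l hl i := by
    obtain rfl | rfl | rfl : l = 0 ∨ l = 1 ∨ l = 2 := by simp at hl; omega
    exacts [((hs _).trans (sameStrand_cross (l := 1) rfl _).symm).trans
      (sameStrand_cup rfl i).symm, (hs _).trans (sameStrand_cross (l := 1) rfl i).symm, hs i]

theorem strandEquiv_capSlide (c c' : Crossing) :
    StrandEquiv [(1, .cross c), (0, .cap)] [(0, .cross c'), (1, .cap)] := by
  refine (isTrace_cross_cap 1 0 c (f := fun i => if i = 2 then 0 else i) (by decide)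
    fun i => ?_).strandEquiv (isTrace_cross_cap 0 1 c' (f := fun i => if i = 2 then 0 else i)
    (by decide) fun i => ?_) ?_
  · split_ifs with h
    · subst h
      exact (sameStrand_cross (l := 0) (k := 1) (c := c) rfl 0).trans
        ((Adj.cap 1 0 rfl).sameStrand.trans
          (sameStrand_cross (l := 0) (k := 1) (c := c) rfl 2).symm)
    · exact .refl _
  · split_ifs with h
    · subst h
      exact (sameStrand_cross (l := 0) (k := 0) (c := c') rfl 0).trans
        ((Adj.cap 1 1 rfl).sameStrand.trans
          (sameStrand_cross (l := 0) (k := 0) (c := c') rfl 2).symm)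
    · exact .refl _
  · rintro (i | _ | i)
    · rfl
    · rfl
    · simp [endpoint, skip, Equiv.swap_apply_of_ne_of_ne]

theorem strandEquiv_cupSlide (c c' : Crossing) :
    StrandEquiv [(0, .cup), (1, .cross c)] [(1, .cup), (0, .cross c')] := by
  refine (isTrace_cup_cross 1 0 c (f := fun i => if i = 2 then 0 else i) (by decide)
    fun i => ?_).strandEquiv (isTrace_cup_cross 0 1 c' (f := fun i => if i = 2 then 0 else i)
    (by decide) fun i => ?_) ?_
  · split_ifs with h
    · subst h
      exact (sameStrand_cross (l := 1) (k := 1) (c := c) rfl 0).symm.trans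
        ((Adj.cup 0 0 rfl).sameStrand.trans (sameStrand_cross (l := 1) (k := 1) (c := c) rfl 1))
    · exact .refl _
  · split_ifs with h
    · subst h
      exact (sameStrand_cross (l := 1) (k := 0) (c := c') rfl 1).symm.trans
        ((Adj.cup 0 1 rfl).sameStrand.trans (sameStrand_cross (l := 1) (k := 0) (c := c') rfl 2))
    · exact .refl _
  · rintro ((_ | i) | i)
    · rfl
    · simp [endpoint, skip, Equiv.swap_apply_of_ne_of_ne]
    · rfl

theorem strandEquiv_zigzag : StrandEquiv [(1, .cup), (0, .cap)] [] :=
  isTrace_zigzag.strandEquiv isTrace_nil (by rintro (i | i) <;> simp [endpoint])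

theorem strandEquiv_zigzag' : StrandEquiv [(0, .cup), (1, .cap)] [] :=
  isTrace_zigzag'.strandEquiv isTrace_nil (by rintro (i | i) <;> simp [endpoint])

theorem strandEquiv_kink (c : Crossing) : StrandEquiv [(1, .cup), (0, .cross c), (1, .cap)] [] :=
  (isTrace_kink c).strandEquiv isTrace_nil (by rintro (i | i) <;> simp [endpoint])

end LocalMoves

namespace LocalMoves

/-! ### Strands under the exchange of heights of two distant pieces -/

section Far

variable (g g' : Gen) (j : ℕ)

theorem adj_gen {g : Gen} {x y : ℕ × ℕ} (h : Adj [(0, g)] x y) :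
    (∃ i, x = (0, g.ins + i) ∧ y = (1, g.outs + i)) ∨
      (x.1 = 0 ∧ x.2 < g.ins ∨ x.1 = 1 ∧ x.2 < g.outs) ∧
      (y.1 = 0 ∧ y.2 < g.ins ∨ y.1 = 1 ∧ y.2 < g.outs) := by
  cases g with
  | cup =>
    rcases adj_cup.1 h with ⟨rfl, rfl⟩ | ⟨i, rfl, rfl⟩
    · exact Or.inr ⟨Or.inr ⟨rfl, by simp [Gen.outs]⟩, Or.inr ⟨rfl, by simp [Gen.outs]⟩⟩
    · exact Or.inl ⟨i, by simp [Gen.ins], by simp [skip, Gen.outs, add_comm]⟩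
  | cap =>
    rcases adj_cap.1 h with ⟨rfl, rfl⟩ | ⟨i, rfl, rfl⟩
    · exact Or.inr ⟨Or.inl ⟨rfl, by simp [Gen.ins]⟩, Or.inl ⟨rfl, by simp [Gen.ins]⟩⟩
    · exact Or.inl ⟨i, by simp [skip, Gen.ins, add_comm], by simp [Gen.outs]⟩
  | cross c =>
    obtain ⟨i, rfl, rfl⟩ := adj_cross.1 h
    rcases i with _ | _ | i
    · exact Or.inr ⟨Or.inl ⟨rfl, by simp [Gen.ins]⟩, Or.inr ⟨rfl, by simp [Gen.outs]⟩⟩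
    · exact Or.inr ⟨Or.inl ⟨rfl, by simp [Gen.ins]⟩, Or.inr ⟨rfl, by simp [Gen.outs]⟩⟩
    · refine Or.inl ⟨i, by rw [Gen.ins, add_comm 2], ?_⟩
      rw [Equiv.swap_apply_of_ne_of_ne (by omega) (by omega), Gen.outs, add_comm 2]

theorem adj_layer {k : ℕ} {g : Gen} {x y : ℕ × ℕ} (h : Adj [(k, g)] x y) :
    (∃ i < k, x = (0, i) ∧ y = (1, i)) ∨
      ∃ x' y', Adj [(0, g)] x' y' ∧ x = moveRight k x' ∧ y = moveRight k y' := by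
  have h' : Adj (shift k [(0, g)]) x y := h
  rcases adj_shift.1 h' with h | ⟨l, i, hl, hi, rfl, rfl⟩
  · exact Or.inr h
  · simp only [List.length_singleton, Nat.lt_one_iff] at hl
    subst hl
    exact Or.inl ⟨i, hi, rfl, rfl⟩

theorem sameStrand_left {w : Word} {l k i : ℕ} {g : Gen} (h : w[l]? = some (k, g)) (hi : i < k) :
    SameStrand w (l, i) (l + 1, i) :=
  (Adj.left l k i g h hi).sameStrand

theorem sameStrand_right {w : Word} {l k : ℕ} {g : Gen} (h : w[l]? = some (k, g)) (i : ℕ) :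
    SameStrand w (l, k + g.ins + i) (l + 1, k + g.outs + i) :=
  (Adj.right l k i g h).sameStrand

theorem sameStrand_moveRight {w : Word} {l k : ℕ} {g : Gen} (h : w[l]? = some (k, g))
    {x y : ℕ × ℕ} (hxy : Adj [(0, g)] x y) :
    SameStrand w (raise l (moveRight k x)) (raise l (moveRight k y)) := by
  refine sameStrand_layer h ?_
  have : Adj (shift k [(0, g)]) (moveRight k x) (moveRight k y) :=
    adj_shift.2 (Or.inl ⟨x, y, hxy, rfl, rfl⟩)
  exact this

/-- The points of two distant pieces, after the exchange of their heights. -/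
def farMap (x : ℕ × ℕ) : ℕ × ℕ :=
  if x.1 = 1 then (if x.2 < g.outs then (2, x.2) else (0, g.ins + (x.2 - g.outs))) else x

/-- The inverse of `farMap`. -/
def farMapInv (x : ℕ × ℕ) : ℕ × ℕ :=
  if x.1 = 1 then (if x.2 < g.ins then (0, x.2) else (2, g.outs + (x.2 - g.ins))) else x

theorem farMap_zero (i : ℕ) : farMap g (0, i) = (0, i) := rfl

theorem farMap_lt {i : ℕ} (h : i < g.outs) : farMap g (1, i) = (2, i) := by
  simp [farMap, h]

theorem farMap_add (i : ℕ) : farMap g (1, g.outs + i) = (0, g.ins + i) := by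
  simp [farMap]

theorem farMapInv_lt {i : ℕ} (h : i < g.ins) : farMapInv g (1, i) = (0, i) := by
  simp [farMapInv, h]

theorem farMapInv_add (i : ℕ) : farMapInv g (1, g.ins + i) = (2, g.outs + i) := by
  simp [farMapInv]

/-- Only the middle level changes its meaning. Its points on top of `g` lie on the top line after
the exchange, and those to the right of `g`, which are still below `g'`, lie on the bottom line. -/
theorem strandMap_far : StrandMap [(0, g), (g.outs + j, g')] [(g.ins + j, g'), (0, g)]
    (farMap g) where
  adj x y h := by
    generalize hw : [(g.ins + j, g'), (0, g)] = w
    have w0 : w[0]? = some (g.ins + j, g') := by subst hw; rfl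
    have w1 : w[1]? = some (0, g) := by subst hw; rfl
    have right (i : ℕ) : SameStrand w (1, g.ins + i) (2, g.outs + i) := by
      simpa only [zero_add] using sameStrand_right w1 i
    rcases adj_cons.1 h with h' | ⟨x, y, h', rfl, rfl⟩
    · rcases adj_gen h' with ⟨i, rfl, rfl⟩ | ⟨hx, hy⟩
      · rw [farMap_zero, farMap_add]
        exact .refl _
      · have key {x : ℕ × ℕ} (hx : x.1 = 0 ∧ x.2 < g.ins ∨ x.1 = 1 ∧ x.2 < g.outs) :
            SameStrand w (farMap g x) (raise 1 x) := by
          obtain ⟨l, i⟩ := x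
          rcases hx with ⟨rfl, hi⟩ | ⟨rfl, hi⟩
          · exact sameStrand_left w0 (by simp only at hi; omega)
          · rw [farMap_lt g hi]
            exact .refl _
        refine (key hx).trans (SameStrand.trans ?_ (key hy).symm)
        simpa only [moveRight, zero_add] using sameStrand_moveRight w1 h'
    · rcases adj_layer h' with ⟨i, hi, rfl, rfl⟩ | ⟨x, y, h'', rfl, rfl⟩
      · change SameStrand w (farMap g (1, i)) (2, i)
        rcases lt_or_ge i g.outs with hi' | hi'
        · rw [farMap_lt g hi']
          exact .refl _
        · obtain ⟨i, rfl⟩ := Nat.exists_eq_add_of_le hi'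
          rw [farMap_add]
          exact (sameStrand_left w0 (by omega)).trans (right i)
      · have key {x : ℕ × ℕ} (hx : x.1 = 0 ∨ x.1 = 1) :
            SameStrand w (farMap g (raise 1 (moveRight (g.outs + j) x)))
              (raise 0 (moveRight (g.ins + j) x)) := by
          obtain ⟨l, i⟩ := x
          rcases hx with rfl | rfl
          · simp only [raise, moveRight, add_zero, add_assoc]
            rw [farMap_add]
            exact .refl _
          · simp only [raise, moveRight, add_assoc]
            exact (right (j + i)).symm
        have hxy := length_pos_of_adj h''
        simp only [List.length_singleton] at hxy
        exact (key (by omega)).trans ((sameStrand_moveRight w0 h'').trans (key (by omega)).symm)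
  bot i := .refl _
  top i := .refl _
  level x hx := by
    simp only [List.length_cons, List.length_nil] at hx ⊢
    rw [farMap]
    split_ifs <;> simp; omega

theorem strandMap_farInv : StrandMap [(g.ins + j, g'), (0, g)] [(0, g), (g.outs + j, g')]
    (farMapInv g) where
  adj x y h := by
    generalize hw : [(0, g), (g.outs + j, g')] = w
    have w0 : w[0]? = some (0, g) := by subst hw; rfl
    have w1 : w[1]? = some (g.outs + j, g') := by subst hw; rfl
    have right (i : ℕ) : SameStrand w (0, g.ins + i) (1, g.outs + i) := by
      simpa only [zero_add] using sameStrand_right w0 i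
    rcases adj_cons.1 h with h' | ⟨x, y, h', rfl, rfl⟩
    · rcases adj_layer h' with ⟨i, hi, rfl, rfl⟩ | ⟨x, y, h'', rfl, rfl⟩
      · change SameStrand w (0, i) (farMapInv g (1, i))
        rcases lt_or_ge i g.ins with hi' | hi'
        · rw [farMapInv_lt g hi']
          exact .refl _
        · obtain ⟨i, rfl⟩ := Nat.exists_eq_add_of_le hi'
          rw [farMapInv_add]
          exact (right i).trans (sameStrand_left w1 (by omega))
      · have key {x : ℕ × ℕ} (hx : x.1 = 0 ∨ x.1 = 1) :
            SameStrand w (farMapInv g (moveRight (g.ins + j) x))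
              (raise 1 (moveRight (g.outs + j) x)) := by
          obtain ⟨l, i⟩ := x
          rcases hx with rfl | rfl
          · simp only [raise, moveRight, add_assoc]
            exact right (j + i)
          · simp only [raise, moveRight, add_assoc]
            rw [farMapInv_add]
            exact .refl _
        have hxy := length_pos_of_adj h''
        simp only [List.length_singleton] at hxy
        exact (key (by omega)).trans ((sameStrand_moveRight w1 h'').trans (key (by omega)).symm)
    · rcases adj_gen h' with ⟨i, rfl, rfl⟩ | ⟨hx, hy⟩
      · change SameStrand w (farMapInv g (1, g.ins + i)) (2, g.outs + i)
        rw [farMapInv_add]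
        exact .refl _
      · have key {x : ℕ × ℕ} (hx : x.1 = 0 ∧ x.2 < g.ins ∨ x.1 = 1 ∧ x.2 < g.outs) :
            SameStrand w (farMapInv g (raise 1 x)) x := by
          obtain ⟨l, i⟩ := x
          rcases hx with ⟨rfl, hi⟩ | ⟨rfl, hi⟩
          · change SameStrand w (farMapInv g (1, i)) (0, i)
            rw [farMapInv_lt g hi]
            exact .refl _
          · exact (sameStrand_left w1 (by simp only at hi; omega)).symm
        refine (key hx).trans (SameStrand.trans ?_ (key hy).symm)
        simpa only [moveRight, raise, zero_add] using sameStrand_moveRight w0 h'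
  bot i := .refl _
  top i := .refl _
  level x hx := by
    simp only [List.length_cons, List.length_nil] at hx ⊢
    rw [farMapInv]
    split_ifs <;> simp; omega

theorem strandEquiv_far :
    StrandEquiv [(0, g), (g.outs + j, g')] [(g.ins + j, g'), (0, g)] := by
  refine ⟨_, _, strandMap_far g g' j, strandMap_farInv g g' j, ?_, ?_⟩
  · rintro ⟨l, i⟩ hl
    obtain rfl | rfl | rfl : l = 0 ∨ l = 1 ∨ l = 2 := by simp at hl; omega
    · exact .refl _
    · rcases lt_or_ge i g.outs with hi' | hi'
      · rw [farMap_lt g hi']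
        exact (sameStrand_left (l := 1) rfl (by omega)).symm
      · obtain ⟨i, rfl⟩ := Nat.exists_eq_add_of_le hi'
        rw [farMap_add]
        have := sameStrand_right (w := [(0, g), (g.outs + j, g')]) (l := 0) rfl i
        simp only [zero_add] at this
        exact this
    · exact .refl _
  · rintro ⟨l, i⟩ hl
    obtain rfl | rfl | rfl : l = 0 ∨ l = 1 ∨ l = 2 := by simp at hl; omega
    · exact .refl _
    · rcases lt_or_ge i g.ins with hi' | hi'
      · rw [farMapInv_lt g hi']
        exact sameStrand_left (l := 0) rfl (by omega)
      · obtain ⟨i, rfl⟩ := Nat.exists_eq_add_of_le hi'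
        rw [farMapInv_add]
        have := (sameStrand_right (w := [(g.ins + j, g'), (0, g)]) (l := 1) rfl i).symm
        rwa [zero_add, zero_add] at this
    · exact .refl _

end Far

theorem IsotopyRel.strandEquiv {v w : Word} (h : IsotopyRel v w) : StrandEquiv v w := by
  cases h with
  | far g g' j => exact strandEquiv_far g g' j
  | zigzag => exact strandEquiv_zigzag
  | zigzag' => exact strandEquiv_zigzag'
  | capSlide x => exact strandEquiv_capSlide _ _
  | cupSlide x => exact strandEquiv_cupSlide _ _

theorem isBraid_nil : IsBraid [] := fun _ h => absurd h List.not_mem_nil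

theorem IsBraid.cons {w : Word} (h : IsBraid w) (k : ℕ) (x : Crossing) : IsBraid (cr k x :: w) := by
  intro p hp
  rcases List.mem_cons.1 hp with rfl | hp
  exacts [⟨x, rfl⟩, h p hp]

theorem strandEquiv_cross (x y : Crossing) : StrandEquiv [cr 0 x] [cr 0 y] :=
  (isBraid_nil.cons _ _).strandEquiv (isBraid_nil.cons _ _) rfl

theorem strandEquiv_cross_cross (x y : Crossing) : StrandEquiv [cr 0 x, cr 0 y] [] :=
  ((isBraid_nil.cons _ _).cons _ _).strandEquiv isBraid_nil (by ext i; simp [perm, cr])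

theorem strandEquiv_tri (x y z : Crossing) : StrandEquiv (tri x y z) (tri' x y z) := by
  refine (((isBraid_nil.cons _ _).cons _ _).cons _ _).strandEquiv
    (((isBraid_nil.cons _ _).cons _ _).cons _ _) ?_
  ext i
  simp only [tri', perm, cr, Equiv.trans_apply, Equiv.refl_apply]
  rcases i with _ | _ | _ | i
  · rfl
  · rfl
  · rfl
  · simp [Equiv.swap_apply_of_ne_of_ne]

theorem strandEquiv_band (x y : Crossing) :
    StrandEquiv [cr 1 x, cr 0 x, cr 2 x, cr 1 x] [cr 1 y, cr 0 y, cr 2 y, cr 1 y] :=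
  ((((isBraid_nil.cons _ _).cons _ _).cons _ _).cons _ _).strandEquiv
    ((((isBraid_nil.cons _ _).cons _ _).cons _ _).cons _ _) rfl

theorem ReidRel.strandEquiv {v w : Word} (h : ReidRel v w) : StrandEquiv v w := by
  cases h with
  | r1 x hx => exact strandEquiv_kink x
  | r2 x hx => exact strandEquiv_cross_cross _ _
  | r3 x y z => exact strandEquiv_tri _ _ _

theorem WReidRel.strandEquiv {v w : Word} (h : WReidRel v w) : StrandEquiv v w := by
  cases h with
  | classical _ _ h => exact h.strandEquiv
  | vr1 => exact strandEquiv_kink _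
  | vr2 => exact strandEquiv_cross_cross _ _
  | vr3 => exact strandEquiv_tri _ _ _
  | mixed y hy => exact strandEquiv_tri _ _ _
  | oc => exact strandEquiv_tri _ _ _

theorem CCRel.strandEquiv {v w : Word} (h : CCRel v w) : StrandEquiv v w := by
  cases h
  exact strandEquiv_cross _ _

theorem DeltaRel.strandEquiv {v w : Word} (h : DeltaRel v w) : StrandEquiv v w := by
  cases h
  exact strandEquiv_tri _ _ _

theorem BPRel.strandEquiv {v w : Word} (h : BPRel v w) : StrandEquiv v w := by
  cases h
  exact strandEquiv_band _ _

theorem VRel.strandEquiv {v w : Word} (h : VRel v w) : StrandEquiv v w := by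
  cases h
  exact strandEquiv_cross _ _

theorem FRel.strandEquiv {v w : Word} (h : FRel v w) : StrandEquiv v w := by
  cases h
  exact strandEquiv_tri _ _ _

theorem WBPRel.strandEquiv {v w : Word} (h : WBPRel v w) : StrandEquiv v w := by
  cases h
  refine ((((isBraid_nil.cons _ _).cons _ _).cons _ _).cons _ _).strandEquiv
    ((((((isBraid_nil.cons _ _).cons _ _).cons _ _).cons _ _).cons _ _).cons _ _) ?_
  ext i
  simp [perm, cr]

end LocalMoves

namespace LocalMoves

/-! ### String links and the strands -/

/-- `SameStrand` is a relation on all pairs of numbers; the points to the right of the diagram form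
vertical strands of their own. -/
theorem IsTangle.sameStrand_outer {n p : ℕ} {w : Word} (h : IsTangle n w p) (i : ℕ) :
    SameStrand w (0, n + i) (w.length, p + i) := by
  induction h with
  | nil m => exact .refl _
  | cons k r g w n h ih =>
    have h1 := ih.append_left [(k, g)]
    have h2 := sameStrand_right (w := (k, g) :: w) (l := 0) rfl (r + i)
    simp only [← add_assoc, zero_add] at h2
    simp only [raise, List.length_singleton, add_comm 1] at h1
    exact h2.trans h1

theorem IsTangle.exists_take {n p : ℕ} {w : Word} (h : IsTangle n w p) (l : ℕ) :
    ∃ q, IsTangle n (w.take l) q ∧ IsTangle q (w.drop l) p := by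
  rw [← List.take_append_drop l w] at h
  exact isTangle_append.1 h

/-- The point lies on the diagram `w` with `n` endpoints at the bottom. -/
def InDiagram (n : ℕ) (w : Word) (x : ℕ × ℕ) : Prop := ∃ p, IsTangle n (w.take x.1) p ∧ x.2 < p

theorem isTangle_take_succ {n p k l : ℕ} {g : Gen} {w : Word} (h : w[l]? = some (k, g))
    (hw : IsTangle n w p) : ∃ r, IsTangle n (w.take l) (k + g.ins + r) ∧
      IsTangle n (w.take (l + 1)) (k + g.outs + r) := by
  obtain ⟨q, h1, h2⟩ := hw.exists_take (l + 1)
  have e : w.take (l + 1) = w.take l ++ [(k, g)] := by rw [List.take_add_one, h]; rfl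
  rw [e] at h1
  obtain ⟨p', h3, h4⟩ := isTangle_append.1 h1
  obtain ⟨r, rfl, h5⟩ := isTangle_cons.1 h4
  exact ⟨r, h3, by rwa [e, isTangle_nil.1 h5]⟩

theorem inDiagram_iff {n p : ℕ} {w : Word} {x : ℕ × ℕ} (h : IsTangle n (w.take x.1) p) :
    InDiagram n w x ↔ x.2 < p := by
  constructor
  · rintro ⟨q, h1, h2⟩
    rwa [h.unique h1]
  · exact fun h' => ⟨p, h, h'⟩

theorem Adj.inDiagram_iff {n p : ℕ} {w : Word} {x y : ℕ × ℕ} (hw : IsTangle n w p)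
    (h : Adj w x y) : InDiagram n w x ↔ InDiagram n w y := by
  cases h with
  | left l k i g h hi =>
    obtain ⟨r, h1, h2⟩ := isTangle_take_succ h hw
    rw [LocalMoves.inDiagram_iff h1, LocalMoves.inDiagram_iff h2]
    simp only
    omega
  | right l k i g h =>
    obtain ⟨r, h1, h2⟩ := isTangle_take_succ h hw
    rw [LocalMoves.inDiagram_iff h1, LocalMoves.inDiagram_iff h2]
    simp only
    omega
  | crossRight l k x h =>
    obtain ⟨r, h1, h2⟩ := isTangle_take_succ h hw
    rw [LocalMoves.inDiagram_iff h1, LocalMoves.inDiagram_iff h2]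
    simp only [Gen.ins, Gen.outs]
    omega
  | crossLeft l k x h =>
    obtain ⟨r, h1, h2⟩ := isTangle_take_succ h hw
    rw [LocalMoves.inDiagram_iff h1, LocalMoves.inDiagram_iff h2]
    simp only [Gen.ins, Gen.outs]
    omega
  | cap l k h =>
    obtain ⟨r, h1, h2⟩ := isTangle_take_succ h hw
    rw [LocalMoves.inDiagram_iff h1, LocalMoves.inDiagram_iff h1]
    simp only [Gen.ins]
    omega
  | cup l k h =>
    obtain ⟨r, h1, h2⟩ := isTangle_take_succ h hw
    rw [LocalMoves.inDiagram_iff h2, LocalMoves.inDiagram_iff h2]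
    simp only [Gen.outs]
    omega

theorem SameStrand.inDiagram_iff {n p : ℕ} {w : Word} {x y : ℕ × ℕ} (hw : IsTangle n w p)
    (h : SameStrand w x y) : InDiagram n w x ↔ InDiagram n w y := by
  induction h with
  | rel x y h => exact h.inDiagram_iff hw
  | refl x => exact Iff.rfl
  | symm x y _ ih => exact ih.symm
  | trans x y z _ _ ih ih' => exact ih.trans ih'

/-- Rids the condition of the widths of the levels, so that it can be transported by maps of points.
Points outside the diagram satisfy it trivially, and since strands do not leave the diagram
(`InDiagram`), the bound on the endpoint is recovered. -/
theorem isStringLink_iff {n : ℕ} {w : Word} (hw : IsTangle n w n) : IsStringLink n w ↔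
    (∀ i < n, SameStrand w (0, i) (w.length, i)) ∧
      ∀ x : ℕ × ℕ, x.1 ≤ w.length → ∃ j, SameStrand w x (0, j) := by
  constructor
  · rintro ⟨-, h1, h2⟩
    refine ⟨h1, fun ⟨l, i⟩ hl => ?_⟩
    obtain ⟨q, hq, hq'⟩ := hw.exists_take l
    rcases lt_or_ge i q with hi | hi
    · obtain ⟨j, -, hj⟩ := h2 l hl q hq i hi
      exact ⟨j, hj⟩
    · obtain ⟨i, rfl⟩ := Nat.exists_eq_add_of_le hi
      have := (hq.sameStrand_outer i).append_right (w.drop l)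
      rw [List.take_append_drop, List.length_take, min_eq_left hl] at this
      exact ⟨_, this.symm⟩
  · rintro ⟨h1, h2⟩
    refine ⟨hw, h1, fun l hl q hq i hi => ?_⟩
    obtain ⟨j, hj⟩ := h2 (l, i) hl
    refine ⟨j, ?_, hj⟩
    have h3 := (hj.inDiagram_iff hw).1 ⟨q, hq, hi⟩
    exact (inDiagram_iff (x := (0, j)) (.nil n)).1 h3

theorem StrandEquiv.isStringLink {n : ℕ} {v w : Word} (h : StrandEquiv v w)
    (hw : IsTangle n w n) (hv : IsStringLink n v) : IsStringLink n w := by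
  obtain ⟨f, g, hf, hg, -, h2⟩ := h
  obtain ⟨h3, h4⟩ := (isStringLink_iff hv.1).1 hv
  refine (isStringLink_iff hw).2 ⟨fun i hi => ?_, fun x hx => ?_⟩
  · exact (hf.bot i).symm.trans (((h3 i hi).map hf.adj).trans (hf.top i))
  · obtain ⟨j, hj⟩ := h4 (g x) (hg.level x hx)
    exact ⟨j, (h2 x hx).symm.trans ((hj.map hf.adj).trans (hf.bot j))⟩

/-! ### Theories of local moves -/

/-- The theory of the planar isotopies, the relations `R`, and the relations `M`. -/
def theory (R M : Word → Word → Prop) (ok : Crossing → Prop) : Theory where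
  rel u u' := IsotopyRel u u' ∨ R u u' ∨ M u u'
  ok := ok

/-- The theory of classical diagrams with the relations `M`. -/
abbrev classicalTheory (M : Word → Word → Prop) : Theory := theory ReidRel M Crossing.IsClassical

/-- The theory of welded diagrams with the relations `M`. -/
abbrev weldedTheory (M : Word → Word → Prop) : Theory := theory WReidRel M fun _ => True

instance (M : Word → Word → Prop) : ReidTheory (classicalTheory M) where
  ok_over := nofun
  ok_under := nofun
  iso _ _ h := Or.inl h
  r1 x hx := Or.inr (Or.inl (.r1 x hx))
  r2 x hx := Or.inr (Or.inl (.r2 x hx))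
  r3 x y z hx hy hz h := Or.inr (Or.inl (.r3 x y z hx hy hz h))

instance (M : Word → Word → Prop) : WeldedTheory (weldedTheory M) where
  ok_over := trivial
  ok_under := trivial
  ok_virt := trivial
  iso _ _ h := Or.inl h
  r1 x _ := by
    cases x
    exacts [Or.inr (Or.inl (.classical _ _ (.r1 .over nofun))),
      Or.inr (Or.inl (.classical _ _ (.r1 .under nofun))), Or.inr (Or.inl .vr1)]
  r2 x _ := by
    cases x
    exacts [Or.inr (Or.inl (.classical _ _ (.r2 .over nofun))),
      Or.inr (Or.inl (.classical _ _ (.r2 .under nofun))), Or.inr (Or.inl .vr2)]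
  r3 x y z hx hy hz h := Or.inr (Or.inl (.classical _ _ (.r3 x y z hx hy hz h)))
  welded _ _ h := Or.inr (Or.inl h)

theorem good_classicalTheory {M : Word → Word → Prop} {w : Word} :
    (classicalTheory M).Good w ↔ IsClassical w := by
  constructor
  · rintro h ⟨k, g⟩ hp rfl
    exact h k .virt hp rfl
  · rintro h k x hx rfl
    exact h _ hx rfl

theorem good_weldedTheory {M : Word → Word → Prop} (w : Word) : (weldedTheory M).Good w :=
  fun _ _ _ => trivial

theorem locally_or {P Q : Word → Word → Prop} {v w : Word}
    (h : Locally (fun u u' => P u u' ∨ Q u u') v w) : Locally P v w ∨ Locally Q v w := by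
  obtain ⟨A, B, k, u, u', h | h, rfl, rfl⟩ := h
  exacts [Or.inl ⟨A, B, k, u, u', h, rfl, rfl⟩, Or.inr ⟨A, B, k, u, u', h, rfl, rfl⟩]

/-- Equality of classes is a chain of moves through tangle diagrams. Since each move preserves
strands and `K` is closed under such changes, a chain starting in `K` never leaves it. -/
theorem realizes_of_mk_eq {R M : Word → Word → Prop} {ok : Crossing → Prop} {n : ℕ} {K : Set Word}
    {M₁ : Move} (hR : ∀ u u', R u u' → StrandEquiv u u') (hM : ∀ u u', M u u' → StrandEquiv u u')
    (hK : ∀ w ∈ K, IsTangle n w n ∧ (theory R M ok).Good w)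
    (hK' : ∀ v ∈ K, ∀ w, IsTangle n w n → (theory R M ok).Good w → StrandEquiv v w → w ∈ K)
    (h : ∀ D D' (hD : IsTangle n D n ∧ (theory R M ok).Good D)
      (hD' : IsTangle n D' n ∧ (theory R M ok).Good D'), M₁ D D' →
      Hom.mk D hD.1 hD.2 = Hom.mk D' hD'.1 hD'.2) :
    Realizes K R (Locally M) M₁ := by
  intro D hD D' hD' hDD'
  have h1 := Quot.eqvGen_exact (h D D' (hK D hD) (hK D' hD') hDD')
  have hS (u u' : Word) (h : (theory R M ok).rel u u') : StrandEquiv u u' := by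
    rcases h with h | h | h
    exacts [h.strandEquiv, hR u u' h, hM u u' h]
  have key : ∀ x y : Diag (theory R M ok) n n,
      Relation.EqvGen (fun v w => Locally (theory R M ok).rel v.1 w.1) x y →
      (x.1 ∈ K ↔ y.1 ∈ K) ∧ (x.1 ∈ K → Relation.EqvGen (fun X Y => X ∈ K ∧ Y ∈ K ∧
        (Locally IsotopyRel X Y ∨ Locally R X Y ∨ Locally M X Y)) x.1 y.1) := by
    intro x y hxy
    induction hxy with
    | rel x y hxy =>
      have hs := StrandEquiv.of_locally hS hxy
      have h2 : x.1 ∈ K ↔ y.1 ∈ K := ⟨fun hx => hK' x.1 hx y.1 y.2.1 y.2.2 hs,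
        fun hy => hK' y.1 hy x.1 x.2.1 x.2.2 hs.symm⟩
      exact ⟨h2, fun hx => .rel _ _ ⟨hx, h2.1 hx, (locally_or hxy).imp_right locally_or⟩⟩
    | refl x => exact ⟨Iff.rfl, fun _ => .refl _⟩
    | symm x y _ ih => exact ⟨ih.1.symm, fun hy => .symm _ _ (ih.2 (ih.1.2 hy))⟩
    | trans x y z _ _ ih ih' =>
      exact ⟨ih.1.trans ih'.1, fun hx => .trans _ _ _ (ih.2 hx) (ih'.2 (ih.1.1 hx))⟩
  exact (key _ _ h1).2 hD

theorem cGenerates_of_mk_eq {M : Word → Word → Prop} {M₁ : Move}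
    (hM : ∀ u u', M u u' → StrandEquiv u u')
    (h : ∀ n D D' (hD : IsTangle n D n ∧ (classicalTheory M).Good D)
      (hD' : IsTangle n D' n ∧ (classicalTheory M).Good D'), M₁ D D' →
      Hom.mk D hD.1 hD.2 = Hom.mk D' hD'.1 hD'.2) :
    CGenerates (Locally M) M₁ :=
  ⟨fun n => realizes_of_mk_eq (fun _ _ h => h.strandEquiv) hM
      (fun _ hw => ⟨hw.1.1, good_classicalTheory.2 hw.2⟩)
      (fun _ hv _ hw hw' hs => ⟨hs.isStringLink hw hv.1, good_classicalTheory.1 hw'⟩) (h n),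
    realizes_of_mk_eq (fun _ _ h => h.strandEquiv) hM
      (fun _ hw => ⟨hw.1, good_classicalTheory.2 hw.2⟩)
      (fun _ _ _ hw hw' _ => ⟨hw, good_classicalTheory.1 hw'⟩) (h 0)⟩

theorem wGenerates_of_mk_eq {M : Word → Word → Prop} {M₁ : Move}
    (hM : ∀ u u', M u u' → StrandEquiv u u')
    (h : ∀ n D D' (hD : IsTangle n D n ∧ (weldedTheory M).Good D)
      (hD' : IsTangle n D' n ∧ (weldedTheory M).Good D'), M₁ D D' →
      Hom.mk D hD.1 hD.2 = Hom.mk D' hD'.1 hD'.2) :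
    WGenerates (Locally M) M₁ :=
  ⟨fun n => realizes_of_mk_eq (fun _ _ h => h.strandEquiv) hM
      (fun w hw => ⟨hw.1, good_weldedTheory w⟩)
      (fun _ hv _ hw _ hs => hs.isStringLink hw hv) (h n),
    realizes_of_mk_eq (fun _ _ h => h.strandEquiv) hM
      (fun w hw => ⟨hw, good_weldedTheory w⟩) (fun _ _ _ hw _ _ => hw) (h 0)⟩

end LocalMoves

namespace LocalMoves

variable {T : Theory}

/-! ### Sliding a clasp along a strand -/

theorem Theory.Good.of_append_left {v w : Word} (h : T.Good (v ++ w)) : T.Good v :=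
  fun k x hx => h k x (List.mem_append_left _ hx)

theorem Theory.Good.of_append_right {v w : Word} (h : T.Good (v ++ w)) : T.Good w :=
  fun k x hx => h k x (List.mem_append_right _ hx)

section Outer

variable [ReidTheory T]

theorem layer_comp_cup {p q k : ℕ} {g : Gen} (hl : IsTangle p [(k, g)] q)
    (hg : T.Good [(k, g)]) :
    cup T p p ⬝ Hom.mk [(k, g)] (hl.add_right 2) hg = Hom.mk [(k, g)] hl hg ⬝ cup T q q := by
  rw [cup_eq le_rfl, cup_eq le_rfl]
  obtain ⟨r, rfl, h⟩ := isTangle_cons.1 hl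
  obtain rfl := isTangle_nil.1 h
  exact (Quot.sound ⟨[], [], k, _, _, ReidTheory.iso _ _ (.far g .cup r),
    by simp [shift, add_assoc], by simp [shift, add_assoc]⟩).symm

theorem layer_comp_cap {p q k : ℕ} {g : Gen} (hl : IsTangle p [(k, g)] q)
    (hg : T.Good [(k, g)]) :
    Hom.mk [(k, g)] (hl.add_right 2) hg ⬝ cap T q q = cap T p p ⬝ Hom.mk [(k, g)] hl hg := by
  rw [cap_eq le_rfl, cap_eq le_rfl]
  obtain ⟨r, rfl, h⟩ := isTangle_cons.1 hl
  obtain rfl := isTangle_nil.1 h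
  exact Quot.sound ⟨[], [], k, _, _, ReidTheory.iso _ _ (.far g .cap r),
    by simp [shift, add_assoc], by simp [shift, add_assoc]⟩

theorem IsTangle.exists_of_cons {p n k : ℕ} {g : Gen} {w : Word}
    (h : IsTangle p ((k, g) :: w) n) : ∃ q, IsTangle p [(k, g)] q ∧ IsTangle q w n :=
  (isTangle_append (v := [(k, g)])).1 h

/-- A minimum to the right of the whole word is distant from each layer and can be moved through all
of them. -/
theorem cup_comp_mk {p q : ℕ} {w : Word} (h : IsTangle p w q) (hw : T.Good w) :
    cup T p p ⬝ Hom.mk w (h.add_right 2) hw = Hom.mk w h hw ⬝ cup T q q := by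
  induction w generalizing p with
  | nil =>
    obtain rfl := isTangle_nil.1 h
    exact (Hom.comp_id _).trans (Hom.id_comp _).symm
  | cons a w ih =>
    obtain ⟨k, g⟩ := a
    obtain ⟨s, h1, h2⟩ := IsTangle.exists_of_cons h
    have hg : T.Good [(k, g)] := Theory.Good.of_append_left (v := [(k, g)]) hw
    have hw' : T.Good w := Theory.Good.of_append_right (v := [(k, g)]) hw
    change cup T p p ⬝ (Hom.mk [(k, g)] (h1.add_right 2) hg ⬝ Hom.mk w (h2.add_right 2) hw') =
      Hom.mk [(k, g)] h1 hg ⬝ Hom.mk w h2 hw' ⬝ cup T q q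
    rw [← Hom.comp_assoc, layer_comp_cup, Hom.comp_assoc, ih h2, Hom.comp_assoc]

theorem mk_comp_cap {p q : ℕ} {w : Word} (h : IsTangle p w q) (hw : T.Good w) :
    Hom.mk w (h.add_right 2) hw ⬝ cap T q q = cap T p p ⬝ Hom.mk w h hw := by
  induction w generalizing p with
  | nil =>
    obtain rfl := isTangle_nil.1 h
    exact (Hom.id_comp _).trans (Hom.comp_id _).symm
  | cons a w ih =>
    obtain ⟨k, g⟩ := a
    obtain ⟨s, h1, h2⟩ := IsTangle.exists_of_cons h
    have hg : T.Good [(k, g)] := Theory.Good.of_append_left (v := [(k, g)]) hw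
    have hw' : T.Good w := Theory.Good.of_append_right (v := [(k, g)]) hw
    change Hom.mk [(k, g)] (h1.add_right 2) hg ⬝ Hom.mk w (h2.add_right 2) hw' ⬝ cap T q q =
      cap T p p ⬝ (Hom.mk [(k, g)] h1 hg ⬝ Hom.mk w h2 hw')
    rw [Hom.comp_assoc, ih h2, ← Hom.comp_assoc, layer_comp_cap, Hom.comp_assoc]

end Outer

namespace Slider

variable [ReidTheory T] {c : Crossing} {cores : Set (List Crossing)}

theorem twist_slide_right (S : Slider T c cores) {n k : ℕ} {l : List Crossing}
    (hl : ∀ x ∈ l, T.ok x) (hk : k + 3 ≤ n) :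
    u T n k c * u T n (k + 1) c * twist T n k l =
      twist T n (k + 1) l * (u T n k c * u T n (k + 1) c) := by
  induction l with
  | nil => rw [twist_nil, twist_nil, one_mul, mul_one]
  | cons x l ih =>
    rw [twist_cons, twist_cons, ← mul_assoc, S.slide_right (hl x List.mem_cons_self) hk, mul_assoc,
      ih fun y hy => hl y (List.mem_cons_of_mem _ hy), mul_assoc]

theorem twist_slide_left (S : Slider T c cores) {n k : ℕ} {l : List Crossing}
    (hl : ∀ x ∈ l, T.ok x) (hk : k + 3 ≤ n) :
    u T n (k + 1) c * u T n k c * twist T n (k + 1) l =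
      twist T n k l * (u T n (k + 1) c * u T n k c) := by
  induction l with
  | nil => rw [twist_nil, twist_nil, one_mul, mul_one]
  | cons x l ih =>
    rw [twist_cons, twist_cons, ← mul_assoc, S.slide_left (hl x List.mem_cons_self) hk, mul_assoc,
      ih fun y hy => hl y (List.mem_cons_of_mem _ hy), mul_assoc]

/-- A clasp with the kink of the last strand is a twist. -/
theorem cup_clasp_cap (S : Slider T c cores) {k : ℕ} {l : List Crossing} (hl : l ∈ cores) :
    cup T (k + 2) (k + 2) ⬝ ((clasp T c l (k + 2 + 2) 2 k * u T (k + 2 + 2) (k + 1) c) ▷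
      cap T (k + 2) (k + 2)) = (twist T (k + 2) k (twistInv l)).1 := by
  have hb : u T (k + 2 + 2) k c * u T (k + 2 + 2) (k + 1) c * u T (k + 2 + 2) k c =
      u T (k + 2 + 2) (k + 1) c * (u T (k + 2 + 2) k c * u T (k + 2 + 2) (k + 1) c) :=
    S.slide_right S.ok_carrier (by omega)
  have hc : Commute (u T (k + 2 + 2) k c) (twist T (k + 2 + 2) (k + 2) l) :=
    u_commute_twist c l le_rfl
  -- The braid relation carries the crossing of the curl through the clasp: the carrier crossing at
  -- `k` commutes with the distant twist.
  have e : clasp T c l (k + 2 + 2) 2 k * u T (k + 2 + 2) (k + 1) c =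
      u T (k + 2 + 2) (k + 1) c * u T (k + 2 + 2) k c *
        (u T (k + 2 + 2) (k + 1) c * twist T (k + 2 + 2) (k + 2) l *
          u T (k + 2 + 2) (k + 1) c.rot) * u T (k + 2 + 2) k c.rot := by
    rw [clasp_succ, clasp_succ, clasp_zero, ← u_inv, ← u_inv]
    change u T (k + 2 + 2) k c * (u T (k + 2 + 2) (k + 1) c * twist T (k + 2 + 2) (k + 2) l *
      (u T (k + 2 + 2) (k + 1) c)⁻¹) * (u T (k + 2 + 2) k c)⁻¹ * u T (k + 2 + 2) (k + 1) c = _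
    generalize twist T (k + 2 + 2) (k + 2) l = y at *
    generalize u T (k + 2 + 2) k c = s at *
    generalize u T (k + 2 + 2) (k + 1) c = t at *
    have h1 : t⁻¹ * s⁻¹ * t = s * t⁻¹ * s⁻¹ := by
      rw [eq_mul_inv_iff_mul_eq, eq_mul_inv_iff_mul_eq]
      calc t⁻¹ * s⁻¹ * t * s * t = t⁻¹ * s⁻¹ * (t * (s * t)) := by group
        _ = s := by rw [← hb]; group
    calc s * (t * y * t⁻¹) * s⁻¹ * t = s * t * y * (t⁻¹ * s⁻¹ * t) := by group
      _ = s * t * (y * s) * t⁻¹ * s⁻¹ := by rw [h1]; group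
      _ = (s * t * s) * y * t⁻¹ * s⁻¹ := by rw [← hc.eq]; group
      _ = _ := by rw [hb]; group
  have h1 : u T (k + 2 + 2) k c.rot ▷ cap T (k + 2) (k + 2) =
      cap T (k + 2) (k + 2) ◁ u T (k + 2) k c.rot := u_act_cap_left _ le_rfl le_rfl
  have h2 : (u T (k + 2 + 2) (k + 1) c * twist T (k + 2 + 2) (k + 2) l *
      u T (k + 2 + 2) (k + 1) c.rot) ▷ cap T (k + 2) (k + 2) =
      twist T (k + 2 + 2) (k + 1) (twistInv l) ▷ cap T (k + 2) (k + 2) :=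
    S.core_act_cap_succ hl le_rfl
  have h3 := S.twist_slide_left (n := k + 2 + 2) (k := k) (S.ok_core _ (S.inv_core l hl)) (by omega)
  have h4 : u T (k + 2 + 2) k c ▷ cap T (k + 2) (k + 2) =
      cap T (k + 2) (k + 2) ◁ u T (k + 2) k c := u_act_cap_left _ le_rfl le_rfl
  have h5 : cup T (k + 2) (k + 2) ⬝ (u T (k + 2 + 2) (k + 1) c ▷ cap T (k + 2) (k + 2)) =
      Hom.id (k + 2) := cup_crossing_cap S.ok_carrier le_rfl
  have h6 : cup T (k + 2) (k + 2) ◁ twist T (k + 2 + 2) k (twistInv l) =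
      twist T (k + 2) k (twistInv l) ▷ cup T (k + 2) (k + 2) :=
    cup_ract_twist_left _ le_rfl le_rfl
  rw [e, Hom.mul_act, h1, Hom.mul_act, ← Hom.act_ract, h2, ← Hom.act_ract, ← Hom.mul_act, h3,
    Hom.mul_act, Hom.mul_act (u T (k + 2 + 2) (k + 1) c), h4, ← Hom.act_ract, ← Hom.act_ract,
    ← Hom.comp_ract, ← Hom.comp_ract, ← Hom.ract_comp, h6, Hom.act_comp, h5, Hom.act_ract,
    Hom.act_ract, ← Hom.ract_mul, ← u_inv, mul_inv_cancel, Hom.ract_one, Hom.act_id]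

/-! The clasp of strand `i` with the last of `p + 1` strands. -/

theorem clasp_act_layer_left (S : Slider T c cores) {p q k i : ℕ} {g : Gen} {l : List Crossing}
    (hp : IsTangle p [(k, g)] q) (hg : T.Good [(k, g)]) (hi : i < k) :
    clasp T c l (p + 1) (p - 1 - i) i ▷ Hom.mk [(k, g)] (hp.add_right 1) hg =
      Hom.mk [(k, g)] (hp.add_right 1) hg ◁ clasp T c l (q + 1) (q - 1 - i) i := by
  obtain ⟨r, hr, h⟩ := isTangle_cons.1 hp
  have hq := isTangle_nil.1 h
  obtain ⟨e, rfl⟩ := Nat.exists_eq_add_of_le (show i + 1 ≤ k by omega)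
  cases g with
  | cross x =>
    simp only [Gen.ins, Gen.outs] at hr hq
    obtain rfl : q = p := by omega
    have hx : T.ok x := hg (i + 1 + e) x (by simp)
    have h1 := congrArg Units.val (S.clasp_commute (l := l) (n := q + 1) (d := q - 1 - i) (i := i)
      (e := e) hx (by omega) (by omega)).eq
    have h2 := crossing_eq (T := T) (n := q + 1) (k := i + 1 + e) (by omega) hx
    simp only [Units.val_mul, u, h2] at h1
    exact h1
  | cap =>
    simp only [Gen.ins, Gen.outs] at hr hq
    obtain rfl : p = q + 2 := by omega
    have h1 := S.clasp_act_cap_left (l := l) (n := q + 1) (d := q - 1 - i) (i := i) (e := e)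
      (by omega) (by omega)
    rw [cap_eq (by omega)] at h1
    rw [show q + 2 - 1 - i = q - 1 - i + 2 by omega]
    exact h1
  | cup =>
    simp only [Gen.ins, Gen.outs] at hr hq
    obtain rfl : q = p + 2 := by omega
    have h1 := S.cup_ract_clasp_left (l := l) (n := p + 1) (d := p - 1 - i) (i := i) (e := e)
      (by omega) (by omega)
    rw [cup_eq (by omega)] at h1
    rw [show p + 2 - 1 - i = p - 1 - i + 2 by omega]
    exact h1.symm

theorem clasp_act_layer_right {p q k i : ℕ} {g : Gen} {l : List Crossing}
    (hp : IsTangle p [(k, g)] q) (hg : T.Good [(k, g)]) (hi : k + g.ins + i < p) :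
    clasp T c l (p + 1) (p - 1 - (k + g.ins + i)) (k + g.ins + i) ▷
        Hom.mk [(k, g)] (hp.add_right 1) hg =
      Hom.mk [(k, g)] (hp.add_right 1) hg ◁
        clasp T c l (q + 1) (q - 1 - (k + g.outs + i)) (k + g.outs + i) := by
  obtain ⟨r, hr, h⟩ := isTangle_cons.1 hp
  have hq := isTangle_nil.1 h
  cases g with
  | cross x =>
    simp only [Gen.ins, Gen.outs] at hr hq hi ⊢
    obtain rfl : q = p := by omega
    have hx : T.ok x := hg k x (by simp)
    have h1 := congrArg Units.val (u_commute_clasp (T := T) (l := l) (c := c) (n := q + 1)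
      (j := k) (k := k + 2 + i) x (q - 1 - (k + 2 + i)) (by omega)).eq
    have h2 := crossing_eq (T := T) (n := q + 1) (k := k) (by omega) hx
    simp only [Units.val_mul, u, h2] at h1
    exact h1.symm
  | cap =>
    simp only [Gen.ins, Gen.outs] at hr hq hi ⊢
    obtain rfl : p = q + 2 := by omega
    have h1 := clasp_act_cap_right (T := T) (c := c) (l := l) (n := q + 1) (j := k + i) (k := k)
      (q - 1 - (k + i)) (by omega) (by omega)
    rw [cap_eq (by omega)] at h1
    rw [show q + 2 - 1 - (k + 2 + i) = q - 1 - (k + i) by omega,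
      show k + 2 + i = k + i + 2 by omega]
    exact h1
  | cup =>
    simp only [Gen.ins, Gen.outs] at hr hq hi ⊢
    obtain rfl : q = p + 2 := by omega
    have h1 := cup_ract_clasp_right (T := T) (c := c) (l := l) (n := p + 1) (j := k + i) (k := k)
      (p - 1 - (k + i)) (by omega) (by omega)
    rw [cup_eq (by omega)] at h1
    rw [show p + 2 - 1 - (k + 2 + i) = p - 1 - (k + i) by omega,
      show k + 2 + i = k + i + 2 by omega]
    exact h1.symm

theorem clasp_act_layer_crossRight (S : Slider T c cores) {p q k : ℕ} {x : Crossing}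
    {l : List Crossing} (hl : l ∈ cores) (hp : IsTangle p [(k, .cross x)] q)
    (hg : T.Good [(k, .cross x)]) :
    clasp T c l (p + 1) (p - 1 - k) k ▷ Hom.mk [(k, .cross x)] (hp.add_right 1) hg =
      Hom.mk [(k, .cross x)] (hp.add_right 1) hg ◁
        clasp T c l (q + 1) (q - 1 - (k + 1)) (k + 1) := by
  obtain ⟨r, hr, h⟩ := isTangle_cons.1 hp
  have hq := isTangle_nil.1 h
  simp only [Gen.ins, Gen.outs] at hr hq
  obtain rfl : q = p := by omega
  have hx : T.ok x := hg k x (by simp)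
  have h1 := congrArg Units.val (S.clasp_mul_u (n := q + 1) (d := r) (k := k) hx hl (by omega))
  have h2 := crossing_eq (T := T) (n := q + 1) (k := k) (by omega) hx
  rw [show q - 1 - k = r + 1 by omega, show q - 1 - (k + 1) = r by omega]
  simp only [Units.val_mul, u, h2] at h1
  exact h1

theorem clasp_act_layer_crossLeft (S : Slider T c cores) {p q k : ℕ} {x : Crossing}
    {l : List Crossing} (hl : l ∈ cores) (hp : IsTangle p [(k, .cross x)] q)
    (hg : T.Good [(k, .cross x)]) :
    clasp T c l (p + 1) (p - 1 - (k + 1)) (k + 1) ▷ Hom.mk [(k, .cross x)] (hp.add_right 1) hg =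
      Hom.mk [(k, .cross x)] (hp.add_right 1) hg ◁ clasp T c l (q + 1) (q - 1 - k) k := by
  obtain ⟨r, hr, h⟩ := isTangle_cons.1 hp
  have hq := isTangle_nil.1 h
  simp only [Gen.ins, Gen.outs] at hr hq
  obtain rfl : q = p := by omega
  have hx : T.ok x := hg k x (by simp)
  have h1 := congrArg Units.val (S.clasp_succ_mul_u (n := q + 1) (d := r) (k := k) hx hl
    (by omega))
  have h2 := crossing_eq (T := T) (n := q + 1) (k := k) (by omega) hx
  rw [show q - 1 - k = r + 1 by omega, show q - 1 - (k + 1) = r by omega]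
  simp only [Units.val_mul, u, h2] at h1
  exact h1

theorem clasp_act_layer_cap (S : Slider T c cores) {p q k : ℕ} {l : List Crossing}
    (hl : l ∈ cores) (hp : IsTangle p [(k, .cap)] q) (hg : T.Good [(k, .cap)]) :
    clasp T c l (p + 1) (p - 1 - k) k ▷ Hom.mk [(k, .cap)] (hp.add_right 1) hg =
      clasp T c (twistInv l) (p + 1) (p - 1 - (k + 1)) (k + 1) ▷
        Hom.mk [(k, .cap)] (hp.add_right 1) hg := by
  obtain ⟨r, hr, h⟩ := isTangle_cons.1 hp
  have hq := isTangle_nil.1 h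
  simp only [Gen.ins, Gen.outs] at hr hq
  obtain rfl : p = q + 2 := by omega
  have h1 := S.clasp_act_cap (n := q + 1) (d := r) (k := k) hl (by omega)
  rw [cap_eq (by omega)] at h1
  rw [show q + 2 - 1 - k = r + 1 by omega, show q + 2 - 1 - (k + 1) = r by omega]
  exact h1

theorem layer_cup_ract_clasp (S : Slider T c cores) {p q k : ℕ} {l : List Crossing}
    (hl : l ∈ cores) (hp : IsTangle p [(k, .cup)] q) (hg : T.Good [(k, .cup)]) :
    Hom.mk [(k, .cup)] (hp.add_right 1) hg ◁ clasp T c l (q + 1) (q - 1 - k) k =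
      Hom.mk [(k, .cup)] (hp.add_right 1) hg ◁
        clasp T c (twistInv l) (q + 1) (q - 1 - (k + 1)) (k + 1) := by
  obtain ⟨r, hr, h⟩ := isTangle_cons.1 hp
  have hq := isTangle_nil.1 h
  simp only [Gen.ins, Gen.outs] at hr hq
  obtain rfl : q = p + 2 := by omega
  have h1 := S.cup_ract_clasp (n := p + 1) (d := r) (k := k) hl (by omega)
  rw [cup_eq (by omega)] at h1
  rw [show p + 2 - 1 - k = r + 1 by omega, show p + 2 - 1 - (k + 1) = r by omega]
  exact h1

end Slider

end LocalMoves

namespace LocalMoves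

variable {T : Theory}

namespace Slider

variable [ReidTheory T] {c : Crossing} {cores : Set (List Crossing)}

/-- Inserting at the point `x` of the word `v` on `n + 1` strands a clasp with a further strand on
the right, which is closed with the last one at the bottom and at the top, gives `f`. -/
def IsSlid (T : Theory) [ReidTheory T] (c : Crossing) (cores : Set (List Crossing)) {n : ℕ}
    (f : Hom T n n) (v : Word) (x : ℕ × ℕ) : Prop :=
  ∀ (U W : Word) (p : ℕ) (hU : IsTangle (n + 1) U p) (hU' : T.Good U) (hW : IsTangle p W (n + 1))
    (hW' : T.Good W), v = U ++ W → U.length = x.1 → x.2 < p → ∀ l ∈ cores,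
    cup T n n ⬝ (Hom.mk U (hU.add_right 1) hU' ◁ clasp T c l (p + 1) (p - 1 - x.2) x.2) ⬝
      Hom.mk W (hW.add_right 1) hW' ⬝ cap T n n = f

/-- The level of a point determines the splitting of the word, so the quantifiers in `IsSlid`
concern a single splitting; for points outside the diagram the condition is empty. -/
theorem isSlid_iff {n p i : ℕ} {f : Hom T n n} {U W : Word} (hU : IsTangle (n + 1) U p)
    (hU' : T.Good U) (hW : IsTangle p W (n + 1)) (hW' : T.Good W) :
    IsSlid T c cores f (U ++ W) (U.length, i) ↔ (i < p → ∀ l ∈ cores,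
    cup T n n ⬝ (Hom.mk U (hU.add_right 1) hU' ◁ clasp T c l (p + 1) (p - 1 - i) i) ⬝
      Hom.mk W (hW.add_right 1) hW' ⬝ cap T n n = f) := by
  constructor
  · intro h
    exact h U W p hU hU' hW hW' rfl rfl
  · intro h V X q hV hV' hX hX' e hl
    obtain ⟨rfl, rfl⟩ := List.append_inj e hl.symm
    obtain rfl := hU.unique hV
    exact h

theorem isSlid_iff_of_act_eq {n p q i j : ℕ} {f : Hom T n n} {U W : Word} {k : ℕ} {g : Gen}
    (hU : IsTangle (n + 1) U p) (hU' : T.Good U) (hg : IsTangle p [(k, g)] q)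
    (hg' : T.Good [(k, g)]) (hW : IsTangle q W (n + 1)) (hW' : T.Good W)
    (hij : i < p ↔ j < q) (h : i < p → ∀ l ∈ cores,
      clasp T c l (p + 1) (p - 1 - i) i ▷ Hom.mk [(k, g)] (hg.add_right 1) hg' =
      Hom.mk [(k, g)] (hg.add_right 1) hg' ◁ clasp T c l (q + 1) (q - 1 - j) j) :
    IsSlid T c cores f (U ++ (k, g) :: W) (U.length, i) ↔
      IsSlid T c cores f (U ++ (k, g) :: W) (U.length + 1, j) := by
  have e : U ++ (k, g) :: W = (U ++ [(k, g)]) ++ W := by simp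
  have h1 := isSlid_iff (c := c) (cores := cores) (f := f) (i := i) hU hU' (hg.append hW)
    (hg'.append hW')
  have h2 := isSlid_iff (c := c) (cores := cores) (f := f) (i := j) (hU.append hg) (hU'.append hg')
    hW hW'
  change IsSlid T c cores f (U ++ (k, g) :: W) (U.length, i) ↔ _ at h1
  rw [List.length_append, List.length_singleton, ← e] at h2
  rw [h1, h2, hij]
  refine forall_congr' fun hj => forall_congr' fun l => forall_congr' fun hl => ?_
  have h3 := h (hij.2 hj) l hl
  change cup T n n ⬝ (Hom.mk U (hU.add_right 1) hU' ◁ clasp T c l (p + 1) (p - 1 - i) i) ⬝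
      (Hom.mk [(k, g)] (hg.add_right 1) hg' ⬝ Hom.mk W (hW.add_right 1) hW') ⬝ cap T n n = f ↔
    cup T n n ⬝ ((Hom.mk U (hU.add_right 1) hU' ⬝ Hom.mk [(k, g)] (hg.add_right 1) hg') ◁
      clasp T c l (q + 1) (q - 1 - j) j) ⬝ Hom.mk W (hW.add_right 1) hW' ⬝ cap T n n = f
  rw [Hom.comp_ract, ← h3]
  simp only [Hom.comp_assoc, Hom.ract_comp, Hom.act_comp]

/-- Along vertical arcs and through crossings the twist is unchanged, and at an extremum it is
inverted. This is why `IsSlid` speaks of all twists of `cores`, a set closed under inversion. -/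
theorem isSlid_iff_of_adj (S : Slider T c cores) {n : ℕ} {f : Hom T n n} {v : Word}
    (hv : IsTangle (n + 1) v (n + 1)) (hv' : T.Good v) {x y : ℕ × ℕ} (h : Adj v x y) :
    IsSlid T c cores f v x ↔ IsSlid T c cores f v y := by
  have split {l k : ℕ} {g : Gen} (h : v[l]? = some (k, g)) : ∃ U W, v = U ++ (k, g) :: W ∧
      U.length = l := by
    obtain ⟨hl, h⟩ := List.getElem?_eq_some_iff.1 h
    refine ⟨v.take l, v.drop (l + 1), ?_, by simp [hl.le]⟩
    rw [← h, List.cons_getElem_drop_succ, List.take_append_drop]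
  have typed {U W : Word} {k : ℕ} {g : Gen} (e : v = U ++ (k, g) :: W) :
      ∃ p q, IsTangle (n + 1) U p ∧ IsTangle p [(k, g)] q ∧ IsTangle q W (n + 1) ∧
        T.Good U ∧ T.Good [(k, g)] ∧ T.Good W := by
    subst e
    obtain ⟨p, h1, h2⟩ := isTangle_append.1 hv
    obtain ⟨q, h2, h3⟩ := h2.exists_of_cons
    have h4 : T.Good ((k, g) :: W) := hv'.of_append_right
    exact ⟨p, q, h1, h2, h3, hv'.of_append_left, Theory.Good.of_append_left (v := [(k, g)]) h4,
      Theory.Good.of_append_right (v := [(k, g)]) h4⟩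
  have width {p q k : ℕ} {g : Gen} (h : IsTangle p [(k, g)] q) :
      ∃ r, p = k + g.ins + r ∧ q = k + g.outs + r := by
    obtain ⟨r, h1, h2⟩ := isTangle_cons.1 h
    exact ⟨r, h1, (isTangle_nil.1 h2).symm⟩
  cases h with
  | left l k i g h hi =>
    obtain ⟨U, W, rfl, rfl⟩ := split h
    obtain ⟨p, q, h1, h2, h3, g1, g2, g3⟩ := typed rfl
    obtain ⟨r, hp, hq⟩ := width h2
    exact isSlid_iff_of_act_eq h1 g1 h2 g2 h3 g3 (by omega)
      fun _ l hl => S.clasp_act_layer_left h2 g2 hi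
  | right l k i g h =>
    obtain ⟨U, W, rfl, rfl⟩ := split h
    obtain ⟨p, q, h1, h2, h3, g1, g2, g3⟩ := typed rfl
    obtain ⟨r, hp, hq⟩ := width h2
    exact isSlid_iff_of_act_eq h1 g1 h2 g2 h3 g3 (by omega)
      fun hi l hl => clasp_act_layer_right h2 g2 hi
  | crossRight l k x h =>
    obtain ⟨U, W, rfl, rfl⟩ := split h
    obtain ⟨p, q, h1, h2, h3, g1, g2, g3⟩ := typed rfl
    obtain ⟨r, hp, hq⟩ := width h2
    exact isSlid_iff_of_act_eq h1 g1 h2 g2 h3 g3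
      (by simp only [Gen.ins, Gen.outs] at hp hq; omega)
      fun hi l hl => S.clasp_act_layer_crossRight hl h2 g2
  | crossLeft l k x h =>
    obtain ⟨U, W, rfl, rfl⟩ := split h
    obtain ⟨p, q, h1, h2, h3, g1, g2, g3⟩ := typed rfl
    obtain ⟨r, hp, hq⟩ := width h2
    exact isSlid_iff_of_act_eq h1 g1 h2 g2 h3 g3
      (by simp only [Gen.ins, Gen.outs] at hp hq; omega)
      fun hi l hl => S.clasp_act_layer_crossLeft hl h2 g2
  | cap l k h =>
    obtain ⟨U, W, rfl, rfl⟩ := split h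
    obtain ⟨p, q, h1, h2, h3, g1, g2, g3⟩ := typed rfl
    obtain ⟨r, hp, hq⟩ := width h2
    simp only [Gen.ins, Gen.outs] at hp hq
    have key (l : List Crossing) (hl : l ∈ cores) :
        cup T n n ⬝ (Hom.mk U (h1.add_right 1) g1 ◁ clasp T c l (p + 1) (p - 1 - k) k) ⬝
          Hom.mk ([(k, .cap)] ++ W) ((h2.append h3).add_right 1) (g2.append g3) ⬝ cap T n n =
        cup T n n ⬝ (Hom.mk U (h1.add_right 1) g1 ◁
          clasp T c (twistInv l) (p + 1) (p - 1 - (k + 1)) (k + 1)) ⬝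
          Hom.mk ([(k, .cap)] ++ W) ((h2.append h3).add_right 1) (g2.append g3) ⬝ cap T n n := by
      have h4 := S.clasp_act_layer_cap hl h2 g2
      change cup T n n ⬝ (Hom.mk U (h1.add_right 1) g1 ◁ clasp T c l (p + 1) (p - 1 - k) k) ⬝
          (Hom.mk [(k, .cap)] (h2.add_right 1) g2 ⬝ Hom.mk W (h3.add_right 1) g3) ⬝ cap T n n =
        cup T n n ⬝ (Hom.mk U (h1.add_right 1) g1 ◁
          clasp T c (twistInv l) (p + 1) (p - 1 - (k + 1)) (k + 1)) ⬝
          (Hom.mk [(k, .cap)] (h2.add_right 1) g2 ⬝ Hom.mk W (h3.add_right 1) g3) ⬝ cap T n n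
      rw [Hom.comp_assoc (cup T n n), Hom.ract_comp, ← Hom.act_comp, h4, Hom.act_comp,
        ← Hom.ract_comp]
      simp only [Hom.comp_assoc]
    rw [← List.singleton_append, isSlid_iff h1 g1 (h2.append h3) (g2.append g3),
      isSlid_iff h1 g1 (h2.append h3) (g2.append g3)]
    constructor
    · intro h _ l hl
      rw [← twistInv_twistInv l, ← key _ (S.inv_core l hl)]
      exact h (by omega) _ (S.inv_core l hl)
    · intro h _ l hl
      rw [key l hl]
      exact h (by omega) _ (S.inv_core l hl)
  | cup l k h =>
    obtain ⟨U, W, rfl, rfl⟩ := split h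
    obtain ⟨p, q, h1, h2, h3, g1, g2, g3⟩ := typed rfl
    obtain ⟨r, hp, hq⟩ := width h2
    simp only [Gen.ins, Gen.outs] at hp hq
    have key (l : List Crossing) (hl : l ∈ cores) :
        Hom.mk (U ++ [(k, .cup)]) ((h1.append h2).add_right 1) (g1.append g2) ◁
          clasp T c l (q + 1) (q - 1 - k) k =
        Hom.mk (U ++ [(k, .cup)]) ((h1.append h2).add_right 1) (g1.append g2) ◁
          clasp T c (twistInv l) (q + 1) (q - 1 - (k + 1)) (k + 1) := by
      have h4 := S.layer_cup_ract_clasp hl h2 g2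
      change (Hom.mk U (h1.add_right 1) g1 ⬝ Hom.mk [(k, .cup)] (h2.add_right 1) g2) ◁
          clasp T c l (q + 1) (q - 1 - k) k =
        (Hom.mk U (h1.add_right 1) g1 ⬝ Hom.mk [(k, .cup)] (h2.add_right 1) g2) ◁
          clasp T c (twistInv l) (q + 1) (q - 1 - (k + 1)) (k + 1)
      rw [Hom.comp_ract, h4, ← Hom.comp_ract]
    have e : U ++ (k, .cup) :: W = (U ++ [(k, .cup)]) ++ W := by simp
    have e' : U.length + 1 = (U ++ [(k, Gen.cup)]).length := by simp
    rw [e, e', isSlid_iff (h1.append h2) (g1.append g2) h3 g3,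
      isSlid_iff (h1.append h2) (g1.append g2) h3 g3]
    constructor
    · intro h _ l hl
      rw [← twistInv_twistInv l, ← key _ (S.inv_core l hl)]
      exact h (by omega) _ (S.inv_core l hl)
    · intro h _ l hl
      rw [key l hl]
      exact h (by omega) _ (S.inv_core l hl)

theorem isSlid_iff_of_sameStrand (S : Slider T c cores) {n : ℕ} {f : Hom T n n} {v : Word}
    (hv : IsTangle (n + 1) v (n + 1)) (hv' : T.Good v) {x y : ℕ × ℕ} (h : SameStrand v x y) :
    IsSlid T c cores f v x ↔ IsSlid T c cores f v y := by
  induction h with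
  | rel x y h => exact S.isSlid_iff_of_adj hv hv' h
  | refl x => exact Iff.rfl
  | symm x y _ ih => exact ih.symm
  | trans x y z _ _ ih ih' => exact ih.trans ih'

end Slider

/-- Inserting a crossing cuts the strand through place `k`, so the point `x` remains connected to
the cut from below or from above. The proof follows the set `R` of points connected to either end;
outside the cut, corresponding points below and above the new crossing agree in `R`. -/
theorem sameStrand_insert_cross {A B : Word} {k : ℕ} {c : Crossing} {x : ℕ × ℕ}
    (h : SameStrand (A ++ B) x (A.length, k)) (hx : x.1 ≤ A.length) :
    SameStrand (A ++ (k, .cross c) :: B) x (A.length, k) ∨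
      SameStrand (A ++ (k, .cross c) :: B) x (A.length + 1, k) := by
  let R (y : ℕ × ℕ) : Prop := SameStrand (A ++ (k, .cross c) :: B) y (A.length, k) ∨
    SameStrand (A ++ (k, .cross c) :: B) y (A.length + 1, k)
  have hR {y z : ℕ × ℕ} (h : SameStrand (A ++ (k, .cross c) :: B) y z) : R y ↔ R z :=
    ⟨fun hy => hy.imp h.symm.trans h.symm.trans, fun hz => hz.imp h.trans h.trans⟩
  let f (y : ℕ × ℕ) : ℕ × ℕ := if y.1 ≤ A.length then y else (y.1 + 1, y.2)
  have hf {y : ℕ × ℕ} (hy : y.1 ≤ A.length) : f y = y := if_pos hy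
  have hget : (A ++ (k, .cross c) :: B)[A.length]? = some (k, .cross c) := by simp
  have hmid (i : ℕ) : R (A.length, i) ↔ R (A.length + 1, i) := by
    by_cases h1 : i = k
    · subst h1
      exact iff_of_true (Or.inl (.refl _)) (Or.inr (.refl _))
    by_cases h2 : i = k + 1
    · subst h2
      exact iff_of_true (Or.inr (Adj.crossLeft _ k c hget).sameStrand)
        (Or.inl (Adj.crossRight _ k c hget).sameStrand.symm)
    · have := sameStrand_cross hget i
      rw [Equiv.swap_apply_of_ne_of_ne h1 h2] at this
      exact hR this
  have hup (y : ℕ × ℕ) : R (f (raise A.length y)) ↔ R (raise (A.length + 1) y) := by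
    obtain ⟨_ | l, i⟩ := y
    · exact (hf (y := (A.length, i)) le_rfl).symm ▸ hmid i
    · have : f (raise A.length (l + 1, i)) = raise (A.length + 1) (l + 1, i) := by
        simp only [f, raise]
        rw [if_neg (by omega)]
        ext
        · simp only
          omega
        · rfl
      rw [this]
  have hadj {y z : ℕ × ℕ} (h : Adj (A ++ B) y z) : R (f y) ↔ R (f z) := by
    rcases adj_append.1 h with h' | ⟨y, z, h', rfl, rfl⟩
    · have hl := length_pos_of_adj h'
      rw [hf hl.1, hf hl.2]
      exact hR (h'.sameStrand.append_right _)
    · rw [hup, hup]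
      have h1 := h'.sameStrand.append_left (A ++ [(k, .cross c)])
      rw [List.append_assoc, List.singleton_append, List.length_append, List.length_singleton] at h1
      exact hR h1
  have key : R (f x) ↔ R (f (A.length, k)) := by
    generalize (A.length, k) = y at h ⊢
    clear hx
    induction h with
    | rel x y h => exact hadj h
    | refl x => exact Iff.rfl
    | symm x y _ ih => exact ih.symm
    | trans x y z _ _ ih ih' => exact ih.trans ih'
  rw [hf hx, hf le_rfl] at key
  exact key.2 (Or.inl (.refl _))

end LocalMoves

/-! ### Removing a twist between two pieces of one strand -/

namespace LocalMoves

variable {T : Theory} [ReidTheory T] {c : Crossing} {cores : Set (List Crossing)}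

namespace Slider

/-- Give the strand at place `k + 1` a curl by means of two auxiliary strands, closed by a minimum
and a maximum. By `cup_clasp_cap` the twist of the pieces `k` and `k + 1` is a clasp of the piece
`k` with the last strand. The other auxiliary strand belongs to the curl, so the clasp can be slid
to it along the common strand, and there the minimum or the maximum absorbs it. -/
theorem comp_twist_comp_of_last (S : Slider T c cores) {n k : ℕ} {A B : Word}
    (hA : IsTangle n A (k + 2)) (hA' : T.Good A) (hB : IsTangle (k + 2) B n) (hB' : T.Good B)
    (h : SameStrand (A ++ B) (A.length, k) (A.length, k + 1)) {l : List Crossing}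
    (hl : l ∈ cores) :
    Hom.mk A hA hA' ⬝ (twist T (k + 2) k l ▷ Hom.mk B hB hB') =
      Hom.mk A hA hA' ⬝ Hom.mk B hB hB' := by
  set f : Hom T n n := Hom.mk A hA hA' ⬝ Hom.mk B hB hB' with hf
  have hc : IsTangle (k + 3) [(k + 1, .cross c)] (k + 3) := isTangle_cross le_rfl
  have hc' : T.Good [(k + 1, .cross c)] := Theory.good_cross S.ok_carrier
  have hc2 : Hom.mk [(k + 1, .cross c)] (hc.add_right 1) hc' =
      (u T (k + 2 + 2) (k + 1) c).1 := (crossing_eq (by omega) S.ok_carrier).symm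
  have hA1 : IsTangle (n + 1) A (k + 3) := hA.add_right 1
  have hB1 : IsTangle (k + 3) B (n + 1) := hB.add_right 1
  have hcup : cup T n n ⬝ Hom.mk A (hA1.add_right 1) hA' =
    Hom.mk A hA hA' ⬝ cup T (k + 2) (k + 2) := cup_comp_mk hA hA'
  have hcap : Hom.mk B (hB1.add_right 1) hB' ⬝ cap T n n =
    cap T (k + 2) (k + 2) ⬝ Hom.mk B hB hB' := mk_comp_cap hB hB'
  have hkink : cup T (k + 2) (k + 2) ⬝ (u T (k + 2 + 2) (k + 1) c ▷ cap T (k + 2) (k + 2)) =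
      Hom.id (k + 2) := cup_crossing_cap S.ok_carrier le_rfl
  have hv : IsTangle (n + 1) (A ++ (k + 1, .cross c) :: B) (n + 1) := hA1.append (hc.append hB1)
  have hv' : T.Good (A ++ (k + 1, .cross c) :: B) := hA'.append (hc'.append hB')
  have hget : (A ++ (k + 1, .cross c) :: B)[A.length]? = some (k + 1, .cross c) := by simp
  -- At the auxiliary strand just above its minimum the clasp is a twist of the two legs of that
  -- minimum, which R1 and vR1 undo.
  have below : IsSlid T c cores f (A ++ (k + 1, .cross c) :: B) (A.length, k + 2) := by
    refine (isSlid_iff hA1 hA' (hc.append hB1) (hc'.append hB')).2 fun _ l hl => ?_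
    have h1 : cup T (k + 2) (k + 2) ◁ twist T (k + 2 + 2) (k + 2) l = cup T (k + 2) (k + 2) :=
      cup_ract_twist (S.ok_core l hl) le_rfl
    rw [show k + 3 - 1 - (k + 2) = 0 by omega, clasp_zero]
    change cup T n n ⬝ (Hom.mk A (hA1.add_right 1) hA' ◁ twist T (k + 2 + 2) (k + 2) l) ⬝
      (Hom.mk [(k + 1, .cross c)] (hc.add_right 1) hc' ⬝ Hom.mk B (hB1.add_right 1) hB') ⬝
      cap T n n = f
    rw [← Hom.comp_ract, hcup, Hom.comp_ract, h1, hc2, Hom.comp_assoc, Hom.comp_assoc,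
      Hom.comp_assoc, hcap]
    change Hom.mk A hA hA' ⬝ (cup T (k + 2) (k + 2) ⬝ (u T (k + 2 + 2) (k + 1) c ▷
      (cap T (k + 2) (k + 2) ⬝ Hom.mk B hB hB'))) = f
    rw [← Hom.act_comp, ← Hom.comp_assoc (cup _ _ _), hkink, Hom.id_comp]
  have above : IsSlid T c cores f (A ++ (k + 1, .cross c) :: B) (A.length + 1, k + 2) := by
    have h0 := isSlid_iff (c := c) (cores := cores) (f := f) (i := k + 2) (hA1.append hc)
      (hA'.append hc') hB1 hB'
    rw [List.length_append, List.length_singleton, List.append_assoc, List.singleton_append] at h0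
    refine h0.2 fun _ l hl => ?_
    have h1 : twist T (k + 2 + 2) (k + 2) l ▷ cap T (k + 2) (k + 2) = cap T (k + 2) (k + 2) :=
      twist_act_cap (S.ok_core l hl) le_rfl
    rw [show k + 3 - 1 - (k + 2) = 0 by omega, clasp_zero]
    change cup T n n ⬝ ((Hom.mk A (hA1.add_right 1) hA' ⬝
      Hom.mk [(k + 1, .cross c)] (hc.add_right 1) hc') ◁ twist T (k + 2 + 2) (k + 2) l) ⬝
      Hom.mk B (hB1.add_right 1) hB' ⬝ cap T n n = f
    rw [Hom.comp_assoc, hcap, ← Hom.comp_assoc, Hom.comp_assoc (cup T n n), Hom.ract_comp, h1,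
      ← Hom.comp_assoc, ← Hom.comp_assoc, hcup, hc2, Hom.comp_assoc (Hom.mk A hA hA'),
      Hom.comp_assoc (Hom.mk A hA hA')]
    change Hom.mk A hA hA' ⬝ (cup T (k + 2) (k + 2) ⬝ (u T (k + 2 + 2) (k + 1) c).1 ⬝
      cap T (k + 2) (k + 2)) ⬝ Hom.mk B hB hB' = f
    rw [Hom.comp_assoc (cup _ _ _)]
    change Hom.mk A hA hA' ⬝ (cup T (k + 2) (k + 2) ⬝ (u T (k + 2 + 2) (k + 1) c ▷
      cap T (k + 2) (k + 2))) ⬝ Hom.mk B hB hB' = f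
    rw [hkink, Hom.comp_id]
  -- The crossing of the curl cuts the strand at place `k + 1`. Whichever side of the cut is reached
  -- from `k`, it continues to the auxiliary strand: upwards to its maximum or downwards to its
  -- minimum.
  have key : IsSlid T c cores f (A ++ (k + 1, .cross c) :: B) (A.length, k) := by
    rcases sameStrand_insert_cross (c := c) h le_rfl with h | h
    · exact (S.isSlid_iff_of_sameStrand hv hv'
        (h.trans (Adj.crossRight _ (k + 1) c hget).sameStrand)).2 above
    · exact (S.isSlid_iff_of_sameStrand hv hv'
        (h.trans (Adj.crossLeft _ (k + 1) c hget).sameStrand.symm)).2 below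
  have h1 := (isSlid_iff hA1 hA' (hc.append hB1) (hc'.append hB')).1 key (by omega) _
    (S.inv_core l hl)
  have h2 := S.cup_clasp_cap (k := k) (S.inv_core l hl)
  rw [twistInv_twistInv] at h2
  rw [show k + 3 - 1 - k = 2 by omega] at h1
  change cup T n n ⬝ (Hom.mk A (hA1.add_right 1) hA' ◁ clasp T c (twistInv l) (k + 2 + 2) 2 k) ⬝
      (Hom.mk [(k + 1, .cross c)] (hc.add_right 1) hc' ⬝ Hom.mk B (hB1.add_right 1) hB') ⬝
      cap T n n = f at h1
  rw [← h1, ← Hom.comp_ract, hcup, hc2, Hom.comp_assoc, Hom.comp_assoc _ _ (cap T n n), hcap,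
    ← Hom.comp_assoc _ (cap T (k + 2) (k + 2)), Hom.comp_ract, Hom.comp_assoc]
  change _ = Hom.mk A hA hA' ⬝ ((cup T (k + 2) (k + 2) ◁ clasp T c (twistInv l) (k + 2 + 2) 2 k) ⬝
    ((u T (k + 2 + 2) (k + 1) c ▷ cap T (k + 2) (k + 2)) ⬝ Hom.mk B hB hB'))
  rw [← Hom.comp_assoc (cup T (k + 2) (k + 2) ◁ _), Hom.ract_comp, ← Hom.mul_act, h2]
  rfl

theorem sameStrand_conjugate {A B : Word} {k : ℕ} (x y z t : Crossing)
    (h : SameStrand (A ++ B) (A.length, k) (A.length, k + 1)) :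
    SameStrand ((A ++ [(k + 1, .cross x), (k, .cross y)]) ++
      ([(k, .cross z), (k + 1, .cross t)] ++ B))
      (A.length + 2, k + 1) (A.length + 2, k + 2) := by
  have h1 : StrandEquiv [] [cr 1 x, cr 0 y, cr 0 z, cr 1 t] := by
    refine isBraid_nil.strandEquiv
      ((((isBraid_nil.cons _ _).cons _ _).cons _ _).cons _ _) ?_
    ext i
    simp [perm, cr]
  obtain ⟨f, -, hf, -⟩ := ((h1.shift k).append_right B)
  have h2 := SameStrand.map (hf.append_left A).adj h
  have h3 (i : ℕ) := extendBelow_of_le hf.bot A (x := (A.length, i)) le_rfl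
  have h4 := (h3 k).symm.trans (h2.trans (h3 (k + 1)))
  have e : A ++ (shift k [cr 1 x, cr 0 y, cr 0 z, cr 1 t] ++ B) =
      (A ++ [(k + 1, .cross x), (k, .cross y)]) ++ ([(k, .cross z), (k + 1, .cross t)] ++ B) := by
    simp [shift, cr]
  rw [e] at h4
  have g0 : ((A ++ [(k + 1, .cross x), (k, .cross y)]) ++
      ([(k, .cross z), (k + 1, .cross t)] ++ B))[A.length]? = some (k + 1, .cross x) := by simp
  have g1 : ((A ++ [(k + 1, .cross x), (k, .cross y)]) ++
      ([(k, .cross z), (k + 1, .cross t)] ++ B))[A.length + 1]? = some (k, .cross y) := by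
    simp
  have p1 := (Adj.left _ _ k _ g0 (Nat.lt_succ_self k)).sameStrand.trans
    (Adj.crossRight _ _ _ g1).sameStrand
  have p2 := (Adj.crossRight _ _ _ g0).sameStrand.trans (Adj.right _ _ 0 _ g1).sameStrand
  exact p1.symm.trans (h4.trans p2)

/-- A twist of two pieces of the same strand can be removed. -/
theorem comp_twist_comp (S : Slider T c cores) {n m k r : ℕ} (hm : k + 2 + r = m) {A B : Word}
    (hA : IsTangle n A m) (hA' : T.Good A) (hB : IsTangle m B n) (hB' : T.Good B)
    (h : SameStrand (A ++ B) (A.length, k) (A.length, k + 1))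
    {l : List Crossing} (hl : l ∈ cores) :
    Hom.mk A hA hA' ⬝ (twist T m k l ▷ Hom.mk B hB hB') =
      Hom.mk A hA hA' ⬝ Hom.mk B hB hB' := by
  induction r generalizing k A B with
  | zero =>
    subst hm
    exact S.comp_twist_comp_of_last hA hA' hB hB' h hl
  | succ r ih =>
    have ok' : T.ok c.rot := ReidTheory.ok_rot S.ok_carrier
    have t0 (x : Crossing) : IsTangle m [(k, .cross x)] m := isTangle_cross (by omega)
    have t1 (x : Crossing) : IsTangle m [(k + 1, .cross x)] m := isTangle_cross (by omega)
    have e0 (x : Crossing) (hx : T.ok x) : Hom.mk [(k, .cross x)] (t0 x) (Theory.good_cross hx) =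
      (u T m k x).1 := (crossing_eq (by omega) hx).symm
    have e1 (x : Crossing) (hx : T.ok x) : Hom.mk [(k + 1, .cross x)] (t1 x)
      (Theory.good_cross hx) = (u T m (k + 1) x).1 := (crossing_eq (by omega) hx).symm
    -- Carrier crossings and their inverses are inserted so that the two pieces become neighbours
    -- one place further right, with one strand less beyond them.
    have h1 := ih (k := k + 1) (by omega)
      (A := A ++ ([(k + 1, .cross c.rot)] ++ [(k, .cross c.rot)]))
      (B := [(k, .cross c)] ++ [(k + 1, .cross c)] ++ B)
      (hA.append ((t1 _).append (t0 _))) (hA'.append ((Theory.good_cross ok').append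
        (Theory.good_cross ok'))) (((t0 _).append (t1 _)).append hB)
      (((Theory.good_cross S.ok_carrier).append (Theory.good_cross S.ok_carrier)).append hB')
      (by
        rw [List.length_append]
        exact sameStrand_conjugate _ _ _ _ h)
    change Hom.mk A hA hA' ⬝ (Hom.mk [(k + 1, .cross c.rot)] (t1 _) (Theory.good_cross ok') ⬝
        Hom.mk [(k, .cross c.rot)] (t0 _) (Theory.good_cross ok')) ⬝ (twist T m (k + 1) l ▷
        (Hom.mk [(k, .cross c)] (t0 _) (Theory.good_cross S.ok_carrier) ⬝
          Hom.mk [(k + 1, .cross c)] (t1 _) (Theory.good_cross S.ok_carrier) ⬝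
          Hom.mk B hB hB')) =
      Hom.mk A hA hA' ⬝ (Hom.mk [(k + 1, .cross c.rot)] (t1 _) (Theory.good_cross ok') ⬝
        Hom.mk [(k, .cross c.rot)] (t0 _) (Theory.good_cross ok')) ⬝
        (Hom.mk [(k, .cross c)] (t0 _) (Theory.good_cross S.ok_carrier) ⬝
          Hom.mk [(k + 1, .cross c)] (t1 _) (Theory.good_cross S.ok_carrier) ⬝
          Hom.mk B hB hB') at h1
    rw [e0 _ ok', e1 _ ok', e0 _ S.ok_carrier, e1 _ S.ok_carrier] at h1
    change (Hom.mk A hA hA' ◁ (u T m (k + 1) c.rot * u T m k c.rot)) ⬝ (twist T m (k + 1) l ▷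
        (u T m k c * u T m (k + 1) c) ▷ Hom.mk B hB hB') =
      (Hom.mk A hA hA' ◁ (u T m (k + 1) c.rot * u T m k c.rot)) ⬝
        ((u T m k c * u T m (k + 1) c) ▷ Hom.mk B hB hB') at h1
    have e2 : u T m (k + 1) c.rot * u T m k c.rot = (u T m k c * u T m (k + 1) c)⁻¹ := by
      rw [mul_inv_rev, u_inv, u_inv]
    rw [Hom.ract_comp, Hom.ract_comp, ← Hom.mul_act, ← Hom.mul_act, ← Hom.mul_act, e2,
      inv_mul_cancel, Hom.one_act, mul_assoc, ← S.twist_slide_right (S.ok_core l hl) (by omega),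
      inv_mul_cancel_left] at h1
    exact h1

end Slider

end LocalMoves

namespace LocalMoves

variable {T : Theory}

/-! ### Words of crossings -/

theorem IsBraid.isTangle_iff {w : Word} (h : IsBraid w) {p q : ℕ} :
    IsTangle p w q ↔ p = q ∧ ∀ a ∈ w, a.1 + 2 ≤ p := by
  induction w generalizing p with
  | nil => simp [isTangle_nil]
  | cons a w ih =>
    obtain ⟨⟨x, hx⟩, hw⟩ := h.of_cons
    rw [hx, isTangle_cons]
    generalize a.1 = k
    simp only [Gen.ins, Gen.outs, ih hw, List.forall_mem_cons]
    constructor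
    · rintro ⟨r, rfl, rfl, h⟩
      exact ⟨rfl, by omega, h⟩
    · rintro ⟨rfl, h1, h2⟩
      exact ⟨p - (k + 2), by omega, by omega, by rwa [Nat.add_sub_cancel' h1]⟩

theorem IsBraid.shift {w : Word} (h : IsBraid w) (k : ℕ) : IsBraid (shift k w) := by
  intro a ha
  obtain ⟨b, hb, rfl⟩ := List.mem_map.1 ha
  exact h b hb

theorem Theory.Good.shift {w : Word} (h : T.Good w) (k : ℕ) : T.Good (shift k w) := by
  intro j x hx
  obtain ⟨⟨i, g⟩, hb, e⟩ := List.mem_map.1 hx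
  simp only [Prod.mk.injEq] at e
  obtain ⟨-, rfl⟩ := e
  exact h i x hb

section Braid

variable [ReidTheory T]

/-- The invertible diagram given by a word of crossings. -/
noncomputable def braidUnit (T : Theory) [ReidTheory T] (p : ℕ) : Word → (Hom T p p)ˣ
  | [] => 1
  | (k, .cross x) :: w => u T p k x * braidUnit T p w
  | (_, .cap) :: w => braidUnit T p w
  | (_, .cup) :: w => braidUnit T p w

theorem IsBraid.mk_eq {w : Word} (h : IsBraid w) {p : ℕ} (hw : IsTangle p w p) (hg : T.Good w) :
    Hom.mk w hw hg = (braidUnit T p w).1 := by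
  induction w with
  | nil => rfl
  | cons a w ih =>
    obtain ⟨⟨x, hx⟩, hb⟩ := h.of_cons
    obtain ⟨k, g⟩ := a
    obtain rfl : g = .cross x := congrArg Prod.snd hx
    obtain ⟨-, hw'⟩ := h.isTangle_iff.1 hw
    have hk : k + 2 ≤ p := hw' (k, .cross x) List.mem_cons_self
    have hx : T.ok x := hg k x List.mem_cons_self
    have h1 : IsTangle p w p :=
      hb.isTangle_iff.2 ⟨rfl, fun a ha => hw' a (List.mem_cons_of_mem _ ha)⟩
    have h2 : T.Good w := Theory.Good.of_append_right (v := [(k, .cross x)]) hg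
    change Hom.mk [(k, .cross x)] (isTangle_cross hk) (Theory.good_cross hx) ⬝ Hom.mk w h1 h2 = _
    rw [ih hb h1 h2, ← crossing_eq hk hx]
    rfl

theorem braidUnit_eq_of_rel {v w : Word} (hv : IsBraid v) (hw : IsBraid w) (hv' : T.Good v)
    (hw' : T.Good w) (h : T.rel v w) {k p : ℕ} (fv : ∀ a ∈ v, k + a.1 + 2 ≤ p)
    (fw : ∀ a ∈ w, k + a.1 + 2 ≤ p) :
    braidUnit T p (shift k v) = braidUnit T p (shift k w) := by
  have tv : IsTangle p (shift k v) p := (hv.shift k).isTangle_iff.2 ⟨rfl, List.forall_mem_map.2 fv⟩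
  have tw : IsTangle p (shift k w) p := (hw.shift k).isTangle_iff.2 ⟨rfl, List.forall_mem_map.2 fw⟩
  refine Units.ext ?_
  rw [← (hv.shift k).mk_eq tv (hv'.shift k), ← (hw.shift k).mk_eq tw (hw'.shift k)]
  exact Quot.sound ⟨[], [], k, v, w, h, by simp, by simp⟩

theorem mk_eq_of_locally {P : Word → Word → Prop}
    (hP : ∀ v w, P v w → IsBraid v ∧ IsBraid w ∧ ∀ p k, (∀ a ∈ v, k + a.1 + 2 ≤ p) →
      (∀ a ∈ w, k + a.1 + 2 ≤ p) → braidUnit T p (shift k v) = braidUnit T p (shift k w))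
    {n : ℕ} {D D' : Word} (hD : IsTangle n D n ∧ T.Good D) (hD' : IsTangle n D' n ∧ T.Good D')
    (h : Locally P D D') : Hom.mk D hD.1 hD.2 = Hom.mk D' hD'.1 hD'.2 := by
  obtain ⟨A, B, k, v, w, hvw, rfl, rfl⟩ := h
  obtain ⟨hv, hw, h⟩ := hP v w hvw
  obtain ⟨⟨q, h1, h2⟩, h3⟩ := hD.imp_left isTangle_append.1
  obtain ⟨⟨q', h1', h2'⟩, h3'⟩ := hD'.imp_left isTangle_append.1
  obtain ⟨p, h4, h5⟩ := isTangle_append.1 h1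
  obtain ⟨p', h4', h5'⟩ := isTangle_append.1 h1'
  obtain rfl := h4.unique h4'
  obtain ⟨rfl, f⟩ := (hv.shift k).isTangle_iff.1 h5
  obtain ⟨rfl, f'⟩ := (hw.shift k).isTangle_iff.1 h5'
  have e := h p k (List.forall_mem_map.1 f) (List.forall_mem_map.1 f')
  have g1 := h3.of_append_left.of_append_right
  have g2 := h3'.of_append_left.of_append_right
  change Hom.mk A h4 h3.of_append_left.of_append_left ⬝ Hom.mk (shift k v) h5 g1 ⬝
      Hom.mk B h2 h3.of_append_right =
    Hom.mk A h4 h3.of_append_left.of_append_left ⬝ Hom.mk (shift k w) h5' g2 ⬝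
      Hom.mk B h2 h3.of_append_right
  rw [(hv.shift k).mk_eq, (hw.shift k).mk_eq, e]

/-- A removable twist may also be inserted: placed below the crossing `x`, the twist `l` turns it
into `y`. -/
theorem Slider.mk_eq_of_selfCrossing {c : Crossing} {cores : Set (List Crossing)}
    (S : Slider T c cores) {l : List Crossing} (hl : l ∈ cores) {A B : Word} {k n : ℕ}
    {x y : Crossing} (h : ∀ m, twist T m k l * u T m k x = u T m k y)
    (hD : IsTangle n (A ++ (k, .cross x) :: B) n ∧ T.Good (A ++ (k, .cross x) :: B))
    (hD' : IsTangle n (A ++ (k, .cross y) :: B) n ∧ T.Good (A ++ (k, .cross y) :: B))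
    (hs : SameStrand (A ++ (k, .cross x) :: B) (A.length, k) (A.length, k + 1)) :
    Hom.mk (A ++ (k, .cross x) :: B) hD.1 hD.2 = Hom.mk (A ++ (k, .cross y) :: B) hD'.1 hD'.2 := by
  obtain ⟨m, hA, hB⟩ := isTangle_append.1 hD.1
  obtain ⟨r, hr, hB1⟩ := isTangle_cons.1 hB
  rw [Gen.ins] at hr
  rw [Gen.outs, ← hr] at hB1
  have gx : T.Good ((k, .cross x) :: B) := hD.2.of_append_right
  have hx : T.ok x := gx k x List.mem_cons_self
  have hy : T.ok y := hD'.2.of_append_right k y List.mem_cons_self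
  have gB : T.Good B := Theory.Good.of_append_right (v := [(k, .cross x)]) gx
  have h1 := S.comp_twist_comp hr.symm hA hD.2.of_append_left hB gx hs hl
  have e (z : Crossing) (hz : T.ok z) :
      Hom.mk [(k, .cross z)] (isTangle_cross (n := m) (by omega)) (Theory.good_cross hz) =
        (u T m k z).1 := (crossing_eq (by omega) hz).symm
  refine h1.symm.trans ?_
  change Hom.mk A hA hD.2.of_append_left ⬝ (twist T m k l ▷ (Hom.mk [(k, .cross x)]
      (isTangle_cross (n := m) (by omega)) (Theory.good_cross hx) ⬝ Hom.mk B hB1 gB)) =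
    Hom.mk A hA hD.2.of_append_left ⬝ (Hom.mk [(k, .cross y)]
      (isTangle_cross (n := m) (by omega)) (Theory.good_cross hy) ⬝ Hom.mk B hB1 gB)
  rw [e x hx, e y hy, ← h m]
  exact congrArg _ (Hom.mul_act _ _ _).symm

end Braid

/-! ### The implications between the moves -/

theorem isBraid_tri (x y z : Crossing) : IsBraid (tri x y z) :=
  ((isBraid_nil.cons _ _).cons _ _).cons _ _

theorem isBraid_tri' (x y z : Crossing) : IsBraid (tri' x y z) :=
  ((isBraid_nil.cons _ _).cons _ _).cons _ _

theorem isBraid_band (x y z t : Crossing) : IsBraid [cr 1 x, cr 0 y, cr 2 z, cr 1 t] :=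
  (((isBraid_nil.cons _ _).cons _ _).cons _ _).cons _ _

theorem isBraid_weldedBand (x y z t t' t'' : Crossing) :
    IsBraid [cr 1 x, cr 0 y, cr 2 z, cr 1 t, cr 1 t', cr 1 t''] :=
  (((((isBraid_nil.cons _ _).cons _ _).cons _ _).cons _ _).cons _ _).cons _ _

theorem hasDelta_of_rel [ReidTheory T]
    (h : T.rel (tri .over .under .over) (tri' .over .under .over)) :
    HasDelta T := by
  intro n k hk
  simp only [u_over_inv]
  exact u_tri ReidTheory.ok_over ReidTheory.ok_under ReidTheory.ok_over h hk

theorem hasFused_of_rel [WeldedTheory T]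
    (h : T.rel (tri .over .virt .over) (tri' .over .virt .over)) :
    HasFused T :=
  fun _ _ hk => u_tri ReidTheory.ok_over WeldedTheory.ok_virt ReidTheory.ok_over h hk

theorem good_band [ReidTheory T] {x : Crossing} (hx : T.ok x) :
    T.Good [cr 1 x, cr 0 x, cr 2 x, cr 1 x] := by
  intro k y hy
  simp only [cr, List.mem_cons, Prod.mk.injEq, Gen.cross.injEq, List.not_mem_nil, or_false] at hy
  rcases hy with ⟨-, rfl⟩ | ⟨-, rfl⟩ | ⟨-, rfl⟩ | ⟨-, rfl⟩ <;> exact hx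

theorem braidUnit_band [ReidTheory T] (p k : ℕ) (x : Crossing) :
    braidUnit T p (shift k [cr 1 x, cr 0 x, cr 2 x, cr 1 x]) = band T p k x := by
  simp [braidUnit, shift, cr, band, mul_assoc]

theorem braidUnit_tri [ReidTheory T] (p k : ℕ) (x y z : Crossing) :
    braidUnit T p (shift k (tri x y z)) = u T p k x * u T p (k + 1) y * u T p k z := by
  simp [braidUnit, shift, cr, tri, mul_assoc]

theorem braidUnit_tri' [ReidTheory T] (p k : ℕ) (x y z : Crossing) :
    braidUnit T p (shift k (tri' x y z)) = u T p (k + 1) z * u T p k y * u T p (k + 1) x := by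
  simp [braidUnit, shift, cr, tri', mul_assoc]

theorem braidUnit_cross [ReidTheory T] (p k : ℕ) (x : Crossing) :
    braidUnit T p (shift k [cr 0 x]) = u T p k x := by
  simp [braidUnit, shift, cr]

theorem hasBandPass_of_rel [ReidTheory T] (h : ∀ u u', BPRel u u' → T.rel u u') :
    HasBandPass T := by
  intro n k hk
  rw [← braidUnit_band, ← braidUnit_band]
  refine braidUnit_eq_of_rel (isBraid_band _ _ _ _) (isBraid_band _ _ _ _)
    (good_band ReidTheory.ok_over) (good_band ReidTheory.ok_under) (h _ _ .mk) ?_ ?_ <;>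
  · simp [cr]
    omega

theorem hasWeldedBandPass_weldedTheory : HasWeldedBandPass (weldedTheory WBPRel) := by
  intro n k hk
  have h := braidUnit_eq_of_rel (T := weldedTheory WBPRel) (k := k) (p := n)
    (isBraid_band _ _ _ _) (isBraid_weldedBand _ _ _ _ _ _)
      (good_weldedTheory _) (good_weldedTheory _)
    (Or.inr (Or.inr .mk)) (by simp [cr]; omega) (by simp [cr]; omega)
  rw [braidUnit_band] at h
  rw [h]
  simp [braidUnit, shift, cr, mul_assoc]

theorem HasDelta.mk_eq [ReidTheory T] (h : HasDelta T) {n : ℕ} {D D' : Word}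
    (hD : IsTangle n D n ∧ T.Good D) (hD' : IsTangle n D' n ∧ T.Good D') (hDD' : Delta D D') :
    Hom.mk D hD.1 hD.2 = Hom.mk D' hD'.1 hD'.2 := by
  refine mk_eq_of_locally ?_ hD hD' hDD'
  rintro _ _ ⟨⟩
  refine ⟨isBraid_tri _ _ _, isBraid_tri' _ _ _, fun p k hk _ => ?_⟩
  rw [braidUnit_tri, braidUnit_tri', ← u_over_inv, ← u_over_inv]
  exact h p k (by simp [tri, cr] at hk; omega)

theorem HasFused.mk_eq [WeldedTheory T] (h : HasFused T) {n : ℕ} {D D' : Word}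
    (hD : IsTangle n D n ∧ T.Good D) (hD' : IsTangle n D' n ∧ T.Good D') (hDD' : F D D') :
    Hom.mk D hD.1 hD.2 = Hom.mk D' hD'.1 hD'.2 := by
  refine mk_eq_of_locally ?_ hD hD' hDD'
  rintro _ _ ⟨⟩
  refine ⟨isBraid_tri _ _ _, isBraid_tri' _ _ _, fun p k hk _ => ?_⟩
  rw [braidUnit_tri, braidUnit_tri']
  exact h p k (by simp [tri, cr] at hk; omega)

theorem HasBandPass.mk_eq [ReidTheory T] (h : HasBandPass T) {n : ℕ} {D D' : Word}
    (hD : IsTangle n D n ∧ T.Good D) (hD' : IsTangle n D' n ∧ T.Good D') (hDD' : BP D D') :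
    Hom.mk D hD.1 hD.2 = Hom.mk D' hD'.1 hD'.2 := by
  refine mk_eq_of_locally ?_ hD hD' hDD'
  rintro _ _ ⟨⟩
  refine ⟨isBraid_band _ _ _ _, isBraid_band _ _ _ _, fun p k hk _ => ?_⟩
  rw [braidUnit_band, braidUnit_band]
  exact h p k (by simp [cr] at hk; omega)

theorem cGenerates_CC_BP : CGenerates CC BP := by
  refine cGenerates_of_mk_eq (fun _ _ h => h.strandEquiv) fun n D D' hD hD' h =>
    HasBandPass.mk_eq ?_ hD hD' h
  intro p k hk
  have key (j : ℕ) (hj : j + 2 ≤ p) : u (classicalTheory CCRel) p j .over = u _ p j .under := by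
    rw [← braidUnit_cross, ← braidUnit_cross]
    refine braidUnit_eq_of_rel (isBraid_nil.cons _ _) (isBraid_nil.cons _ _)
      (Theory.good_cross ReidTheory.ok_over) (Theory.good_cross ReidTheory.ok_under)
      (Or.inr (Or.inr .mk)) ?_ ?_ <;>
    simpa [cr] using hj
  rw [band, band, key _ (by omega), key _ (by omega), key _ (by omega)]

theorem cGenerates_BP_Delta : CGenerates BP Delta :=
  cGenerates_of_mk_eq (fun _ _ h => h.strandEquiv) fun _ _ _ hD hD' h =>
    (hasBandPass_of_rel fun _ _ h => Or.inr (Or.inr h)).hasDelta.mk_eq hD hD' h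

theorem cGenerates_Delta_SC : CGenerates Delta SC := by
  refine cGenerates_of_mk_eq (fun _ _ h => h.strandEquiv) ?_
  rintro n _ _ hD hD' ⟨A, B, k, x, x', ⟨rfl, rfl⟩, rfl, rfl, h⟩
  have S := (hasDelta_of_rel (T := classicalTheory DeltaRel) (Or.inr (Or.inr .mk))).slider
    fun _ hx => hx
  -- σ⁻²σ = σ⁻¹.
  refine S.mk_eq_of_selfCrossing (l := [.under, .under]) (Or.inr rfl) (fun m => ?_) hD hD' h
  simp only [twist_cons, twist_nil, mul_one, ← u_over_inv]
  group

theorem virtualization (x : Crossing) {p k : ℕ} (hk : k + 2 ≤ p) :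
    u (weldedTheory VRel) p k x = u _ p k .virt := by
  by_cases hx : x.IsClassical
  · rw [← braidUnit_cross, ← braidUnit_cross]
    refine braidUnit_eq_of_rel (isBraid_nil.cons _ _) (isBraid_nil.cons _ _)
      (good_weldedTheory _) (good_weldedTheory _) (Or.inr (Or.inr (.mk x hx))) ?_ ?_ <;>
    simpa [cr] using hk
  · rw [not_not.1 hx]

theorem wGenerates_V_CC : WGenerates V CC := by
  refine wGenerates_of_mk_eq (fun _ _ h => h.strandEquiv) fun n D D' hD hD' h =>
    mk_eq_of_locally ?_ hD hD' h
  rintro _ _ ⟨⟩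
  refine ⟨isBraid_nil.cons _ _, isBraid_nil.cons _ _, fun p k hk _ => ?_⟩
  have hk : k + 2 ≤ p := by simpa [cr] using hk
  rw [braidUnit_cross, braidUnit_cross, virtualization _ hk, virtualization .under hk]

theorem wGenerates_V_WBP : WGenerates V WBP := by
  refine wGenerates_of_mk_eq (fun _ _ h => h.strandEquiv) fun n D D' hD hD' h =>
    mk_eq_of_locally ?_ hD hD' h
  rintro _ _ ⟨⟩
  refine ⟨isBraid_band _ _ _ _, isBraid_weldedBand _ _ _ _ _ _, fun p k hk _ => ?_⟩
  have hk : k + 4 ≤ p := by simp [cr] at hk; omega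
  have h0 (x : Crossing) := virtualization x (p := p) (k := k) (by omega)
  have h1 (x : Crossing) := virtualization x (p := p) (k := k + 1) (by omega)
  have h2 (x : Crossing) := virtualization x (p := p) (k := k + 2) (by omega)
  simp only [braidUnit, shift, cr, List.map_cons, List.map_nil, mul_one, add_zero]
  rw [h0 .over, h0 .under, h1 .over, h1 .under, h2 .over, h2 .under, u_virt_mul_self, mul_one]

theorem wGenerates_WBP_F : WGenerates WBP F :=
  wGenerates_of_mk_eq (fun _ _ h => h.strandEquiv) fun _ _ _ hD hD' h =>
    hasWeldedBandPass_weldedTheory.hasFused.mk_eq hD hD' h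

theorem wGenerates_WBP_BP : WGenerates WBP BP :=
  wGenerates_of_mk_eq (fun _ _ h => h.strandEquiv) fun _ _ _ hD hD' h =>
    hasWeldedBandPass_weldedTheory.hasBandPass.mk_eq hD hD' h

theorem hasFused_weldedTheory : HasFused (weldedTheory FRel) :=
  hasFused_of_rel (Or.inr (Or.inr .mk))

theorem wGenerates_F_Delta : WGenerates F Delta :=
  wGenerates_of_mk_eq (fun _ _ h => h.strandEquiv) fun _ _ _ hD hD' h =>
    hasFused_weldedTheory.hasDelta.mk_eq hD hD' h

theorem wGenerates_F_SV : WGenerates F SV := by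
  refine wGenerates_of_mk_eq (fun _ _ h => h.strandEquiv) ?_
  rintro n _ _ hD hD' ⟨A, B, k, x, x', ⟨-, rfl⟩, rfl, rfl, h⟩
  -- The inverse of the crossing cancels it, and only the virtual crossing remains.
  refine hasFused_weldedTheory.slider.mk_eq_of_selfCrossing (l := [.virt, x.rot])
    ⟨x.rot, Or.inr rfl⟩ (fun m => ?_) hD hD' h
  rw [twist_cons, twist_cons, twist_nil, mul_one, ← u_inv, inv_mul_cancel_right]

theorem sameStrand_change_cross {A B : Word} {k i j : ℕ} {x y : Crossing}
    (h : SameStrand (A ++ (k, .cross x) :: B) (A.length, i) (A.length, j)) :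
    SameStrand (A ++ (k, .cross y) :: B) (A.length, i) (A.length, j) := by
  obtain ⟨f, -, hf, -⟩ := ((strandEquiv_cross x y).shift k).append_right B
  have h1 := SameStrand.map (hf.append_left A).adj h
  have h2 (i : ℕ) := extendBelow_of_le hf.bot A (x := (A.length, i)) le_rfl
  exact (h2 i).symm.trans (h1.trans (h2 j))

/-- SV is not a move of the form `Locally`, so the quotient category is not used. Both crossings are
virtualized to the same diagram; the change of the crossing leaves the strands, hence the
self-crossing condition, intact. -/
theorem realizes_SV_SC {K : Set Word} {R : Word → Word → Prop}
    (hK : ∀ (A B : Word) (k : ℕ) (x y : Crossing), A ++ (k, .cross x) :: B ∈ K →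
      A ++ (k, .cross y) :: B ∈ K) : Realizes K R SV SC := by
  rintro _ hD _ hD' ⟨A, B, k, x, x', ⟨rfl, rfl⟩, rfl, rfl, h⟩
  refine .trans _ (A ++ (k, .cross .virt) :: B) _ (.rel _ _ ⟨hD, hK _ _ _ _ _ hD, ?_⟩)
    (.symm _ _ (.rel _ _ ⟨hD', hK _ _ _ _ _ hD, ?_⟩))
  · exact Or.inr (Or.inr ⟨A, B, k, .over, .virt, ⟨nofun, rfl⟩, rfl, rfl, h⟩)
  · exact Or.inr (Or.inr ⟨A, B, k, .under, .virt, ⟨nofun, rfl⟩, rfl, rfl,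
      sameStrand_change_cross h⟩)

theorem isTangle_change_cross {A B : Word} {k n p : ℕ} {x y : Crossing}
    (h : IsTangle n (A ++ (k, .cross x) :: B) p) : IsTangle n (A ++ (k, .cross y) :: B) p := by
  obtain ⟨q, hA, hB⟩ := isTangle_append.1 h
  obtain ⟨r, h1, h2⟩ := isTangle_cons.1 hB
  exact hA.append (isTangle_cons.2 ⟨r, h1, h2⟩)

theorem wGenerates_SV_SC : WGenerates SV SC := by
  refine ⟨fun n => realizes_SV_SC fun A B k x y h => ?_,
    realizes_SV_SC fun A B k x y h => isTangle_change_cross h⟩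
  exact ((((strandEquiv_cross x y).shift k).append_right B).append_left A).isStringLink
    (isTangle_change_cross h.1) h

end LocalMoves

theorem mainTheorem3 :
    (LocalMoves.CGenerates LocalMoves.CC LocalMoves.BP ∧
      LocalMoves.CGenerates LocalMoves.BP LocalMoves.Delta ∧
      LocalMoves.CGenerates LocalMoves.Delta LocalMoves.SC) ∧
    (LocalMoves.WGenerates LocalMoves.V LocalMoves.WBP ∧
      LocalMoves.WGenerates LocalMoves.WBP LocalMoves.F ∧
      LocalMoves.WGenerates LocalMoves.F LocalMoves.SV) ∧
    (LocalMoves.WGenerates LocalMoves.V LocalMoves.CC ∧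
      LocalMoves.WGenerates LocalMoves.WBP LocalMoves.BP ∧
      LocalMoves.WGenerates LocalMoves.F LocalMoves.Delta ∧
      LocalMoves.WGenerates LocalMoves.SV LocalMoves.SC) :=
  ⟨⟨LocalMoves.cGenerates_CC_BP, LocalMoves.cGenerates_BP_Delta, LocalMoves.cGenerates_Delta_SC⟩,
    ⟨LocalMoves.wGenerates_V_WBP, LocalMoves.wGenerates_WBP_F, LocalMoves.wGenerates_F_SV⟩,
    LocalMoves.wGenerates_V_CC, LocalMoves.wGenerates_WBP_BP, LocalMoves.wGenerates_F_Delta,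
    LocalMoves.wGenerates_SV_SC⟩
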